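/- Fix a schema $\mathcal S$ (finitely many relation symbols, each of arity at least $1$) and $k\ge 0$. A $k$-ary conjunctive query (CQ) $q(x_1,\dots,x_k)\text{ :- }\alpha_1\wedge\dots\wedge\alpha_n$ over $\mathcal S$ is a conjunction of relational atoms in which every answer variable $x_i$ occurs (the $x_i$ need not be distinct). Its canonical structure $\widehat q$ has as elements the variables that occur in $q$, as facts the conjuncts of $q$, and as distinguished elements $x_1,\dots,x_k$. The query $q$ is *c-acyclic* if every cycle in the incidence multigraph of $\widehat q$ (nodes: elements and facts; one edge for each occurrence of an element in a fact) contains a distinguished element. The *membership oracle* for $q$ takes a finite structure $A$ over $\mathcal S$ with a $k$-tuple $\mathbf a$ of its elements, and answers whether $\mathbf a\in q(A)$. The *size* of $q$ is the number of elements, facts and distinguished elements of $\widehat q$. **Theorem.** For each schema $\mathcal S$ and each $k\ge 0$, the class of c-acyclic $k$-ary CQs over $\mathcal S$ is efficiently exactly learnable with membership queries: there are an algorithm, which takes no input but has access to a membership oracle, and a polynomial $p$ such that, for every c-acyclic $k$-ary CQ $q$ over $\mathcal S$, the algorithm, run with the membership oracle for $q$, halts within time $p(\mathrm{size}(q))$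 and outputs a c-acyclic $k$-ary CQ over $\mathcal S$ that is logically equivalent to $q$. -/

import Mathlib

namespace CQLearning

/-! ## Schemas, structures, conjunctive queries -/

/-- A schema: finitely many relation symbols, each with an arity of at least one. -/
structure Schema where
  numRel : ℕ
  arity : Fin numRel → ℕ
  arity_pos : ∀ r, 1 ≤ arity r

/-- An expression `R(a₁, …, aₙ)` with `R` a relation symbol of arity `n` and `aᵢ : A`.
It is a fact of a structure if the `aᵢ` are elements, and an atomic formula if they are
variables. -/
structure Atom (S : Schema) (A : Type) where
  rel : Fin S.numRel
  args : Fin (S.arity rel) → A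

/-- Replace every argument `a` of an atom by `g a`. -/
def Atom.map {S : Schema} {A B : Type} (g : A → B) (f : Atom S A) : Atom S B :=
  ⟨f.rel, fun j => g (f.args j)⟩

/-- A finite structure over the schema `S`, given by its domain and its facts. -/
structure Str (S : Schema) where
  Dom : Type
  finite_dom : Finite Dom
  facts : Set (Atom S Dom)

/-- A finite structure with `k` distinguished elements (repetitions are allowed). -/
structure PStr (S : Schema) (k : ℕ) extends Str S where
  pt : Fin k → Dom

/-- `A.IsCycle m a f i j` says that
`a 0, f 0, a 1, f 1, …, a m, f m, a 0` is a cycle in the incidence multigraph of `A`. The nodes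
of this bipartite multigraph are the elements and the facts of `A`, and its edges are the
occurrences of an element in a fact, an occurrence being a fact with an argument position.
The cycle leaves `a t` by the edge at position `i t` of `f t` and reaches
`a (t + 1)` by the edge at position `j t` of `f t`; the index `t + 1` is cyclic, so that
`a (m + 1) = a 0`. For `m = 0` this is a pair of parallel edges, that is, an element that occurs
twice in the fact `f 0`. -/
structure PStr.IsCycle {S : Schema} {k : ℕ} (A : PStr S k) (m : ℕ)
    (a : Fin (m + 1) → A.Dom) (f : Fin (m + 1) → Atom S A.Dom)
    (i j : ∀ t, Fin (S.arity (f t).rel)) : Prop where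
  facts_mem : ∀ t, f t ∈ A.facts
  elements_distinct : Function.Injective a
  facts_distinct : Function.Injective f
  leave : ∀ t, (f t).args (i t) = a t
  arrive : ∀ t, (f t).args (j t) = a (t + 1)
  edges_distinct : ∀ t, i t ≠ j t

/-- A structure with distinguished elements is c-acyclic if every cycle of its incidence
multigraph contains a distinguished element. -/
def PStr.CAcyclic {S : Schema} {k : ℕ} (A : PStr S k) : Prop :=
  ∀ (m : ℕ) (a : Fin (m + 1) → A.Dom) (f : Fin (m + 1) → Atom S A.Dom)
    (i j : ∀ t, Fin (S.arity (f t).rel)),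
    A.IsCycle m a f i j → ∃ t, ∃ l, a t = A.pt l

/-- A `k`-ary conjunctive query `q(x₁, …, x_k) :- α₁ ∧ … ∧ αₙ`. Variables are natural numbers,
`head` lists the answer variables (repetitions are allowed), `body` lists the conjuncts,
and every answer variable occurs in a conjunct. -/
structure CQ (S : Schema) (k : ℕ) where
  head : Fin k → ℕ
  body : List (Atom S ℕ)
  safe : ∀ l, ∃ f ∈ body, ∃ j, f.args j = head l

namespace CQ

variable {S : Schema} {k : ℕ}

/-- The type of the variables that occur in `q`. -/
def Var (q : CQ S k) : Type := {v : ℕ // ∃ f ∈ q.body, ∃ j, f.args j = v}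

theorem finite_var (q : CQ S k) : Finite q.Var := by
  have h : {v : ℕ | ∃ f ∈ q.body, ∃ j, f.args j = v} =
      ⋃ f ∈ {f | f ∈ q.body}, Set.range f.args := by
    ext v; simp
  have hfin : {v : ℕ | ∃ f ∈ q.body, ∃ j, f.args j = v}.Finite := by
    rw [h]
    exact (List.finite_toSet q.body).biUnion fun f _ => Set.finite_range f.args
  exact hfin.to_subtype

/-- The answer variables of `q`. -/
def headVar (q : CQ S k) (l : Fin k) : q.Var := ⟨q.head l, q.safe l⟩

/-- The conjuncts of `q`, as atoms over the variables that occur in `q`. -/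
def conjuncts (q : CQ S k) : Set (Atom S q.Var) :=
  {f | f.map Subtype.val ∈ q.body}

/-- `q(A)`: the set of all `k`-tuples that satisfy `q` in the structure `A`. -/
def answers (q : CQ S k) (A : Str S) : Set (Fin k → A.Dom) :=
  {x | ∃ ν : q.Var → A.Dom,
    (∀ f ∈ q.conjuncts, f.map ν ∈ A.facts) ∧ ∀ l, ν (q.headVar l) = x l}

/-- Logical equivalence: the same answers in all (finite) structures. -/
def Equivalent (q q' : CQ S k) : Prop := ∀ A : Str S, q.answers A = q'.answers A

/-- The canonical structure of `q`: the elements are the variables that occur in `q`, the facts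
are the conjuncts, and the distinguished elements are the answer variables. -/
def canonical (q : CQ S k) : PStr S k where
  Dom := q.Var
  finite_dom := q.finite_var
  facts := q.conjuncts
  pt := q.headVar

/-- A conjunctive query is c-acyclic if its canonical structure is. -/
def CAcyclic (q : CQ S k) : Prop := q.canonical.CAcyclic

/-- The size of `q`: the number of elements, of facts, and of distinguished elements of its
canonical structure. -/
noncomputable def size (q : CQ S k) : ℕ := Nat.card q.Var + q.conjuncts.ncard + k

end CQ

/-! ## Data and representations -/

/-- The data that programs work on: finite binary trees. -/
inductive Data where
  | nil : Data
  | cons : Data → Data → Data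

namespace Data

/-- The number of nodes of a tree, leaves included. -/
def size : Data → ℕ
  | nil => 1
  | cons a b => a.size + b.size + 1

/-- Natural numbers in unary. -/
def ofNat : ℕ → Data
  | 0 => nil
  | n + 1 => cons nil (ofNat n)

/-- Finite lists. -/
def ofList : List Data → Data
  | [] => nil
  | d :: l => cons d (ofList l)

/-- Truth values: `nil` is false, and `cons nil nil` is true. -/
def ofBool : Bool → Data
  | false => nil
  | true => cons nil nil

end Data

/-- The representation of an atom whose arguments are natural numbers. -/
def Atom.encode {S : Schema} (f : Atom S ℕ) : Data :=
  .cons (.ofNat f.rel) (.ofList (List.ofFn fun j => .ofNat (f.args j)))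

/-- The representation of a conjunctive query. -/
def CQ.encode {S : Schema} {k : ℕ} (q : CQ S k) : Data :=
  .cons (.ofList (List.ofFn fun l => .ofNat (q.head l))) (.ofList (q.body.map Atom.encode))

/-- A finite structure with `k` distinguished elements, listed explicitly: its domain is
`{0, …, n - 1}`, and its facts are the members of `facts`. Every finite structure with `k`
distinguished elements is isomorphic to one that is listed in this way. -/
structure Example (S : Schema) (k : ℕ) where
  n : ℕ
  facts : List (Atom S (Fin n))
  pt : Fin k → Fin n

/-- The structure that is listed. -/
def Example.toPStr {S : Schema} {k : ℕ} (E : Example S k) : PStr S k where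
  Dom := Fin E.n
  finite_dom := inferInstance
  facts := {f | f ∈ E.facts}
  pt := E.pt

/-- The representation of an example. -/
def Example.encode {S : Schema} {k : ℕ} (E : Example S k) : Data :=
  .cons (.ofNat E.n)
    (.cons (.ofList (List.ofFn fun l => .ofNat (E.pt l)))
      (.ofList (E.facts.map fun f => (f.map Fin.val).encode)))

/-- The membership oracle for `q`: it answers "yes" to `d` exactly if `d` represents a positive
example, that is, a structure whose distinguished tuple is an answer of `q`. -/
def CQ.Mem {S : Schema} {k : ℕ} (q : CQ S k) (d : Data) : Prop :=
  ∃ E : Example S k, E.encode = d ∧ E.toPStr.pt ∈ q.answers E.toPStr.toStr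

/-! ## Oracle programs and their running time -/

/-- Programs of the WHILE language on binary trees (`cons`, head, tail, test for `nil`, sequential
composition, conditional, while loop), extended by oracle calls. The memory of a program is
one tree, which can hold any fixed number of variables as its subtrees. -/
inductive Prog where
  /-- return the input -/
  | id : Prog
  /-- return the tree `nil` -/
  | nil : Prog
  /-- return the left subtree of the input, or `nil` if the input is `nil` -/
  | fst : Prog
  /-- return the right subtree of the input, or `nil` if the input is `nil` -/
  | snd : Prog
  /-- ask the oracle about the input, and return its answer as a truth value -/
  | oracle : Prog
  /-- run `P` and `Q` on the input and return `cons` of the two results -/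
  | pair (P Q : Prog) : Prog
  /-- run `P`, then run `Q` on the result -/
  | seq (P Q : Prog) : Prog
  /-- run `P` if the test `C` returns something else than `nil` on the input, otherwise `Q` -/
  | ite (C P Q : Prog) : Prog
  /-- as long as the test `C` returns something else than `nil`, run `P` -/
  | while (C P : Prog) : Prog

/-- `Runs O P x y t`: with the oracle `O`, the program `P` halts on the input `x` with the output
`y`, in time `t`. Every elementary operation, an oracle call included, is charged the size of its
whole input, and every control construct is charged one more step. As copying and writing
are paid for, the size of every tree that occurs in a run is at most linear in the time spent,
and time in this model is polynomially related to time on (oracle) Turing machines. -/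
inductive Runs (O : Data → Prop) : Prog → Data → Data → ℕ → Prop
  | id (x) : Runs O .id x x x.size
  | nil (x) : Runs O .nil x .nil x.size
  | fst_nil : Runs O .fst .nil .nil Data.nil.size
  | fst_cons (a b) : Runs O .fst (.cons a b) a (Data.cons a b).size
  | snd_nil : Runs O .snd .nil .nil Data.nil.size
  | snd_cons (a b) : Runs O .snd (.cons a b) b (Data.cons a b).size
  | oracle_yes (x) : O x → Runs O .oracle x (.ofBool true) x.size
  | oracle_no (x) : ¬ O x → Runs O .oracle x (.ofBool false) x.size
  | pair {P Q x y z s t} : Runs O P x y s → Runs O Q x z t →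
      Runs O (.pair P Q) x (.cons y z) (s + t + 1)
  | seq {P Q x y z s t} : Runs O P x y s → Runs O Q y z t →
      Runs O (.seq P Q) x z (s + t + 1)
  | ite_true {C P Q x a b y s t} : Runs O C x (.cons a b) s → Runs O P x y t →
      Runs O (.ite C P Q) x y (s + t + 1)
  | ite_false {C P Q x y s t} : Runs O C x .nil s → Runs O Q x y t →
      Runs O (.ite C P Q) x y (s + t + 1)
  | while_done {C P x s} : Runs O C x .nil s → Runs O (.while C P) x x (s + x.size + 1)
  | while_step {C P x a b y z s t u} : Runs O C x (.cons a b) s → Runs O P x y t →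
      Runs O (.while C P) y z u → Runs O (.while C P) x z (s + t + u + 1)

/-! ## Efficient exact learnability -/

/-- A class `C` of `k`-ary conjunctive queries over `S` is efficiently exactly learnable with
membership queries: there are one program, which gets no input (it starts on `nil`), and one
polynomial `p`, such that for every goal query `q ∈ C` the program, with the membership oracle
for `q` as its oracle, halts within time `p (size of q)`, and its output represents a query in `C`
that is logically equivalent to `q`.
The run depends only on the oracle, thus on `q` up to logical equivalence, so
the bound holds with the size of the smallest query in `C` that is equivalent to `q`. -/
def EfficientlyExactlyLearnable {S : Schema} {k : ℕ} (C : Set (CQ S k)) : Prop :=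
  ∃ (P : Prog) (p : Polynomial ℕ), ∀ q ∈ C, ∃ q' ∈ C, ∃ t : ℕ,
    Runs q.Mem P .nil q'.encode t ∧ q'.Equivalent q ∧ t ≤ p.eval q.size

end CQLearning

/-!
The goal query `q` is learned by growing a structure `A` that is a *critical* positive example: it
is positive, that is, `q` maps to it homomorphically, and no proper subset of its facts is. A
critical example is a homomorphic image of `q` (`Crit.image_eq`), so it has at most as many
elements and facts as `q`, and any positive example can be turned into a critical one by greedily
dropping facts, at the cost of one oracle call per fact (`crit_minimize`). The first example is
made from the structure of all facts over `k + 1` elements, with distinguished elements that have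
the same equality pattern as the answer variables (`exists_initial`).

To enlarge `A`, the algorithm labels the arguments of its facts in all possible ways, from a set
of labels of polynomial size (`blowup`); this is polynomial since the arities are bounded.
Distinguished elements keep a dummy label. The blow-up is positive, and it is minimized to a
critical example `K`, which maps back to `A`. Either `K` is larger than `A`, and replaces it, or
the map has a section, which is a choice of one label for each element of `A`
(`Crit.exists_section`). As the number of elements and facts is bounded by that of `q`, there are
only linearly many replacements. The facts that are processed first by the minimization are
dropped if this is possible at all, and this is used to exclude a section in two situations.

* *`A` has a cycle that avoids the distinguished elements.* The labels of an element name the fact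
  that is its parent, a position in this fact, and a depth, counted modulo the number of elements
  plus one. Since `q` is c-acyclic, its facts form a forest (`Acyc.exists_forestRank`), so that it
  maps to the facts with consistent labels (`Pos.cover`), and the others are dropped first. A
  section with consistent labels would direct each cycle, and the depth would increase by one at
  each step of the cycle, which is too short for that (`acyc_of_section`).
* *`A` is c-acyclic, but does not map to `q`.* Now `A` is a forest, and one of its trees does not
  map to `q` (`exists_hom_of_realized`). The labels of an element are facts. An element of `q`
  over an element `v` of this tree is labelled with a child fact of `v` in whose direction the
  tree does not embed, or with the fact that introduces `v` if there is no such child. Thereby `q`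
  maps to the blow-up without the facts over the tree whose arguments all point to the fact itself
  (`Pos.weaken`); these are dropped first. In a section, each fact would then have an argument
  that points to one of its children, which is impossible in a finite tree (`no_section`).

When neither expansion yields a larger structure, `A` is c-acyclic and maps to `q`. As `q` maps to
`A`, the query whose canonical structure is `A` is equivalent to `q` (`Inv.exists_output`).

For the running time, `PolyTime` collects the functions that a single program computes in
polynomial time with any oracle. It is closed under composition, case distinction, and iterations
over lists with results of polynomial size (`PolyTime.foldl`), which covers one round of the
algorithm. The main loop is bounded by the size of `q`, as are its intermediate structures
(`Inv.sz_le`).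
-/

namespace CQLearning

/-! ### Polynomial-time computable functions -/

/-- Types whose elements are represented by trees. -/
class Enc (α : Type) where
  enc : α → Data

open Enc (enc)

instance : Enc ℕ := ⟨Data.ofNat⟩
instance : Enc Bool := ⟨Data.ofBool⟩
instance : Enc Unit := ⟨fun _ => Data.nil⟩
instance {α : Type} [Enc α] : Enc (List α) := ⟨fun l => Data.ofList (l.map enc)⟩
instance {α β : Type} [Enc α] [Enc β] : Enc (α × β) := ⟨fun p => .cons (enc p.1) (enc p.2)⟩

/-- The size of the representation of `a`. -/
def sz {α : Type} [Enc α] (a : α) : ℕ := (enc a).size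

/-- Membership oracles, seen as arguments of computable functions. -/
abbrev Oracle := Data → Prop

/-- `f` is computed in polynomial time by a single program that works for all oracles; `f` may
depend on the oracle. -/
def PolyTime {α β : Type} [Enc α] [Enc β] (f : Oracle → α → β) : Prop :=
  ∃ (P : Prog) (p : Polynomial ℕ), ∀ O a, ∃ t,
    Runs O P (enc a) (enc (f O a)) t ∧ t ≤ p.eval (sz a)

theorem eval_mono (p : Polynomial ℕ) : Monotone fun n => p.eval n := by
  intro a b h
  simp only [Polynomial.eval_eq_sum_range]
  exact Finset.sum_le_sum fun i _ => Nat.mul_le_mul_left _ (Nat.pow_le_pow_left h _)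

theorem Data.size_pos (d : Data) : 1 ≤ d.size := by cases d <;> simp [Data.size]

theorem Runs.size_le {O : Oracle} {P : Prog} {x y : Data} {t : ℕ} (h : Runs O P x y t) :
    y.size ≤ 3 * t := by
  induction h <;> (try simp only [Data.size, Data.ofBool] at *) <;> try omega
  case nil x => have := x.size_pos; omega
  case oracle_yes x _ => cases x <;> simp only [Data.size] <;> omega
  case oracle_no x _ => cases x <;> simp only [Data.size] <;> omega

section

variable {α β γ X A B : Type} [Enc α] [Enc β] [Enc γ] [Enc X] [Enc A] [Enc B]

theorem sz_pos (a : α) : 1 ≤ sz a := Data.size_pos _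

@[simp] theorem sz_pair (a : α) (b : β) : sz (a, b) = sz a + sz b + 1 := rfl

@[simp] theorem sz_nil : sz ([] : List α) = 1 := rfl

@[simp] theorem sz_cons (a : α) (l : List α) : sz (a :: l) = sz a + sz l + 1 := rfl

theorem sz_bool_le (b : Bool) : sz b ≤ 3 := by cases b <;> simp [sz, enc, Data.ofBool, Data.size]

@[simp] theorem sz_nat (n : ℕ) : sz n = 2 * n + 1 := by
  induction n with
  | zero => rfl
  | succ n ih =>
    have : sz (n + 1) = 1 + sz n + 1 := rfl
    omega

theorem sz_append (l l' : List α) : sz (l ++ l') + 1 = sz l + sz l' := by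
  induction l with
  | nil => simp; omega
  | cons a l ih => simp only [List.cons_append, sz_cons]; omega

theorem sz_reverse (l : List α) : sz l.reverse = sz l := by
  induction l with
  | nil => rfl
  | cons a l ih =>
    have := sz_append l.reverse [a]
    simp only [List.reverse_cons, sz_cons, sz_nil] at *; omega

theorem sz_le_of_mem {a : α} {l : List α} (h : a ∈ l) : sz a ≤ sz l := by
  induction l with
  | nil => simp at h
  | cons b l ih =>
    rcases List.mem_cons.1 h with rfl | h
    · simp only [sz_cons]; omega
    · have := ih h; simp only [sz_cons]; omega

theorem sz_sublist {l l' : List α} (h : l.Sublist l') : sz l ≤ sz l' := by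
  induction h with
  | slnil => rfl
  | cons a _ ih => simp only [sz_cons]; omega
  | cons_cons a _ ih => simp only [sz_cons]; omega

theorem length_lt_sz (l : List α) : l.length < sz l := by
  induction l with
  | nil => simp
  | cons a l ih => simp only [List.length_cons, sz_cons]; omega

theorem sz_list_le {l : List α} {c : ℕ} (h : ∀ a ∈ l, sz a ≤ c) :
    sz l ≤ l.length * (c + 1) + 1 := by
  induction l with
  | nil => simp
  | cons a l ih =>
    have h1 := ih fun b hb => h b (List.mem_cons_of_mem _ hb)
    have h2 := h a (by simp)
    simp only [sz_cons, List.length_cons, Nat.add_mul, one_mul] at *; omega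

theorem PolyTime.sz_le {f : Oracle → α → β} (h : PolyTime f) :
    ∃ p : Polynomial ℕ, ∀ O a, sz (f O a) ≤ p.eval (sz a) := by
  obtain ⟨P, p, h⟩ := h
  refine ⟨3 * p, fun O a => ?_⟩
  obtain ⟨t, h1, h2⟩ := h O a
  have := h1.size_le
  simp only [Polynomial.eval_mul, Polynomial.eval_ofNat]
  unfold sz at *; omega

theorem PolyTime.id : PolyTime (fun _ (a : α) => a) :=
  ⟨.id, .X, fun O a => ⟨_, .id _, by simp [sz]⟩⟩

theorem PolyTime.comp {f : Oracle → α → β} {g : Oracle → β → γ} (hg : PolyTime g)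
    (hf : PolyTime f) : PolyTime (fun O a => g O (f O a)) := by
  obtain ⟨Q, q, hq⟩ := hg
  obtain ⟨P, p, hp⟩ := hf
  refine ⟨.seq P Q, p + q.comp (3 * p) + 1, fun O a => ?_⟩
  obtain ⟨s, hs, hs'⟩ := hp O a
  obtain ⟨t, ht, ht'⟩ := hq O (f O a)
  refine ⟨_, .seq hs ht, ?_⟩
  have h1 : sz (f O a) ≤ 3 * p.eval (sz a) := by have := hs.size_le; unfold sz at *; omega
  have h2 := eval_mono q h1
  simp only [Polynomial.eval_add, Polynomial.eval_comp, Polynomial.eval_mul,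
    Polynomial.eval_ofNat, Polynomial.eval_one] at *
  omega

theorem PolyTime.pair {f : Oracle → X → α} {g : Oracle → X → β} (hf : PolyTime f)
    (hg : PolyTime g) : PolyTime (fun O x => (f O x, g O x)) := by
  obtain ⟨P, p, hp⟩ := hf
  obtain ⟨Q, q, hq⟩ := hg
  refine ⟨.pair P Q, p + q + 1, fun O a => ?_⟩
  obtain ⟨s, hs, hs'⟩ := hp O a
  obtain ⟨t, ht, ht'⟩ := hq O a
  refine ⟨_, .pair hs ht, ?_⟩
  simp only [Polynomial.eval_add, Polynomial.eval_one]
  omega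

/-- Two functions with the same values on representations are equally computable. -/
theorem PolyTime.of_enc {β' : Type} [Enc β'] {f : Oracle → X → β} {f' : Oracle → X → β'}
    (hf : PolyTime f) (h : ∀ O x, enc (f O x) = enc (f' O x)) : PolyTime f' := by
  obtain ⟨P, p, hp⟩ := hf
  exact ⟨P, p, fun O a => by rw [← h]; exact hp O a⟩

theorem PolyTime.projFst : PolyTime (fun _ (a : α × β) => a.1) :=
  ⟨.fst, .X, fun O a => ⟨_, .fst_cons _ _, by simp [sz, enc]⟩⟩

theorem PolyTime.projSnd : PolyTime (fun _ (a : α × β) => a.2) :=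
  ⟨.snd, .X, fun O a => ⟨_, .snd_cons _ _, by simp [sz, enc]⟩⟩

theorem exists_runs_const (d : Data) :
    ∃ (P : Prog) (p : Polynomial ℕ), ∀ (O : Oracle) x, ∃ t, Runs O P x d t ∧ t ≤ p.eval x.size := by
  induction d with
  | nil => exact ⟨.nil, .X, fun O x => ⟨_, .nil _, by simp⟩⟩
  | cons a b iha ihb =>
    obtain ⟨P, p, hp⟩ := iha
    obtain ⟨Q, q, hq⟩ := ihb
    refine ⟨.pair P Q, p + q + 1, fun O a => ?_⟩
    obtain ⟨s, hs, hs'⟩ := hp O a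
    obtain ⟨t, ht, ht'⟩ := hq O a
    refine ⟨_, .pair hs ht, ?_⟩
    simp only [Polynomial.eval_add, Polynomial.eval_one]
    omega

theorem PolyTime.const (b : β) : PolyTime (fun _ (_ : α) => b) := by
  obtain ⟨P, p, h⟩ := exists_runs_const (enc b)
  exact ⟨P, p, fun O a => h O _⟩

/-- The oracle answer to the representation of `a`. -/
noncomputable def ask (O : Oracle) (a : α) : Bool := by
  classical exact decide (O (enc a))

theorem ask_eq_true {O : Oracle} {a : α} : ask O a = true ↔ O (enc a) := by simp [ask]

theorem PolyTime.ask : PolyTime (fun O (a : α) => ask O a) := by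
  refine ⟨.oracle, .X, fun O a => ?_⟩
  change ∃ t, Runs O .oracle (enc a) (enc (CQLearning.ask O a)) t ∧ _
  by_cases h : O (enc a)
  · refine ⟨_, ?_, (by simp [sz] : sz a ≤ _)⟩
    rw [ask_eq_true.2 h]
    exact .oracle_yes _ h
  · refine ⟨_, ?_, (by simp [sz] : sz a ≤ _)⟩
    rw [show CQLearning.ask O a = false by simpa [← ask_eq_true] using h]
    exact .oracle_no _ h

theorem PolyTime.ite {c : Oracle → X → Bool} {f g : Oracle → X → β} (hc : PolyTime c)
    (hf : PolyTime f) (hg : PolyTime g) :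
    PolyTime (fun O x => if c O x then f O x else g O x) := by
  obtain ⟨C, c', hc⟩ := hc
  obtain ⟨P, p, hp⟩ := hf
  obtain ⟨Q, q, hq⟩ := hg
  refine ⟨.ite C P Q, c' + p + q + 1, fun O a => ?_⟩
  obtain ⟨r, hr, hr'⟩ := hc O a
  obtain ⟨s, hs, hs'⟩ := hp O a
  obtain ⟨t, ht, ht'⟩ := hq O a
  simp only [Polynomial.eval_add, Polynomial.eval_one]
  cases h : c O a
  · rw [h] at hr
    exact ⟨_, .ite_false hr ht, by omega⟩
  · rw [h] at hr
    exact ⟨_, .ite_true hr hs, by omega⟩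

/-- Case distinction on a list. -/
def listCase (l : List A) (f : β) (g : A → List A → β) : β :=
  match l with
  | [] => f
  | a :: t => g a t

theorem PolyTime.listCase {l : Oracle → X → List A} {f : Oracle → X → β}
    {g : Oracle → X × A × List A → β} (hl : PolyTime l) (hf : PolyTime f) (hg : PolyTime g) :
    PolyTime (fun O x => listCase (l O x) (f O x) (fun a t => g O (x, a, t))) := by
  obtain ⟨L, l', hl⟩ := hl
  obtain ⟨P, p, hp⟩ := hf
  obtain ⟨Q, q, hq⟩ := hg
  refine ⟨.ite L (.seq (.pair .id L) Q) P,
    l' + p + (.X + l' + 1) + q.comp (3 * (.X + l' + 1)) + 2, fun O x => ?_⟩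
  obtain ⟨r, hr, hr'⟩ := hl O x
  obtain ⟨s, hs, hs'⟩ := hp O x
  simp only [Polynomial.eval_add, Polynomial.eval_one, Polynomial.eval_comp, Polynomial.eval_mul,
    Polynomial.eval_ofNat, Polynomial.eval_X]
  rcases h : l O x with - | ⟨a, t⟩
  · rw [h] at hr
    exact ⟨_, .ite_false hr hs, by omega⟩
  · obtain ⟨u, hu, hu'⟩ := hq O (x, a, t)
    rw [h] at hr
    have h1 := Runs.pair (Runs.id (O := O) (enc x)) hr
    refine ⟨_, .ite_true hr (.seq h1 hu), ?_⟩
    have h2 : sz (x, a, t) ≤ 3 * (sz x + l'.eval (sz x) + 1) := by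
      have := h1.size_le
      change sz (x, a, t) ≤ 3 * (sz x + r + 1) at this
      omega
    have h3 := eval_mono q h2
    change r + (sz x + r + 1 + u + 1) + 1 ≤ _
    dsimp only at h3
    omega

theorem PolyTime.cons {f : Oracle → X → α} {g : Oracle → X → List α} (hf : PolyTime f)
    (hg : PolyTime g) : PolyTime (fun O x => f O x :: g O x) :=
  (hf.pair hg).of_enc fun _ _ => rfl

/-- A while loop whose test and body are computed in polynomial time: if the loop passes through
the states `s 0, …, s m`, then its running time is at most `m + 1` times a polynomial in the
maximal size of the states. -/
theorem exists_runs_while {c : Oracle → α → Bool} {f : Oracle → α → α} (hc : PolyTime c)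
    (hf : PolyTime f) : ∃ (P : Prog) (p : Polynomial ℕ), ∀ (O : Oracle) (m σ : ℕ) (s : ℕ → α),
      (∀ i < m, c O (s i) = true ∧ s (i + 1) = f O (s i)) → c O (s m) = false →
      (∀ i ≤ m, sz (s i) ≤ σ) →
      ∃ t, Runs O P (enc (s 0)) (enc (s m)) t ∧ t ≤ (m + 1) * p.eval σ := by
  obtain ⟨C, c', hc⟩ := hc
  obtain ⟨P, p, hp⟩ := hf
  refine ⟨.while C P, c' + p + .X + 1, fun O m => ?_⟩
  induction m with
  | zero =>
    intro σ s _ h1 h2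
    obtain ⟨r, hr, hr'⟩ := hc O (s 0)
    rw [h1] at hr
    refine ⟨_, .while_done hr, ?_⟩
    have := eval_mono c' (h2 0 le_rfl)
    have h3 := h2 0 le_rfl
    simp only [Polynomial.eval_add, Polynomial.eval_one, Polynomial.eval_X]
    dsimp only at this
    change r + sz (s 0) + 1 ≤ _
    omega
  | succ m ih =>
    intro σ s h0 h1 h2
    obtain ⟨u, hu, hu'⟩ := ih σ (fun i => s (i + 1)) (fun i hi => h0 (i + 1) (by omega)) h1
      fun i hi => h2 (i + 1) (by omega)
    obtain ⟨r, hr, hr'⟩ := hc O (s 0)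
    obtain ⟨t, ht, ht'⟩ := hp O (s 0)
    rw [(h0 0 (by omega)).1] at hr
    rw [← (h0 0 (by omega)).2] at ht
    refine ⟨_, .while_step hr ht hu, ?_⟩
    have h3 := eval_mono c' (h2 0 (by omega))
    have h4 := eval_mono p (h2 0 (by omega))
    dsimp only at h3 h4
    simp only [Polynomial.eval_add, Polynomial.eval_one, Polynomial.eval_X] at *
    rw [Nat.add_mul (m + 1) 1]
    omega

/-- Iteration over a list, provided that the intermediate results are of polynomial size. -/
theorem PolyTime.foldl {l : Oracle → X → List A} {b : Oracle → X → B}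
    {st : Oracle → X × B × A → B} (hl : PolyTime l) (hb : PolyTime b) (hst : PolyTime st)
    (hbd : ∃ p : Polynomial ℕ, ∀ O x l', l' <+: l O x →
      sz (l'.foldl (fun b a => st O (x, b, a)) (b O x)) ≤ p.eval (sz x)) :
    PolyTime (fun O x => (l O x).foldl (fun b a => st O (x, b, a)) (b O x)) := by
  have hc : PolyTime (fun _ (s : X × B × List A) =>
      CQLearning.listCase s.2.2 false (fun _ _ => true)) :=
    PolyTime.listCase (g := fun _ _ => true) (PolyTime.projSnd.comp PolyTime.projSnd)
      (PolyTime.const _) (PolyTime.const _)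
  have hf : PolyTime (fun O (s : X × B × List A) =>
      CQLearning.listCase s.2.2 s (fun a t => (s.1, st O (s.1, s.2.1, a), t))) :=
    PolyTime.listCase (g := fun O (q : (X × B × List A) × A × List A) =>
      (q.1.1, st O (q.1.1, q.1.2.1, q.2.1), q.2.2))
      (PolyTime.projSnd.comp PolyTime.projSnd) PolyTime.id
      ((PolyTime.projFst.comp PolyTime.projFst).pair
        ((hst.comp ((PolyTime.projFst.comp PolyTime.projFst).pair
          ((PolyTime.projFst.comp (PolyTime.projSnd.comp PolyTime.projFst)).pair
            (PolyTime.projFst.comp PolyTime.projSnd)))).pair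
              (PolyTime.projSnd.comp PolyTime.projSnd)))
  obtain ⟨W, w, hW⟩ := exists_runs_while hc hf
  have hinit : PolyTime (fun O x => (x, b O x, l O x)) := PolyTime.id.pair (hb.pair hl)
  have hext : PolyTime (fun _ (s : X × B × List A) => s.2.1) :=
    PolyTime.projFst.comp PolyTime.projSnd
  obtain ⟨pl, hpl⟩ := hl.sz_le
  obtain ⟨pb, hpb⟩ := hbd
  obtain ⟨I, pI, hI⟩ := hinit
  obtain ⟨E, pE, hE⟩ := hext
  refine ⟨.seq I (.seq W E), pI + (pl + 1) * w.comp (.X + pb + pl + 2) +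
    pE.comp (.X + pb + pl + 2) + 2, fun O x => ?_⟩
  obtain ⟨r, hr, hr'⟩ := hI O x
  have hstate : ∀ i ≤ (l O x).length, sz (x, ((l O x).take i).foldl
      (fun b a => st O (x, b, a)) (b O x), (l O x).drop i) ≤
      (Polynomial.X + pb + pl + 2).eval (sz x) := by
    intro i _
    have h1 := hpb O x _ (List.take_prefix i (l O x))
    have h2 := sz_sublist (List.drop_sublist i (l O x))
    have h3 := hpl O x
    simp only [sz_pair, Polynomial.eval_add, Polynomial.eval_X, Polynomial.eval_ofNat]
    omega
  obtain ⟨t, ht, ht'⟩ := hW O (l O x).length _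
    (fun i => (x, ((l O x).take i).foldl (fun b a => st O (x, b, a)) (b O x), (l O x).drop i))
    (fun i hi => by
      rw [List.drop_eq_getElem_cons hi]
      refine ⟨rfl, ?_⟩
      dsimp only
      rw [List.take_succ_eq_append_getElem hi, List.foldl_append]
      rfl)
    (by simp [CQLearning.listCase]) hstate
  simp only [List.take_zero, List.drop_zero, List.take_length, List.drop_length,
    List.foldl_nil] at ht
  obtain ⟨u, hu, hu'⟩ := hE O (x, (l O x).foldl (fun b a => st O (x, b, a)) (b O x), [])
  refine ⟨_, .seq hr (.seq ht hu), ?_⟩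
  have h1 := hstate _ le_rfl
  simp only [List.take_length, List.drop_length] at h1
  have h2 := eval_mono pE h1
  dsimp only at h2
  have h3 : (l O x).length ≤ pl.eval (sz x) := (length_lt_sz _).le.trans (hpl O x)
  have h4 := Nat.mul_le_mul_right (w.eval ((Polynomial.X + pb + pl + 2).eval (sz x)))
    (Nat.add_le_add_right h3 1)
  simp only [Polynomial.eval_add, Polynomial.eval_mul, Polynomial.eval_comp, Polynomial.eval_one,
    Polynomial.eval_ofNat, Polynomial.eval_X] at *
  omega

/-- Iteration over a list, if each step increases the size of the intermediate result by a
polynomial amount only. -/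
theorem PolyTime.foldl_add {l : Oracle → X → List A} {b : Oracle → X → B}
    {st : Oracle → X × B × A → B} (hl : PolyTime l) (hb : PolyTime b) (hst : PolyTime st)
    (hbd : ∃ p : Polynomial ℕ, ∀ O x b, ∀ a ∈ l O x, sz (st O (x, b, a)) ≤ sz b + p.eval (sz x)) :
    PolyTime (fun O x => (l O x).foldl (fun b a => st O (x, b, a)) (b O x)) := by
  refine PolyTime.foldl hl hb hst ?_
  obtain ⟨p, hp⟩ := hbd
  obtain ⟨pl, hpl⟩ := hl.sz_le
  obtain ⟨pb, hpb⟩ := hb.sz_le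
  refine ⟨pb + pl * p, fun O x l' hl' => ?_⟩
  have key : ∀ (l' : List A) b0, (∀ a ∈ l', a ∈ l O x) →
      sz (l'.foldl (fun b a => st O (x, b, a)) b0) ≤ sz b0 + l'.length * p.eval (sz x) := by
    intro l'
    induction l' with
    | nil => intro b0 _; simp
    | cons a l' ih =>
      intro b0 h
      have h1 := ih (st O (x, b0, a)) fun a' ha' => h a' (by simp [ha'])
      have h2 := hp O x b0 a (h a (by simp))
      simp only [List.foldl_cons, List.length_cons, Nat.add_mul, one_mul]
      omega
  have h1 := key l' (b O x) fun a ha => hl'.subset ha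
  have h2 := hpb O x
  have h3 : l'.length ≤ pl.eval (sz x) :=
    (hl'.length_le.trans (length_lt_sz _).le).trans (hpl O x)
  have h4 := Nat.mul_le_mul_right (p.eval (sz x)) h3
  simp only [Polynomial.eval_add, Polynomial.eval_mul]
  omega

end

/-! ### Polynomial-time operations on lists and numbers -/

section

variable {A : Type} [DecidableEq A]

/-- The elements of a list, without repetitions. -/
def nub (l : List A) : List A := l.foldl (fun b a => if decide (a ∈ b) then b else a :: b) []

theorem nub_aux (l b : List A) (hb : b.Nodup) :
    (l.foldl (fun b a => if decide (a ∈ b) then b else a :: b) b).Nodup ∧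
    ∀ x, x ∈ l.foldl (fun b a => if decide (a ∈ b) then b else a :: b) b ↔ x ∈ b ∨ x ∈ l := by
  induction l generalizing b with
  | nil => simp [hb]
  | cons a l ih =>
    rw [List.foldl_cons]
    by_cases h : a ∈ b
    · simp only [h, decide_true, if_true]
      refine ⟨(ih b hb).1, fun x => ?_⟩
      rw [(ih b hb).2]
      grind
    · have hb' : (a :: b).Nodup := List.nodup_cons.2 ⟨h, hb⟩
      simp only [h, decide_false]
      refine ⟨(ih _ hb').1, fun x => ?_⟩
      have := (ih _ hb').2 x
      grind

theorem nodup_nub (l : List A) : (nub l).Nodup := (nub_aux l [] List.nodup_nil).1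

theorem mem_nub {l : List A} {x : A} : x ∈ nub l ↔ x ∈ l := by
  simpa [nub] using (nub_aux l [] List.nodup_nil).2 x

end

section

variable {α β γ X A B : Type} [Enc α] [Enc β] [Enc γ] [Enc X] [Enc A] [Enc B]

theorem PolyTime.congr {f g : Oracle → X → β} (hf : PolyTime f) (h : ∀ O x, f O x = g O x) :
    PolyTime g :=
  hf.of_enc fun O x => by rw [h]

theorem PolyTime.fst {f : Oracle → X → α × β} (hf : PolyTime f) : PolyTime fun O x => (f O x).1 :=
  PolyTime.projFst.comp hf

theorem PolyTime.snd {f : Oracle → X → α × β} (hf : PolyTime f) : PolyTime fun O x => (f O x).2 :=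
  PolyTime.projSnd.comp hf

theorem PolyTime.and {f g : Oracle → X → Bool} (hf : PolyTime f) (hg : PolyTime g) :
    PolyTime fun O x => f O x && g O x :=
  (hf.ite hg (.const false)).congr fun O x => by cases f O x <;> rfl

theorem PolyTime.or {f g : Oracle → X → Bool} (hf : PolyTime f) (hg : PolyTime g) :
    PolyTime fun O x => f O x || g O x :=
  (hf.ite (.const true) hg).congr fun O x => by cases f O x <;> rfl

theorem PolyTime.not {f : Oracle → X → Bool} (hf : PolyTime f) : PolyTime fun O x => !f O x :=
  (hf.ite (.const false) (.const true)).congr fun O x => by cases f O x <;> rfl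

theorem PolyTime.revAppend {f g : Oracle → X → List α} (hf : PolyTime f) (hg : PolyTime g) :
    PolyTime fun O x => (f O x).reverse ++ g O x := by
  have h : PolyTime fun O x => (f O x).foldl (fun b a => a :: b) (g O x) := by
    refine PolyTime.foldl_add (st := fun _ p => p.2.2 :: p.2.1) hf hg
      (.cons (.snd (.snd .id)) (.fst (.snd .id))) ?_
    obtain ⟨p, hp⟩ := hf.sz_le
    refine ⟨p + 1, fun O x b a ha => ?_⟩
    have h1 := hp O x
    have h2 := sz_le_of_mem ha
    simp only [sz_cons, Polynomial.eval_add, Polynomial.eval_one]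
    omega
  refine h.congr fun O x => ?_
  generalize g O x = m
  induction f O x generalizing m with
  | nil => rfl
  | cons a l ih => simp [ih]

theorem PolyTime.reverse {f : Oracle → X → List α} (hf : PolyTime f) :
    PolyTime fun O x => (f O x).reverse :=
  (hf.revAppend (.const [])).congr fun _ _ => List.append_nil _

theorem PolyTime.append {f g : Oracle → X → List α} (hf : PolyTime f) (hg : PolyTime g) :
    PolyTime fun O x => f O x ++ g O x :=
  (hf.reverse.revAppend hg).congr fun _ _ => by rw [List.reverse_reverse]

theorem PolyTime.flatMap {l : Oracle → X → List A} {g : Oracle → X → A → List β}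
    (hl : PolyTime l) (hg : PolyTime fun O (p : X × A) => g O p.1 p.2) :
    PolyTime fun O x => (l O x).flatMap fun a => g O x a := by
  have h : PolyTime fun O x => (l O x).foldl (fun b a => (g O x a).reverse ++ b) [] := by
    refine PolyTime.foldl_add (st := fun O p => (g O p.1 p.2.2).reverse ++ p.2.1) hl (.const [])
      (.revAppend (hg.comp (.pair (.fst .id) (.snd (.snd .id)))) (.fst (.snd .id))) ?_
    obtain ⟨p, hp⟩ := hl.sz_le
    obtain ⟨q, hq⟩ := hg.sz_le
    refine ⟨q.comp (.X + p + 1), fun O x b a ha => ?_⟩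
    have h1 := hp O x
    have h2 := sz_le_of_mem ha
    have h3 := hq O (x, a)
    have h4 := eval_mono q (show sz (x, a) ≤ sz x + p.eval (sz x) + 1 by rw [sz_pair]; omega)
    have h5 := sz_append (g O x a).reverse b
    rw [sz_reverse] at h5
    simp only [Polynomial.eval_add, Polynomial.eval_comp, Polynomial.eval_X, Polynomial.eval_one]
    dsimp only at h3 h4
    omega
  refine h.reverse.congr fun O x => ?_
  have key : ∀ (l : List A) (b : List β), l.foldl (fun b a => (g O x a).reverse ++ b) b =
      (l.flatMap fun a => g O x a).reverse ++ b := by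
    intro l
    induction l with
    | nil => simp
    | cons a l ih => intro b; simp [ih]
  rw [key]; simp

theorem PolyTime.map {l : Oracle → X → List A} {g : Oracle → X → A → β}
    (hl : PolyTime l) (hg : PolyTime fun O (p : X × A) => g O p.1 p.2) :
    PolyTime fun O x => (l O x).map fun a => g O x a :=
  (hl.flatMap (g := fun O x a => [g O x a]) (hg.cons (.const []))).congr fun O x => by
    induction l O x with
    | nil => rfl
    | cons a l ih => simp [ih]

theorem PolyTime.filter {l : Oracle → X → List A} {g : Oracle → X → A → Bool}
    (hl : PolyTime l) (hg : PolyTime fun O (p : X × A) => g O p.1 p.2) :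
    PolyTime fun O x => (l O x).filter fun a => g O x a :=
  (hl.flatMap (g := fun O x a => if g O x a then [a] else [])
    (hg.ite (.cons (.snd .id) (.const [])) (.const []))).congr fun O x => by
    induction l O x with
    | nil => rfl
    | cons a l ih => by_cases h : g O x a <;> simp [ih, h]

theorem PolyTime.any {l : Oracle → X → List A} {g : Oracle → X → A → Bool}
    (hl : PolyTime l) (hg : PolyTime fun O (p : X × A) => g O p.1 p.2) :
    PolyTime fun O x => (l O x).any fun a => g O x a := by
  refine (PolyTime.listCase (f := fun _ _ => false) (g := fun _ _ => true)
    (hl.filter hg) (.const false) (.const true)).congr fun O x => ?_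
  induction l O x with
  | nil => rfl
  | cons a l ih => by_cases h : g O x a <;> simp [← ih, h, CQLearning.listCase]

theorem PolyTime.all {l : Oracle → X → List A} {g : Oracle → X → A → Bool}
    (hl : PolyTime l) (hg : PolyTime fun O (p : X × A) => g O p.1 p.2) :
    PolyTime fun O x => (l O x).all fun a => g O x a :=
  (hl.any (g := fun O x a => !g O x a) hg.not).not.congr fun O x => by
    rw [List.not_any_eq_all_not]; simp

theorem PolyTime.length {l : Oracle → X → List A} (hl : PolyTime l) :
    PolyTime fun O x => (l O x).length :=
  (hl.map (g := fun _ _ _ => ()) (.const ())).of_enc fun O x => by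
    induction l O x with
    | nil => rfl
    | cons a l ih =>
      change Data.cons .nil (enc (l.map fun _ => ())) = Data.cons .nil (enc l.length)
      rw [ih]

theorem PolyTime.units {n : Oracle → X → ℕ} (hn : PolyTime n) :
    PolyTime fun O x => List.replicate (n O x) () :=
  hn.of_enc fun O x => by
    induction n O x with
    | zero => rfl
    | succ n ih =>
      change Data.cons .nil (enc n) = Data.cons .nil (enc (List.replicate n ()))
      rw [ih]

theorem PolyTime.tail {l : Oracle → X → List A} (hl : PolyTime l) :
    PolyTime fun O x => (l O x).tail :=
  (PolyTime.listCase (f := fun _ _ => []) (g := fun _ p => p.2.2) hl (.const [])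
    (.snd (.snd .id))).congr fun O x => by cases l O x <;> rfl

theorem PolyTime.add {m n : Oracle → X → ℕ} (hm : PolyTime m) (hn : PolyTime n) :
    PolyTime fun O x => m O x + n O x :=
  (hm.units.append hn.units).length.congr fun O x => by simp

theorem PolyTime.drop {l : Oracle → X → List A} {n : Oracle → X → ℕ} (hl : PolyTime l)
    (hn : PolyTime n) : PolyTime fun O x => (l O x).drop (n O x) := by
  refine (PolyTime.foldl_add (st := fun _ p => p.2.1.tail) hn.units hl (.tail (.fst (.snd .id)))
    ⟨0, fun O x b _ _ => ?_⟩).congr fun O x => ?_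
  · have := sz_sublist (List.tail_sublist b)
    dsimp only
    omega
  · generalize l O x = m
    induction n O x generalizing m with
    | zero => simp
    | succ n ih => simp [List.replicate_succ, ih]

theorem PolyTime.sub {m n : Oracle → X → ℕ} (hm : PolyTime m) (hn : PolyTime n) :
    PolyTime fun O x => m O x - n O x :=
  (hm.units.drop hn).length.congr fun O x => by simp

theorem PolyTime.pos {n : Oracle → X → ℕ} (hn : PolyTime n) :
    PolyTime fun O x => decide (0 < n O x) :=
  (PolyTime.listCase (f := fun _ _ => false) (g := fun _ _ => true) hn.units (.const false)
    (.const true)).congr fun O x => by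
    cases h : n O x <;> simp [CQLearning.listCase, List.replicate_succ]

theorem PolyTime.lt {m n : Oracle → X → ℕ} (hm : PolyTime m) (hn : PolyTime n) :
    PolyTime fun O x => decide (m O x < n O x) :=
  (hn.sub hm).pos.congr fun O x => by simp

theorem PolyTime.range {n : Oracle → X → ℕ} (hn : PolyTime n) :
    PolyTime fun O x => List.range (n O x) := by
  have key : ∀ m : ℕ, (List.replicate m ()).foldl (fun (b : List ℕ) _ => b.length :: b) [] =
      (List.range m).reverse := by
    intro m
    induction m with
    | zero => rfl
    | succ m ih => rw [List.replicate_succ', List.foldl_append, ih, List.range_succ]; simp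
  have h : PolyTime fun O (x : X) =>
      (List.replicate (n O x) ()).foldl (fun (b : List ℕ) _ => b.length :: b) [] := by
    refine PolyTime.foldl (st := fun _ p => p.2.1.length :: p.2.1) hn.units (.const [])
      (.cons (.length (.fst (.snd .id))) (.fst (.snd .id))) ?_
    obtain ⟨p, hp⟩ := hn.sz_le
    refine ⟨p * (2 * p + 2) + 1, fun O x l' hl' => ?_⟩
    obtain ⟨h1, h2⟩ := List.prefix_replicate_iff.1 hl'
    rw [h2, key, sz_reverse]
    have h3 := hp O x
    rw [sz_nat] at h3
    refine (sz_list_le (c := 2 * p.eval (sz x) + 1) fun a ha => ?_).trans ?_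
    · rw [sz_nat]
      have := List.mem_range.1 ha
      omega
    · rw [List.length_range]
      simp only [Polynomial.eval_add, Polynomial.eval_mul, Polynomial.eval_ofNat,
        Polynomial.eval_one]
      have := Nat.mul_le_mul_right (2 * p.eval (sz x) + 2)
        (show l'.length ≤ p.eval (sz x) by omega)
      rw [show 2 * p.eval (sz x) + 1 + 1 = 2 * p.eval (sz x) + 2 by omega]
      omega
  exact h.reverse.congr fun O x => by rw [key, List.reverse_reverse]

/-- Equality is decided in polynomial time. -/
class EncEq (α : Type) [Enc α] [DecidableEq α] : Prop where
  eq : PolyTime fun _ (p : α × α) => decide (p.1 = p.2)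

theorem PolyTime.eq [DecidableEq α] [EncEq α] {f g : Oracle → X → α} (hf : PolyTime f)
    (hg : PolyTime g) : PolyTime fun O x => decide (f O x = g O x) :=
  EncEq.eq.comp (hf.pair hg)

instance : EncEq ℕ where
  eq := ((PolyTime.lt (.fst .id) (.snd .id)).or (PolyTime.lt (.snd .id) (.fst .id))).not.congr
    fun O x => by
      by_cases h : x.1 = x.2
      · simp [h]
      · rcases Nat.lt_or_gt_of_ne h with h' | h' <;> simp [h', h]

instance [DecidableEq α] [EncEq α] [DecidableEq β] [EncEq β] : EncEq (α × β) where
  eq := ((PolyTime.eq (.fst (.fst .id)) (.fst (.snd .id))).and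
      (PolyTime.eq (.snd (.fst .id)) (.snd (.snd .id)))).congr
    fun O x => by rw [Bool.eq_iff_iff]; simp [Prod.ext_iff]

instance [DecidableEq α] [EncEq α] : EncEq (List α) where
  eq := by
    have h : PolyTime fun _ (p : List α × List α) => p.1.foldl (fun (s : Bool × List α) a =>
        listCase s.2 (false, []) fun b t => (s.1 && decide (a = b), t)) (true, p.2) := by
      refine PolyTime.foldl_add
        (st := fun _ (q : (List α × List α) × (Bool × List α) × α) =>
          listCase q.2.1.2 (false, []) fun b t => (q.2.1.1 && decide (q.2.2 = b), t))
        (.fst .id) (.pair (.const true) (.snd .id))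
        (PolyTime.listCase
          (g := fun _ (z : ((List α × List α) × (Bool × List α) × α) × α × List α) =>
            (z.1.2.1.1 && decide (z.1.2.2 = z.2.1), z.2.2))
          (.snd (.fst (.snd .id))) (.const _)
          (.pair (.and (.fst (.fst (.snd (.fst .id))))
            (.eq (.snd (.snd (.fst .id))) (.fst (.snd .id)))) (.snd (.snd .id))))
        ⟨3, fun O x s a _ => ?_⟩
      obtain ⟨s, l⟩ := s
      rw [Polynomial.eval_ofNat]
      rcases l with - | ⟨b, t⟩
      · have := sz_bool_le false
        have := sz_pos s
        simp only [CQLearning.listCase, sz_pair, sz_nil]; omega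
      · have := sz_bool_le (s && decide (a = b))
        have := sz_pos s
        simp only [CQLearning.listCase, sz_pair, sz_cons]; omega
    refine (h.fst.and (PolyTime.listCase (f := fun _ _ => true) (g := fun _ _ => false) h.snd
      (.const true) (.const false))).congr fun O p => ?_
    obtain ⟨l, m⟩ := p
    have key : ∀ (l m : List α) (c : Bool), (let r := l.foldl (fun (s : Bool × List α) a =>
        listCase s.2 (false, []) fun b t => (s.1 && decide (a = b), t)) (c, m);
        (r.1 && listCase r.2 true fun _ _ => false)) = (c && decide (l = m)) := by
      intro l
      induction l with
      | nil => intro m c; cases m <;> simp [CQLearning.listCase]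
      | cons a l ih =>
        intro m c
        cases m with
        | nil =>
          have := ih [] false
          simp only [List.foldl_cons, CQLearning.listCase] at this ⊢
          rw [this]; simp
        | cons b m =>
          have := ih m (c && decide (a = b))
          simp only [List.foldl_cons, CQLearning.listCase] at this ⊢
          rw [this, Bool.eq_iff_iff]; simp [and_assoc]
    simpa using key l m true

section
variable [DecidableEq A] [EncEq A]

theorem PolyTime.mem {f : Oracle → X → A} {l : Oracle → X → List A} (hf : PolyTime f)
    (hl : PolyTime l) : PolyTime fun O x => decide (f O x ∈ l O x) :=
  (hl.any (g := fun O x b => decide (b = f O x))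
    (.eq (.snd .id) (hf.comp (.fst .id)))).congr fun O x => by
      rw [Bool.eq_iff_iff]; simp

theorem PolyTime.idxOf {f : Oracle → X → A} {l : Oracle → X → List A} (hf : PolyTime f)
    (hl : PolyTime l) : PolyTime fun O x => (l O x).idxOf (f O x) := by
  refine (PolyTime.foldl_add (b := fun _ _ => 0)
    (st := fun O p => if decide (p.2.2 = f O p.1) then 0 else p.2.1 + 1)
    hl.reverse (.const 0) (.ite (.eq (.snd (.snd .id)) (hf.comp (.fst .id))) (.const 0)
      (.add (.fst (.snd .id)) (.const 1))) ⟨2, fun O x b a _ => ?_⟩).congr fun O x => ?_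
  · dsimp only
    rw [Polynomial.eval_ofNat]
    split_ifs <;> simp only [sz_nat] <;> omega
  · induction l O x with
    | nil => rfl
    | cons a l ih =>
      simp only [List.reverse_cons, List.foldl_append, List.foldl_cons, List.foldl_nil, ih,
        List.idxOf_cons]
      by_cases h : a = f O x
      · simp [h]
      · rw [beq_false_of_ne h]; simp [h]

theorem PolyTime.nub {l : Oracle → X → List A} (hl : PolyTime l) :
    PolyTime fun O x => nub (l O x) := by
  refine PolyTime.foldl_add (b := fun _ _ => [])
    (st := fun O p => if decide (p.2.2 ∈ p.2.1) then p.2.1 else p.2.2 :: p.2.1) hl (.const [])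
    (.ite (.mem (.snd (.snd .id)) (.fst (.snd .id))) (.fst (.snd .id))
      (.cons (.snd (.snd .id)) (.fst (.snd .id)))) ?_
  obtain ⟨p, hp⟩ := hl.sz_le
  refine ⟨p + 1, fun O x b a ha => ?_⟩
  have h1 := hp O x
  have h2 := sz_le_of_mem ha
  dsimp only
  split_ifs <;> simp only [sz_cons, Polynomial.eval_add, Polynomial.eval_one] <;> omega

end

end

/-! ### The learning algorithm -/

/-- An atom, as the programs see it: the number of its relation symbol, and its arguments. -/
abbrev RawAtom (V : Type) := ℕ × List V

/-- A structure whose domain is an initial segment of the natural numbers: the size of the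
domain, the distinguished elements, and the facts. -/
abbrev RawStr := ℕ × List ℕ × List (RawAtom ℕ)

section

variable {V Λ : Type} [DecidableEq V]

/-- The elements that occur in a list of facts, without repetitions. -/
def elements (F : List (RawAtom V)) : List V := nub (F.flatMap fun f => f.2)

/-- Rename the elements that occur in the facts to `0, …, n - 1`. -/
def compress (s : List V × List (RawAtom V)) : RawStr :=
  ((elements s.2).length, s.1.map fun v => (elements s.2).idxOf v,
    s.2.map fun f => (f.1, f.2.map fun v => (elements s.2).idxOf v))

/-- Go through the list of facts, and drop each fact without which the structure is still a
positive example. -/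
noncomputable def minimize (O : Oracle) (s : List V × List (RawAtom V)) : List (RawAtom V) :=
  s.2.foldl (fun acc x =>
    if ask O (compress (s.1, acc.filter fun y => !decide (y = x))) then
      acc.filter fun y => !decide (y = x) else acc) s.2

/-- A minimal positive substructure, with its elements renamed. -/
noncomputable def shrink (O : Oracle) (s : List V × List (RawAtom V)) : RawStr :=
  compress (s.1, nub (minimize O s))

/-- All ways to label the members of a list (of length at most `r`). -/
def labelings (r : ℕ) (L : List Λ) (l : List V) : List (List (V × Λ)) :=
  match r with
  | 0 => [[]]
  | r + 1 => listCase l [[]] fun a t =>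
      L.flatMap fun b => (labelings r L t).map fun s => (a, b) :: s

/-- All facts that arise from the given facts by labelling the arguments. -/
def blowup (r : ℕ) (L : List Λ) (F : List (RawAtom V)) : List (RawAtom (V × Λ)) :=
  F.flatMap fun f => (labelings r L f.2).map fun s => (f.1, s)

/-- The labels of `frontBlowup` are the facts of `A`, and a dummy for distinguished elements. -/
def frontLabels (A : RawStr) : List (RawAtom ℕ) := (0, []) :: A.2.2

/-- A labelled fact is *good* if its distinguished arguments have the dummy label, and each other
argument is labelled with the underlying fact (or with a fact in which it does not occur). -/
def frontGood (A : RawStr) (f : RawAtom (ℕ × RawAtom ℕ)) : Bool :=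
  f.2.all fun p => if decide (p.1 ∈ A.2.1) then decide (p.2 = (0, [])) else
    decide (p.2 = (f.1, f.2.map fun p => p.1)) || !decide (p.1 ∈ p.2.2)

/-- The blow-up of `A` with the labels of `frontLabels`, good facts first. -/
def frontBlowup (r : ℕ) (A : RawStr) :
    List (ℕ × RawAtom ℕ) × List (RawAtom (ℕ × RawAtom ℕ)) :=
  (A.2.1.map fun v => (v, (0, [])),
    ((blowup r (frontLabels A) A.2.2).filter fun f => frontGood A f) ++
      blowup r (frontLabels A) A.2.2)

/-- Labels of `coverBlowup`: a fact, a position in it, and a depth. -/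
abbrev CoverLabel := RawAtom ℕ × ℕ × ℕ

/-- The label of distinguished elements in `coverBlowup`. -/
def dummy : CoverLabel := ((0, []), 0, 0)

/-- The labels of `coverBlowup`: the depth is counted modulo `n + 1`, for `n` the number of elements
of `A`. -/
def coverLabels (r : ℕ) (A : RawStr) : List CoverLabel :=
  dummy :: A.2.2.flatMap fun f => (List.range r).flatMap fun i =>
    (List.range (A.1 + 1)).map fun d => (f, i, d)

/-- Successor modulo `n + 1`. -/
def next (n d : ℕ) : ℕ := if decide (d = n) then 0 else d + 1

/-- A labelled fact `f` is admitted in the cover if its distinguished arguments have the dummy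
label, and for some position `i` (that of the parent) and some `d`, the argument there has depth
`d`, and each other argument at a position `j` has the label `f, j, d + 1`. -/
def coverAllowed (A : RawStr) (f : RawAtom (ℕ × CoverLabel)) : Bool :=
  (List.range f.2.length).any fun i => (List.range (A.1 + 1)).any fun d =>
    (List.range f.2.length).all fun j => listCase (f.2.drop j) true fun p _ =>
      if decide (p.1 ∈ A.2.1) then decide (p.2 = dummy) else
        if decide (j = i) then decide (p.2.2.2 = d) else
          decide (p.2 = ((f.1, f.2.map fun p => p.1), j, next A.1 d))

/-- The blow-up of `A` with the labels of `coverLabels`, facts outside of the cover first. -/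
def coverBlowup (r : ℕ) (A : RawStr) : List (ℕ × CoverLabel) × List (RawAtom (ℕ × CoverLabel)) :=
  (A.2.1.map fun v => (v, dummy),
    ((blowup r (coverLabels r A) A.2.2).filter fun f => !coverAllowed A f) ++
      blowup r (coverLabels r A) A.2.2)

/-- `A'` has more elements and facts than `A`. -/
def grows (A A' : RawStr) : Bool := decide (A.1 + A.2.2.length < A'.1 + A'.2.2.length)

/-- The test of the main loop: one of the two expansions yields a larger structure. -/
noncomputable def loopTest (r : ℕ) (O : Oracle) (A : RawStr) : Bool :=
  grows A (shrink O (coverBlowup r A)) || grows A (shrink O (frontBlowup r A))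

/-- The body of the main loop: replace the structure by a larger expansion. -/
noncomputable def loopBody (r : ℕ) (O : Oracle) (A : RawStr) : RawStr :=
  if grows A (shrink O (coverBlowup r A)) then shrink O (coverBlowup r A)
  else shrink O (frontBlowup r A)

/-- The first structure on the list that is a positive example; the value for a list without
positive examples is arbitrary. -/
noncomputable def firstPositive (O : Oracle) : List RawStr → RawStr
  | [] => (0, [], [])
  | A :: l => if ask O A then A else firstPositive O l

end

section

variable {V Λ X : Type} [Enc V] [Enc Λ] [Enc X]

theorem PolyTime.labelings (r : ℕ) :
    ∀ {X : Type} [Enc X] {L : Oracle → X → List Λ} {l : Oracle → X → List V}, PolyTime L →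
      PolyTime l → PolyTime fun O x => labelings r (L O x) (l O x) := by
  induction r with
  | zero => intro X _ L l _ _; exact .const _
  | succ r ih =>
    intro X _ L l hL hl
    exact PolyTime.listCase (g := fun O (q : X × V × List V) => (L O q.1).flatMap fun b =>
        (CQLearning.labelings r (L O q.1) q.2.2).map fun s => (q.2.1, b) :: s) hl (.const _)
      (.flatMap (hL.comp (.fst .id)) (.map (ih (hL.comp (.fst (.fst .id))) (.snd (.snd (.fst .id))))
        (.cons (.pair (.fst (.snd (.fst (.fst .id)))) (.snd (.fst .id))) (.snd .id))))

theorem PolyTime.blowup (r : ℕ) {L : Oracle → X → List Λ} {F : Oracle → X → List (RawAtom V)}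
    (hL : PolyTime L) (hF : PolyTime F) : PolyTime fun O x => blowup r (L O x) (F O x) :=
  .flatMap hF (.map (.labelings r (hL.comp (.fst .id)) (.snd (.snd .id)))
    (.pair (.fst (.snd (.fst .id))) (.snd .id)))

end

section

variable {V X : Type} [DecidableEq V] [Enc V] [Enc X] [EncEq V]

theorem PolyTime.elements {F : Oracle → X → List (RawAtom V)} (hF : PolyTime F) :
    PolyTime fun O x => elements (F O x) :=
  (hF.flatMap (.snd (.snd .id))).nub

theorem PolyTime.compress {s : Oracle → X → List V × List (RawAtom V)} (hs : PolyTime s) :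
    PolyTime fun O x => compress (s O x) := by
  refine PolyTime.comp (g := fun _ s => CQLearning.compress s) ?_ hs
  have h : PolyTime fun _ (s : List V × List (RawAtom V)) => CQLearning.elements s.2 :=
    .elements (.snd .id)
  exact .pair h.length (.pair (.map (.fst .id) (.idxOf (.snd .id) (h.comp (.fst .id))))
    (.map (.snd .id) (.pair (.fst (.snd .id)) (.map (.snd (.snd .id))
      (.idxOf (.snd .id) (h.comp (.fst (.fst .id))))))))

theorem PolyTime.minimize : PolyTime fun O (s : List V × List (RawAtom V)) => minimize O s := by
  have h : PolyTime fun _ (p : (List V × List (RawAtom V)) × List (RawAtom V) × RawAtom V) =>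
      p.2.1.filter fun y => !decide (y = p.2.2) :=
    .filter (.fst (.snd .id)) (.not (.eq (.snd .id) (.snd (.snd (.fst .id)))))
  refine PolyTime.foldl_add (X := List V × List (RawAtom V)) (l := fun _ s => s.2)
    (b := fun _ s => s.2)
    (st := fun O (p : (List V × List (RawAtom V)) × List (RawAtom V) × RawAtom V) =>
      if CQLearning.ask O (CQLearning.compress (p.1.1,
        p.2.1.filter fun y => !decide (y = p.2.2))) then
      p.2.1.filter fun y => !decide (y = p.2.2) else p.2.1) (.snd .id) (.snd .id)
    (.ite (PolyTime.ask.comp (.compress (.pair (.fst (.fst .id)) h))) h (.fst (.snd .id)))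
    ⟨0, fun O x b a _ => ?_⟩
  have := sz_sublist (List.filter_sublist (p := fun y => !decide (y = a)) (l := b))
  dsimp only
  split_ifs <;> omega

theorem PolyTime.shrink {s : Oracle → X → List V × List (RawAtom V)} (hs : PolyTime s) :
    PolyTime fun O x => shrink O (s O x) :=
  .compress (.pair hs.fst (.nub (PolyTime.minimize.comp hs)))

theorem PolyTime.frontLabels : PolyTime fun _ (A : RawStr) => frontLabels A :=
  .cons (.const _) (.snd (.snd .id))

theorem PolyTime.frontGood :
    PolyTime fun _ (p : RawStr × RawAtom (ℕ × RawAtom ℕ)) => frontGood p.1 p.2 :=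
  .all (.snd (.snd .id)) (.ite (.mem (.fst (.snd .id)) (.fst (.snd (.fst (.fst .id)))))
    (.eq (.snd (.snd .id)) (.const _))
    (.or (.eq (.snd (.snd .id)) (.pair (.fst (.snd (.fst .id)))
      (.map (.snd (.snd (.fst .id))) (.fst (.snd .id)))))
      (.not (.mem (.fst (.snd .id)) (.snd (.snd (.snd .id)))))))

theorem PolyTime.frontBlowup (r : ℕ) : PolyTime fun _ (A : RawStr) => frontBlowup r A := by
  have h : PolyTime fun _ (A : RawStr) =>
      CQLearning.blowup r (CQLearning.frontLabels A) A.2.2 :=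
    .blowup r .frontLabels (.snd (.snd .id))
  exact .pair (.map (.fst (.snd .id)) (.pair (.snd .id) (.const _)))
    (.append (.filter h PolyTime.frontGood) h)

theorem PolyTime.coverLabels (r : ℕ) : PolyTime fun _ (A : RawStr) => coverLabels r A :=
  .cons (.const _) (.flatMap (.snd (.snd .id)) (.flatMap (.const _)
    (.map (.range (.add (.fst (.fst (.fst .id))) (.const 1)))
      (.pair (.snd (.fst (.fst .id))) (.pair (.snd (.fst .id)) (.snd .id))))))

theorem PolyTime.next {n d : Oracle → X → ℕ} (hn : PolyTime n) (hd : PolyTime d) :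
    PolyTime fun O x => next (n O x) (d O x) :=
  .ite (.eq hd hn) (.const 0) (.add hd (.const 1))

theorem PolyTime.coverAllowed :
    PolyTime fun _ (p : RawStr × RawAtom (ℕ × CoverLabel)) => coverAllowed p.1 p.2 := by
  refine .any (.range (.length (.snd (.snd .id)))) (.any (.range (.add (.fst (.fst (.fst .id)))
    (.const 1))) (.all (.range (.length (.snd (.snd (.fst (.fst .id)))))) ?_))
  exact PolyTime.listCase (g := fun _ (q : ((((RawStr × RawAtom (ℕ × CoverLabel)) × ℕ) × ℕ) × ℕ) ×
      (ℕ × CoverLabel) × List (ℕ × CoverLabel)) =>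
      if decide (q.2.1.1 ∈ q.1.1.1.1.1.2.1) then decide (q.2.1.2 = dummy) else
        if decide (q.1.2 = q.1.1.1.2) then decide (q.2.1.2.2.2 = q.1.1.2) else
          decide (q.2.1.2 = ((q.1.1.1.1.2.1, q.1.1.1.1.2.2.map fun p => p.1), q.1.2,
            CQLearning.next q.1.1.1.1.1.1 q.1.1.2)))
    (.drop (.snd (.snd (.fst (.fst (.fst .id))))) (.snd .id)) (.const true)
    (.ite (.mem (.fst (.fst (.snd .id))) (.fst (.snd (.fst (.fst (.fst (.fst (.fst .id))))))))
      (.eq (.snd (.fst (.snd .id))) (.const _))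
      (.ite (.eq (.snd (.fst .id)) (.snd (.fst (.fst (.fst .id)))))
        (.eq (.snd (.snd (.snd (.fst (.snd .id))))) (.snd (.fst (.fst .id))))
        (.eq (.snd (.fst (.snd .id))) (.pair (.pair (.fst (.snd (.fst (.fst (.fst (.fst .id))))))
          (.map (.snd (.snd (.fst (.fst (.fst (.fst .id)))))) (.fst (.snd .id))))
          (.pair (.snd (.fst .id)) (.next (.fst (.fst (.fst (.fst (.fst (.fst .id))))))
            (.snd (.fst (.fst .id)))))))))

theorem PolyTime.coverBlowup (r : ℕ) : PolyTime fun _ (A : RawStr) => coverBlowup r A := by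
  have h : PolyTime fun _ (A : RawStr) =>
      CQLearning.blowup r (CQLearning.coverLabels r A) A.2.2 :=
    .blowup r (.coverLabels r) (.snd (.snd .id))
  exact .pair (.map (.fst (.snd .id)) (.pair (.snd .id) (.const _)))
    (.append (.filter h (.not PolyTime.coverAllowed)) h)

theorem PolyTime.grows {A A' : Oracle → X → RawStr} (hA : PolyTime A) (hA' : PolyTime A') :
    PolyTime fun O x => grows (A O x) (A' O x) :=
  .lt (.add hA.fst hA.snd.snd.length) (.add hA'.fst hA'.snd.snd.length)

theorem PolyTime.loopTest (r : ℕ) : PolyTime (loopTest r) :=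
  .or (.grows .id (.shrink (.coverBlowup r))) (.grows .id (.shrink (.frontBlowup r)))

theorem PolyTime.loopBody (r : ℕ) : PolyTime (loopBody r) :=
  .ite (.grows .id (.shrink (.coverBlowup r))) (.shrink (.coverBlowup r))
    (.shrink (.frontBlowup r))

theorem PolyTime.firstPositive (l : List RawStr) :
    PolyTime fun O (_ : X) => firstPositive O l := by
  induction l with
  | nil => exact .const _
  | cons A l ih => exact .ite (PolyTime.ask.comp (.const A)) (.const A) ih

end

/-! ### Forest structure of sets of facts without cycles -/

section

variable {S : Schema} {V W : Type} {k : ℕ}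

/-- The elements that occur in a set of facts. -/
def Occ (F : Set (Atom S V)) : Set V := {v | ∃ f ∈ F, ∃ i, f.args i = v}

theorem Occ.mono {F F' : Set (Atom S V)} (h : F ⊆ F') : Occ F ⊆ Occ F' :=
  fun _ ⟨f, hf, i, hi⟩ => ⟨f, h hf, i, hi⟩

theorem Occ.finite {F : Set (Atom S V)} (h : F.Finite) : (Occ F).Finite := by
  have : Occ F = ⋃ f ∈ F, Set.range f.args := by ext v; simp [Occ]
  rw [this]
  exact h.biUnion fun f _ => Set.finite_range f.args

/-- `PStr.IsCycle`, for an arbitrary set of facts. -/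
structure IsCycleIn (F : Set (Atom S V)) (m : ℕ) (a : Fin (m + 1) → V)
    (f : Fin (m + 1) → Atom S V) (i j : ∀ t, Fin (S.arity (f t).rel)) : Prop where
  facts_mem : ∀ t, f t ∈ F
  elements_distinct : Function.Injective a
  facts_distinct : Function.Injective f
  leave : ∀ t, (f t).args (i t) = a t
  arrive : ∀ t, (f t).args (j t) = a (t + 1)
  edges_distinct : ∀ t, i t ≠ j t

/-- Every cycle of `F` meets `D`. -/
def Acyc (F : Set (Atom S V)) (D : Set V) : Prop :=
  ∀ (m : ℕ) (a : Fin (m + 1) → V) (f : Fin (m + 1) → Atom S V)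
    (i j : ∀ t, Fin (S.arity (f t).rel)), IsCycleIn F m a f i j → ∃ t, a t ∈ D

theorem Acyc.mono {F F' : Set (Atom S V)} {D : Set V} (h : Acyc F D) (hF : F' ⊆ F) :
    Acyc F' D := fun m a f i j hc => h m a f i j
  ⟨fun t => hF (hc.1 t), hc.2, hc.3, hc.4, hc.5, hc.6⟩

/-- There is no closed walk `a 0, f 0, …, a m, f m, a 0` without repetitions outside of `D`. This is
the definition with indices in `ℕ` in place of `Fin (m + 1)`. -/
theorem Acyc.not_closed {F : Set (Atom S V)} {D : Set V} (h : Acyc F D) (m : ℕ) (a : ℕ → V)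
    (f : ℕ → Atom S V) (i : ∀ t, Fin (S.arity (f t).rel)) (hf : ∀ t, f t ∈ F)
    (hi : ∀ t, (f t).args (i t) = a t) (hD : ∀ t, a t ∉ D)
    (ha : ∀ s t, s < t → t ≤ m → a s ≠ a t) (hf' : ∀ s t, s < t → t ≤ m → f s ≠ f t)
    (hj : ∀ t < m, ∃ j, (f t).args j = a (t + 1) ∧ i t ≠ j)
    (hm : ∃ j, (f m).args j = a 0 ∧ i m ≠ j) : False := by
  have inj : ∀ {β : Type} (u : ℕ → β), (∀ s t, s < t → t ≤ m → u s ≠ u t) →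
      Function.Injective fun t : Fin (m + 1) => u t := by
    intro β u hu s t hst
    dsimp only at hst
    by_contra hne
    rcases lt_or_gt_of_ne (fun h => hne (Fin.ext h)) with h1 | h1
    · exact hu _ _ h1 (by omega) hst
    · exact hu _ _ h1 (by omega) hst.symm
  have hj' : ∀ t : Fin (m + 1), ∃ j, (f t).args j = a ((t + 1 : Fin (m + 1)) : ℕ) ∧ i t ≠ j := by
    intro t
    by_cases ht : t = Fin.last m
    · subst ht
      simpa using hm
    · have h1 : t < Fin.last m := Fin.lt_last_iff_ne_last.2 ht
      rw [Fin.val_add_one_of_lt h1]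
      exact hj t (by simpa [Fin.lt_def] using h1)
  choose j hj1 hj2 using hj'
  obtain ⟨t, ht⟩ := h m (fun t => a t) (fun t => f t) (fun t => i t) j
    ⟨fun t => hf t, inj a ha, inj f hf', fun t => hi t, hj1, hj2⟩
  exact hD _ ht

theorem Acyc.args_inj {F : Set (Atom S V)} {D : Set V} (h : Acyc F D) {f : Atom S V} (hf : f ∈ F)
    {i j : Fin (S.arity f.rel)} (hij : f.args i = f.args j) (hD : f.args i ∉ D) : i = j := by
  by_contra hne
  exact h.not_closed 0 (fun _ => f.args i) (fun _ => f) (fun _ => i) (fun _ => hf) (fun _ => rfl)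
    (fun _ => hD) (by omega) (by omega) (by omega) ⟨j, hij.symm, hne⟩

/-- Without cycles, some fact is a leaf: at most one of its arguments outside of `D` occurs in
another fact. Otherwise one could walk forever through facts, never turning back. -/
theorem Acyc.exists_leaf {F : Set (Atom S V)} {D : Set V} (h : Acyc F D) (hfin : F.Finite)
    (hne : F.Nonempty) : ∃ f ∈ F, ∀ i j, f.args i ∉ D → f.args j ∉ D →
      f.args i ∈ Occ (F \ {f}) → f.args j ∈ Occ (F \ {f}) → i = j := by
  by_contra hcon
  push Not at hcon
  let St := {s : (f : Atom S V) × Fin (S.arity f.rel) // s.1 ∈ F}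
  have hnext : ∀ s : St, ∃ s' : St, s'.1.1 ≠ s.1.1 ∧ s'.1.1.args s'.1.2 ∉ D ∧
      ∃ j, s.1.1.args j = s'.1.1.args s'.1.2 ∧ s.1.2 ≠ j := by
    rintro ⟨⟨f, i⟩, hf⟩
    have : ∃ j, i ≠ j ∧ f.args j ∉ D ∧ f.args j ∈ Occ (F \ {f}) := by
      obtain ⟨x, y, hx, hy, hx', hy', hxy⟩ := hcon f hf
      by_cases hix : i = x
      · exact ⟨y, hix ▸ hxy, hy, hy'⟩
      · exact ⟨x, hix, hx, hx'⟩
    obtain ⟨j, hij, hjD, f', hf', i', hi'⟩ := this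
    exact ⟨⟨⟨f', i'⟩, hf'.1⟩, hf'.2, by rw [hi']; exact hjD, j, hi'.symm, hij⟩
  choose nx hnx1 hnx2 hnx3 using hnext
  obtain ⟨f0, hf0⟩ := hne
  let s : ℕ → St := fun t => nx^[t + 1] ⟨⟨f0, ⟨0, S.arity_pos _⟩⟩, hf0⟩
  have hs : ∀ t, s (t + 1) = nx (s t) := fun t => Function.iterate_succ_apply' _ _ _
  have hs0 : ∀ t, ∃ u, s t = nx u := fun t => ⟨_, Function.iterate_succ_apply' _ _ _⟩
  let f : ℕ → Atom S V := fun t => (s t).1.1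
  let i : ∀ t, Fin (S.arity (f t).rel) := fun t => (s t).1.2
  let a : ℕ → V := fun t => (f t).args (i t)
  have hf : ∀ t, f t ∈ F := fun t => (s t).2
  have haD : ∀ t, a t ∉ D := by
    intro t
    obtain ⟨u, hu⟩ := hs0 t
    change (s t).1.1.args (s t).1.2 ∉ D
    rw [hu]
    exact hnx2 u
  have hff : ∀ t, f (t + 1) ≠ f t := fun t => by simp only [f, hs]; exact hnx1 _
  have hj : ∀ t, ∃ j, (f t).args j = a (t + 1) ∧ i t ≠ j := by
    intro t
    obtain ⟨j, h1, h2⟩ := hnx3 (s t)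
    refine ⟨j, ?_, h2⟩
    change (s t).1.1.args j = (s (t + 1)).1.1.args (s (t + 1)).1.2
    rw [hs]
    exact h1
  -- a shortest segment of the walk between two equal elements or two equal facts is a cycle
  have hrep : ∃ g, 0 < g ∧ ∃ x, f x = f (x + g) ∨ a x = a (x + g) := by
    obtain ⟨x, y, hxy, h1⟩ := hfin.exists_lt_map_eq_of_forall_mem hf
    exact ⟨y - x, by omega, x, Or.inl (by rw [h1]; congr 1; omega)⟩
  classical
  let g := Nat.find hrep
  obtain ⟨hg, x, hx⟩ : 0 < g ∧ ∃ x, f x = f (x + g) ∨ a x = a (x + g) := Nat.find_spec hrep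
  have hmin : ∀ u v, u < v → v < u + g → f u ≠ f v ∧ a u ≠ a v := by
    intro u v huv hv
    have h1 := Nat.find_min hrep (show v - u < g by omega)
    push Not at h1
    have h2 := h1 (by omega) u
    rwa [show u + (v - u) = v by omega] at h2
  by_cases hax : a x = a (x + g)
  · refine h.not_closed (g - 1) (fun t => a (x + t)) (fun t => f (x + t)) (fun t => i (x + t))
      (fun t => hf _) (fun t => rfl) (fun t => haD _) (fun u v h1 h2 => (hmin _ _ ?_ ?_).2)
      (fun u v h1 h2 => (hmin _ _ ?_ ?_).1) (fun t _ => hj (x + t)) ?_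
    any_goals omega
    obtain ⟨j, h1, h2⟩ := hj (x + (g - 1))
    refine ⟨j, ?_, h2⟩
    rw [h1, show x + (g - 1) + 1 = x + g by omega, ← hax]
  -- if a fact is repeated, the cycle starts at the element by which the walk leaves it
  · have hfx : f x = f (x + g) := hx.resolve_right hax
    have hg2 : 2 ≤ g := by
      by_contra hlt
      have : g = 1 := by omega
      rw [this] at hfx
      exact hff x hfx.symm
    refine h.not_closed (g - 1) (fun t => a (x + 1 + t)) (fun t => f (x + 1 + t))
      (fun t => i (x + 1 + t))
      (fun t => hf _) (fun t => rfl) (fun t => haD _) (fun u v h1 h2 => (hmin _ _ ?_ ?_).2)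
      (fun u v h1 h2 => (hmin _ _ ?_ ?_).1) (fun t _ => hj (x + 1 + t)) ?_
    any_goals omega
    obtain ⟨j, h1, -⟩ := hj x
    have h3 : ∃ j, (f (x + g)).args j = a (x + 1) := by rw [← hfx]; exact ⟨j, h1⟩
    rw [show x + 1 + (g - 1) = x + g by omega]
    obtain ⟨j', h4⟩ := h3
    refine ⟨j', h4, ?_⟩
    rintro rfl
    exact (hmin (x + 1) (x + g) (by omega) (by omega)).2 h4.symm

/-- A ranking of the facts in an order in which a forest can be built, adding one fact at a time:
at most one argument outside of `D` of a fact, its parent, occurs in facts of smaller rank. -/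
structure ForestRank (F : Set (Atom S V)) (D : Set V) (r : Atom S V → ℕ) : Prop where
  inj : Set.InjOn r F
  args_inj : ∀ f ∈ F, ∀ i j, f.args i = f.args j → f.args i ∉ D → i = j
  parent_unique : ∀ f ∈ F, ∀ i j, f.args i ∉ D → f.args j ∉ D →
    f.args i ∈ Occ {f' ∈ F | r f' < r f} → f.args j ∈ Occ {f' ∈ F | r f' < r f} → i = j

theorem Acyc.exists_forestRank {F : Set (Atom S V)} {D : Set V} (h : Acyc F D) (hfin : F.Finite) :
    ∃ r : Atom S V → ℕ, ForestRank F D r := by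
  classical
  suffices H : ∀ (n : ℕ) (F : Set (Atom S V)), F.Finite → Acyc F D → F.ncard = n →
      ∃ r : Atom S V → ℕ, ForestRank F D r ∧ ∀ f ∈ F, r f < n by
    obtain ⟨r, hr, -⟩ := H _ F hfin h rfl
    exact ⟨r, hr⟩
  intro n
  induction n with
  | zero =>
    intro F hfin _ h0
    rw [Set.ncard_eq_zero hfin] at h0
    subst h0
    exact ⟨fun _ => 0, ⟨by simp, by simp, by simp⟩, by simp⟩
  | succ n ih =>
    intro F hfin h hn
    have hne : F.Nonempty := by
      rw [Set.nonempty_iff_ne_empty]; rintro rfl; simp at hn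
    obtain ⟨f, hf, hleaf⟩ := h.exists_leaf hfin hne
    obtain ⟨r, hr, hrn⟩ := ih (F \ {f}) hfin.sdiff (h.mono Set.sdiff_subset)
      (by rw [Set.ncard_sdiff_singleton_of_mem hf]; omega)
    have hup : ∀ g ∈ F, g ≠ f → g ∈ F \ {f} ∧ Function.update r f n g = r g ∧ r g < n :=
      fun g hg hgf => ⟨⟨hg, hgf⟩, Function.update_of_ne hgf _ _, hrn g ⟨hg, hgf⟩⟩
    have hlow : ∀ g ∈ F, Occ {f' ∈ F | Function.update r f n f' < Function.update r f n g} ⊆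
        Occ {f' ∈ F \ {f} | g = f ∨ r f' < r g} := by
      intro g hg
      refine Occ.mono fun f' hf' => ?_
      by_cases hf'f : f' = f
      · subst hf'f
        by_cases hgf : g = f'
        · subst hgf; exact absurd hf'.2 (lt_irrefl _)
        · have h1 := hup g hg hgf
          have h2 := hf'.2
          rw [Function.update_self, h1.2.1] at h2
          omega
      · have h1 := hup f' hf'.1 hf'f
        refine ⟨h1.1, ?_⟩
        by_cases hgf : g = f
        · exact Or.inl hgf
        · have h2 := hup g hg hgf
          have h3 := hf'.2
          rw [h1.2.1, h2.2.1] at h3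
          exact Or.inr h3
    refine ⟨Function.update r f n, ⟨?_, fun g hg i j hij hD => h.args_inj hg hij hD, ?_⟩, ?_⟩
    · intro g hg g' hg' heq
      by_cases hgf : g = f <;> by_cases hgf' : g' = f
      · rw [hgf, hgf']
      · have := hup g' hg' hgf'
        rw [hgf, Function.update_self, this.2.1] at heq; omega
      · have := hup g hg hgf
        rw [hgf', Function.update_self, this.2.1] at heq; omega
      · have h1 := hup g hg hgf
        have h2 := hup g' hg' hgf'
        rw [h1.2.1, h2.2.1] at heq
        exact hr.inj h1.1 h2.1 heq
    · intro g hg i j hi hj h1 h2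
      have h1 := hlow g hg h1
      have h2 := hlow g hg h2
      by_cases hgf : g = f
      · subst hgf
        exact hleaf i j hi hj (Occ.mono (fun _ h => h.1) h1) (Occ.mono (fun _ h => h.1) h2)
      · simp only [hgf, false_or] at h1 h2
        exact hr.parent_unique g ⟨hg, hgf⟩ i j hi hj h1 h2
    · intro g hg
      by_cases hgf : g = f
      · subst hgf; simp
      · have := hup g hg hgf
        omega

/-! ### Positive and critical examples -/

/-- The facts `Q` with the distinguished elements `qpt` have a homomorphism to `F`, `pt`. -/
def Pos (Q : Set (Atom S W)) (qpt : Fin k → W) (F : Set (Atom S V)) (pt : Fin k → V) : Prop :=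
  ∃ h : W → V, (∀ g ∈ Q, g.map h ∈ F) ∧ ∀ l, h (qpt l) = pt l

/-- `F` is positive, and none of its proper subsets is. -/
def Crit (Q : Set (Atom S W)) (qpt : Fin k → W) (F : Set (Atom S V)) (pt : Fin k → V) : Prop :=
  Pos Q qpt F pt ∧ ∀ F' ⊆ F, Pos Q qpt F' pt → F' = F

variable {Q : Set (Atom S W)} {qpt : Fin k → W}

theorem Pos.mono {F F' : Set (Atom S V)} {pt : Fin k → V} (h : Pos Q qpt F pt) (hF : F ⊆ F') :
    Pos Q qpt F' pt := by
  obtain ⟨h, h1, h2⟩ := h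
  exact ⟨h, fun g hg => hF (h1 g hg), h2⟩

theorem Pos.map {V' : Type} {F : Set (Atom S V)} {F' : Set (Atom S V')} {pt : Fin k → V}
    {pt' : Fin k → V'} (h : Pos Q qpt F pt) (π : V → V') (hπ : ∀ f ∈ F, f.map π ∈ F')
    (hpt : ∀ l, π (pt l) = pt' l) : Pos Q qpt F' pt' := by
  obtain ⟨h, h1, h2⟩ := h
  exact ⟨π ∘ h, fun g hg => hπ _ (h1 g hg), fun l => by simp [h2, hpt]⟩

theorem Pos.pt_mem {F : Set (Atom S V)} {pt : Fin k → V} (h : Pos Q qpt F pt)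
    (hQ : ∀ w, w ∈ Occ Q) (l : Fin k) : pt l ∈ Occ F := by
  obtain ⟨h, h1, h2⟩ := h
  obtain ⟨g, hg, i, hi⟩ := hQ (qpt l)
  exact ⟨_, h1 g hg, i, by rw [← h2, ← hi]; rfl⟩

theorem Crit.image_eq {F : Set (Atom S V)} {pt : Fin k → V} (hF : Crit Q qpt F pt) {h : W → V}
    (h1 : ∀ g ∈ Q, g.map h ∈ F) (h2 : ∀ l, h (qpt l) = pt l) : Atom.map h '' Q = F :=
  hF.2 _ (by rintro _ ⟨g, hg, rfl⟩; exact h1 g hg) ⟨h, fun g hg => ⟨g, hg, rfl⟩, h2⟩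

theorem Occ.image (h : W → V) (Q : Set (Atom S W)) : Occ (Atom.map h '' Q) = h '' Occ Q := by
  ext v
  constructor
  · rintro ⟨_, ⟨g, hg, rfl⟩, i, rfl⟩
    exact ⟨_, ⟨g, hg, i, rfl⟩, rfl⟩
  · rintro ⟨_, ⟨g, hg, i, rfl⟩, rfl⟩
    exact ⟨_, ⟨g, hg, rfl⟩, i, rfl⟩

/-- Critical examples are homomorphic images, thus not larger. -/
theorem Crit.finite_and_ncard_le {F : Set (Atom S V)} {pt : Fin k → V} (hF : Crit Q qpt F pt)
    (hfin : Q.Finite) [Finite W] :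
    F.Finite ∧ F.ncard ≤ Q.ncard ∧ (Occ F).ncard ≤ Nat.card W := by
  obtain ⟨h, h1, h2⟩ := hF.1
  rw [← hF.image_eq h1 h2]
  refine ⟨hfin.image _, Set.ncard_image_le hfin, ?_⟩
  rw [Occ.image]
  refine (Set.ncard_image_le (Set.toFinite _)).trans ?_
  rw [← Set.ncard_univ]
  exact Set.ncard_le_ncard (Set.subset_univ _)

theorem Atom.map_congr {f : Atom S V} {h h' : V → W} (H : ∀ i, h (f.args i) = h' (f.args i)) :
    f.map h = f.map h' := by
  simp only [Atom.map, H]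

theorem Atom.map_eq_self {f : Atom S V} {h : V → V} (H : ∀ i, h (f.args i) = f.args i) :
    f.map h = f := by
  simp only [Atom.map, H]

theorem Atom.map_injOn {F : Set (Atom S V)} {h : V → W} (H : Set.InjOn h (Occ F)) :
    Set.InjOn (Atom.map h) F := by
  rintro ⟨r, x⟩ hf ⟨r', x'⟩ hf' heq
  simp only [Atom.map, Atom.mk.injEq] at heq
  obtain ⟨rfl, heq⟩ := heq
  rw [heq_eq_eq] at heq
  congr 1
  funext i
  exact H ⟨_, hf, i, rfl⟩ ⟨_, hf', i, rfl⟩ (congrFun heq i)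

/-- If a positive example `F'` maps to a critical example `F`, then `F'` is larger than `F`, or
the map is an isomorphism and thus has a section. -/
theorem Crit.exists_section {V' : Type} [Nonempty V'] {F : Set (Atom S V)} {pt : Fin k → V}
    {F' : Set (Atom S V')} {pt' : Fin k → V'} (hF : Crit Q qpt F pt) (hQ : ∀ w, w ∈ Occ Q)
    (hF' : Pos Q qpt F' pt') (hfin : F'.Finite) (π : V' → V) (hπ : ∀ f ∈ F', f.map π ∈ F)
    (hpt : ∀ l, π (pt' l) = pt l)
    (hle : (Occ F').ncard + F'.ncard ≤ (Occ F).ncard + F.ncard) :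
    ∃ s : V → V', (∀ v ∈ Occ F, π (s v) = v) ∧ (∀ f ∈ F, f.map s ∈ F') ∧
      ∀ l, s (pt l) = pt' l := by
  have himg : Atom.map π '' F' = F := by
    refine hF.2 _ (by rintro _ ⟨f, hf, rfl⟩; exact hπ f hf) (hF'.map π ?_ hpt)
    exact fun f hf => ⟨f, hf, rfl⟩
  have hocc : π '' Occ F' = Occ F := by rw [← Occ.image, himg]
  have hinj : Set.InjOn π (Occ F') := by
    refine Set.injOn_of_ncard_image_eq ?_ (Occ.finite hfin)
    have h1 := Set.ncard_image_le (f := Atom.map π) hfin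
    have h2 := Set.ncard_image_le (f := π) (Occ.finite hfin)
    rw [himg] at h1
    rw [hocc] at h2 ⊢
    omega
  have hs : ∀ v ∈ Occ F', Function.invFunOn π (Occ F') (π v) = v := fun v hv =>
    hinj (Function.invFunOn_mem ⟨v, hv, rfl⟩) hv (Function.invFunOn_eq ⟨v, hv, rfl⟩)
  refine ⟨Function.invFunOn π (Occ F'), ?_, ?_, ?_⟩
  · intro v hv
    rw [← hocc] at hv
    exact Function.invFunOn_eq hv
  · intro f hf
    rw [← himg] at hf
    obtain ⟨f', hf', rfl⟩ := hf
    convert hf'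
    exact Atom.map_eq_self (h := Function.invFunOn π (Occ F') ∘ π) fun i => hs _ ⟨f', hf', i, rfl⟩
  · intro l
    rw [← hpt]
    exact hs _ (hF'.pt_mem hQ l)

end

section

variable {S : Schema} {V W : Type} {k : ℕ}

/-! ### Atoms as lists -/

/-- An atom in the form in which the programs see it. -/
def Atom.raw (f : Atom S V) : RawAtom V := (f.rel, List.ofFn f.args)

theorem Atom.raw_injective : Function.Injective (Atom.raw : Atom S V → RawAtom V) := by
  rintro ⟨r, x⟩ ⟨r', x'⟩ h
  simp only [Atom.raw, Prod.mk.injEq] at h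
  obtain ⟨h1, h2⟩ := h
  obtain rfl := Fin.ext h1
  rw [List.ofFn_inj.1 h2]

theorem Atom.mem_raw {f : Atom S V} {v : V} : v ∈ f.raw.2 ↔ ∃ i, f.args i = v := by
  simp [Atom.raw, List.mem_ofFn]

/-- No fact is a dummy label, because arities are positive. -/
theorem Atom.raw_ne (f : Atom S V) : f.raw ≠ (0, []) := by
  intro h
  have h1 : f.args ⟨0, S.arity_pos _⟩ ∈ f.raw.2 := Atom.mem_raw.2 ⟨_, rfl⟩
  rw [h] at h1
  simp at h1

/-! ### Unfolding cycles -/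

/-- The facts of the cover; see `coverAllowed`. -/
def CoverAllowed (D : Set V) (δ : RawAtom V × ℕ × ℕ) (n : ℕ)
    (f : Atom S (V × RawAtom V × ℕ × ℕ)) : Prop :=
  ∃ (i : Fin (S.arity f.rel)) (d : ℕ), d < n + 1 ∧ ∀ j,
    ((f.args j).1 ∈ D → (f.args j).2 = δ) ∧
    ((f.args j).1 ∉ D → (j = i → (f.args j).2.2.2 = d) ∧
      (j ≠ i → (f.args j).2 = ((f.map Prod.fst).raw, (j : ℕ), next n d)))

/-- The labels of the cover. -/
def CoverLab (F : Set (Atom S V)) (δ : RawAtom V × ℕ × ℕ) (n R : ℕ) :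
    Set (RawAtom V × ℕ × ℕ) :=
  {b | b = δ ∨ ∃ f ∈ F, ∃ i < R, ∃ d < n + 1, b = (f.raw, i, d)}

theorem next_lt {n d : ℕ} (h : d < n + 1) : next n d < n + 1 := by
  unfold next
  split_ifs with h1
  · omega
  · have : d ≠ n := by simpa using h1
    omega

/-- A forest has no obstruction against unfolding: its homomorphisms lift to the cover. The labels
are chosen one fact at a time: the parent of a new fact already has one, and it prescribes those
of the other arguments. -/
theorem Pos.cover {Q : Set (Atom S W)} {qpt : Fin k → W} {F : Set (Atom S V)} {pt : Fin k → V}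
    {δ : RawAtom V × ℕ × ℕ} {n R : ℕ} (h : Pos Q qpt F pt) (hQ : Acyc Q (Set.range qpt))
    (hfin : Q.Finite) (hR : ∀ r, S.arity r ≤ R) (hδ : δ.2.2 < n + 1) :
    Pos Q qpt {f : Atom S (V × RawAtom V × ℕ × ℕ) | f.map Prod.fst ∈ F ∧
      (∀ j, (f.args j).2 ∈ CoverLab F δ n R) ∧ CoverAllowed (Set.range pt) δ n f}
      fun l => (pt l, δ) := by
  classical
  obtain ⟨h, h1, h2⟩ := h
  obtain ⟨r, hr⟩ := hQ.exists_forestRank hfin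
  have hD : ∀ u, h u ∉ Set.range pt → u ∉ Set.range qpt := by
    rintro _ hu ⟨l, rfl⟩
    exact hu ⟨l, (h2 l).symm⟩
  have key : ∀ m : ℕ, ∃ b : W → RawAtom V × ℕ × ℕ, (∀ u, b u ∈ CoverLab F δ n R) ∧
      (∀ u, h u ∈ Set.range pt → b u = δ) ∧
      ∀ g ∈ Q, r g < m → CoverAllowed (Set.range pt) δ n (g.map fun u => (h u, b u)) := by
    intro m
    induction m with
    | zero => exact ⟨fun _ => δ, fun _ => Or.inl rfl, fun _ _ => rfl, by simp⟩
    | succ m ih =>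
      obtain ⟨b, hb1, hb2, hb3⟩ := ih
      by_cases hg : ∃ g ∈ Q, r g = m
      swap
      · refine ⟨b, hb1, hb2, fun g hgQ hgm => hb3 g hgQ ?_⟩
        by_contra hlt
        exact hg ⟨g, hgQ, by omega⟩
      obtain ⟨g, hgQ, hgm⟩ := hg
      obtain ⟨i, hi⟩ : ∃ i, ∀ j, h (g.args j) ∉ Set.range pt →
          g.args j ∈ Occ {g' ∈ Q | r g' < r g} → j = i := by
        by_cases hex : ∃ i, h (g.args i) ∉ Set.range pt ∧ g.args i ∈ Occ {g' ∈ Q | r g' < r g}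
        · obtain ⟨i, hi1, hi2⟩ := hex
          exact ⟨i, fun j hj1 hj2 =>
            hr.parent_unique g hgQ j i (hD _ hj1) (hD _ hi1) hj2 hi2⟩
        · exact ⟨⟨0, S.arity_pos _⟩, fun j hj1 hj2 => (hex ⟨j, hj1, hj2⟩).elim⟩
      let d := (b (g.args i)).2.2
      have hd : d < n + 1 := by
        rcases hb1 (g.args i) with h3 | ⟨_, _, _, _, d', hd', h3⟩
        · simp only [d, h3]; exact hδ
        · simp only [d, h3]; exact hd'
      let b' : W → RawAtom V × ℕ × ℕ := fun u =>
        if H : ∃ j, j ≠ i ∧ g.args j = u ∧ h u ∉ Set.range pt then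
          ((g.map h).raw, (H.choose : ℕ), next n d) else b u
      have hb'1 : ∀ j, j ≠ i → h (g.args j) ∉ Set.range pt →
          b' (g.args j) = ((g.map h).raw, (j : ℕ), next n d) := by
        intro j hj hjD
        have H : ∃ j', j' ≠ i ∧ g.args j' = g.args j ∧ h (g.args j) ∉ Set.range pt :=
          ⟨j, hj, rfl, hjD⟩
        have h3 : H.choose = j :=
          (hr.args_inj g hgQ _ _ H.choose_spec.2.1.symm (hD _ hjD)).symm
        simp only [b', dif_pos H, h3]
      have hb'2 : ∀ u, (h u ∉ Set.range pt → ∀ j, g.args j = u → j = i) → b' u = b u := by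
        intro u hu
        refine dif_neg ?_
        rintro ⟨j, hj, hju, hjD⟩
        exact hj (hu hjD j hju)
      refine ⟨b', fun u => ?_, fun u hu => ?_, fun g' hg' hg'm => ?_⟩
      · by_cases H : ∃ j, j ≠ i ∧ g.args j = u ∧ h u ∉ Set.range pt
        · obtain ⟨j, hj, rfl, hjD⟩ := H
          rw [hb'1 j hj hjD]
          exact Or.inr ⟨_, h1 g hgQ, j, j.2.trans_le (hR _), _, next_lt hd, rfl⟩
        · rw [show b' u = b u from dif_neg H]
          exact hb1 u
      · rw [hb'2 u fun h3 => (h3 hu).elim]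
        exact hb2 u hu
      · rcases Nat.lt_or_ge (r g') m with hlt | _
        · have h3 : (g'.map fun u => (h u, b' u)) = g'.map fun u => (h u, b u) := by
            refine Atom.map_congr fun j => ?_
            rw [hb'2]
            intro h4 j' hj'
            refine hi j' (by rwa [hj']) ?_
            rw [hj']
            exact ⟨g', ⟨hg', by omega⟩, j, rfl⟩
          rw [h3]
          exact hb3 g' hg' hlt
        · obtain rfl : g' = g := hr.inj hg' hgQ (by omega)
          refine ⟨i, d, hd, fun j => ⟨fun hj => ?_, fun hj => ⟨fun hji => ?_,
            fun hji => hb'1 j hji hj⟩⟩⟩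
          · have := hb'2 (g'.args j) fun h3 => (h3 hj).elim
            exact this.trans (hb2 _ hj)
          · have := hb'2 (g'.args i) fun h3 j' hj' =>
              (hr.args_inj g' hg' i j' hj'.symm (hD _ h3)).symm
            rw [hji]
            exact congrArg (fun x => x.2.2) this
  obtain ⟨m, hm⟩ := (hfin.image r).bddAbove
  obtain ⟨b, hb1, hb2, hb3⟩ := key (m + 1)
  refine ⟨fun u => (h u, b u), fun g hg => ⟨h1 g hg, fun j => hb1 _, hb3 g hg ?_⟩, fun l => ?_⟩
  · have := hm ⟨g, hg, rfl⟩
    omega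
  · dsimp only
    rw [hb2 (qpt l) ⟨l, (h2 l).symm⟩, h2]

theorem next_modEq (n d : ℕ) : next n d ≡ d + 1 [MOD n + 1] := by
  unfold next
  split_ifs with h
  · obtain rfl : d = n := by simpa using h
    exact (Nat.modEq_zero_iff_dvd.2 dvd_rfl).symm
  · rfl

theorem ofNat_succ (m t : ℕ) : Fin.ofNat (m + 1) (t + 1) = Fin.ofNat (m + 1) t + 1 := by
  ext
  simp [Fin.ofNat, Fin.add_def]

/-- If the depth changes by one along each step of a cycle, then its length is divisible by
`n + 1`. -/
theorem dvd_of_depth {m n : ℕ} (b : Fin (m + 1) → ℕ)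
    (h : (∀ t, b (t + 1) = next n (b t)) ∨ ∀ t, b t = next n (b (t + 1))) : n + 1 ∣ m + 1 := by
  have hz : Fin.ofNat (m + 1) (m + 1) = 0 := by ext; simp
  rcases h with h | h
  · have key : ∀ t : ℕ, b (Fin.ofNat (m + 1) t) ≡ b 0 + t [MOD n + 1] := by
      intro t
      induction t with
      | zero => simp; rfl
      | succ t ih =>
        rw [ofNat_succ, h]
        exact (next_modEq _ _).trans (ih.add_right 1)
    have h1 := key (m + 1)
    rw [hz] at h1
    exact (Nat.modEq_zero_iff_dvd.1 (Nat.ModEq.add_left_cancel' (b 0) h1.symm))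
  · have key : ∀ t : ℕ, b 0 ≡ b (Fin.ofNat (m + 1) t) + t [MOD n + 1] := by
      intro t
      induction t with
      | zero => simp; rfl
      | succ t ih =>
        rw [h (Fin.ofNat (m + 1) t)] at ih
        rw [ofNat_succ]
        refine ih.trans (((next_modEq _ _).add_right t).trans ?_)
        rw [add_assoc, add_comm 1 t]
    have h1 := key (m + 1)
    rw [hz] at h1
    exact (Nat.modEq_zero_iff_dvd.1 (Nat.ModEq.add_left_cancel' (b 0) h1.symm))

/-- A section of the cover orients each fact and gives each element at most one parent, so a
cycle would be a directed one. Its length is less than `n + 1`, which the depth forbids. -/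
theorem acyc_of_section {F : Set (Atom S V)} {D : Set V} {δ : RawAtom V × ℕ × ℕ} {n : ℕ}
    (hfin : F.Finite) (hn : (Occ F).ncard ≤ n) (s : V → V × RawAtom V × ℕ × ℕ)
    (hs1 : ∀ v ∈ Occ F, (s v).1 = v) (hs2 : ∀ f ∈ F, CoverAllowed D δ n (f.map s)) :
    Acyc F D := by
  intro m a f i j hc
  by_contra! hD
  have hlen : m + 1 ≤ n := by
    have h1 : Set.range a ⊆ Occ F := by
      rintro _ ⟨t, rfl⟩
      exact ⟨f t, hc.facts_mem t, i t, hc.leave t⟩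
    have h2 := Set.ncard_le_ncard h1 (Occ.finite hfin)
    rw [← Nat.card_coe_set_eq, Nat.card_range_of_injective hc.elements_distinct,
      Nat.card_eq_fintype_card, Fintype.card_fin] at h2
    omega
  -- the elements before and after `f t` are two children of `f t`, or parent and child
  have hstep : ∀ t,
      ((s (a t)).2.1 = (f t).raw ∧ (s (a t)).2.2.1 = i t ∧
        (s (a (t + 1))).2.1 = (f t).raw ∧ (s (a (t + 1))).2.2.1 = j t) ∨
      ((s (a (t + 1))).2.1 = (f t).raw ∧ (s (a (t + 1))).2.2.2 = next n (s (a t)).2.2.2) ∨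
      ((s (a t)).2.1 = (f t).raw ∧ (s (a t)).2.2.2 = next n (s (a (t + 1))).2.2.2) := by
    intro t
    obtain ⟨p, d, -, hp⟩ := hs2 _ (hc.facts_mem t)
    have hraw : ((f t).map s).map Prod.fst = f t :=
      Atom.map_eq_self (h := fun v => (s v).1) fun x => hs1 _ ⟨f t, hc.facts_mem t, x, rfl⟩
    have hq : ∀ x v, (f t).args x = v → v ∉ D → (x = p → (s v).2.2.2 = d) ∧
        (x ≠ p → (s v).2 = ((f t).raw, (x : ℕ), next n d)) := by
      rintro x _ rfl hv
      have h1 := (hp x).2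
      rw [hraw] at h1
      refine h1 ?_
      have : (((f t).map s).args x).1 = (f t).args x := hs1 _ ⟨f t, hc.facts_mem t, x, rfl⟩
      rwa [this]
    have hi := hq _ _ (hc.leave t) (hD t)
    have hj := hq _ _ (hc.arrive t) (hD _)
    by_cases h1 : i t = p
    · have h2 : j t ≠ p := fun h2 => hc.edges_distinct t (h1.trans h2.symm)
      right; left
      rw [hj.2 h2, hi.1 h1]
      exact ⟨rfl, rfl⟩
    · by_cases h2 : j t = p
      · right; right
        rw [hi.2 h1, hj.1 h2]
        exact ⟨rfl, rfl⟩
      · left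
        rw [hj.2 h2, hi.2 h1]
        exact ⟨rfl, rfl, rfl, rfl⟩
  have hnot : ¬ n + 1 ∣ m + 1 := fun h => by
    have := Nat.le_of_dvd (by omega) h
    omega
  -- for `m = 0`, the facts `f t` and `f (t + 1)` coincide, so this case is separate
  rcases Nat.eq_zero_or_pos m with rfl | hm
  · have h0 : (0 : Fin 1) + 1 = 0 := rfl
    rcases hstep 0 with h | h | h
    · rw [h0, h.2.1] at h
      exact hc.edges_distinct 0 (Fin.ext h.2.2.2)
    · refine hnot (dvd_of_depth (m := 0) (fun t => (s (a t)).2.2.2) (Or.inl fun t => ?_))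
      rw [Subsingleton.elim (α := Fin 1) t 0]; exact h.2
    · refine hnot (dvd_of_depth (m := 0) (fun t => (s (a t)).2.2.2) (Or.inr fun t => ?_))
      rw [Subsingleton.elim (α := Fin 1) t 0]; exact h.2
  have hne : ∀ t : Fin (m + 1), t + 1 ≠ t := by
    intro t h
    have h1 : (1 : Fin (m + 1)) = 0 := by simpa using h
    have h2 := congrArg Fin.val h1
    obtain ⟨m, rfl⟩ : ∃ m', m = m' + 1 := ⟨m - 1, by omega⟩
    simp at h2
  -- a step down to a child is followed by another one, since each element names only one parent
  by_cases hex : ∃ t, (s (a (t + 1))).2.1 = (f t).raw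
  · obtain ⟨t0, ht0⟩ := hex
    have hstep' : ∀ t, (s (a (t + 1))).2.1 = (f t).raw →
        (s (a (t + 1 + 1))).2.1 = (f (t + 1)).raw ∧
        (s (a (t + 1 + 1))).2.2.2 = next n (s (a (t + 1))).2.2.2 := by
      intro t ht
      have h1 : (s (a (t + 1))).2.1 ≠ (f (t + 1)).raw := by
        rw [ht]
        exact fun h => hne t (hc.facts_distinct (Atom.raw_injective h)).symm
      rcases hstep (t + 1) with h | h | h
      · exact (h1 h.1).elim
      · exact h
      · exact (h1 h.1).elim
    have hall : ∀ x : ℕ, (s (a (t0 + Fin.ofNat (m + 1) x + 1))).2.1 =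
        (f (t0 + Fin.ofNat (m + 1) x)).raw := by
      intro x
      induction x with
      | zero => simpa using ht0
      | succ x ih =>
        have := (hstep' _ ih).1
        rwa [ofNat_succ, ← add_assoc]
    have hall' : ∀ t, (s (a (t + 1))).2.1 = (f t).raw := by
      intro t
      have := hall (t - t0 : Fin (m + 1)).val
      rw [Fin.ofNat_val_eq_self] at this
      simpa using this
    refine hnot (dvd_of_depth (fun t => (s (a t)).2.2.2) (Or.inl fun t => ?_))
    have := (hstep' (t - 1) (hall' _)).2
    simpa using this
  · push Not at hex
    refine hnot (dvd_of_depth (fun t => (s (a t)).2.2.2) (Or.inr fun t => ?_))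
    rcases hstep t with h | h | h
    · exact (hex t h.2.2.1).elim
    · exact (hex t h.1).elim
    · exact h.2

end

section

variable {S : Schema} {V W : Type} {k : ℕ}

/-! ### Weakening a forest -/

/-- Good labelled facts; see `frontGood`. -/
def FrontGood (D : Set V) (f : Atom S (V × RawAtom V)) : Prop :=
  ∀ j, ((f.args j).1 ∈ D → (f.args j).2 = (0, [])) ∧
    ((f.args j).1 ∉ D → (f.args j).2 = (f.map Prod.fst).raw ∨ (f.args j).1 ∉ (f.args j).2.2)

/-- All labelled facts over `F`. -/
def FrontLifts (F : Set (Atom S V)) : Set (Atom S (V × RawAtom V)) :=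
  {f | f.map Prod.fst ∈ F ∧ ∀ j, (f.args j).2 = (0, []) ∨ ∃ f' ∈ F, (f.args j).2 = f'.raw}

/-- The element `v` occurs in facts of smaller rank than `f`. -/
def Earlier (F : Set (Atom S V)) (r : Atom S V → ℕ) (f : Atom S V) (v : V) : Prop :=
  v ∈ Occ {f' ∈ F | r f' < r f}

/-- `f'` is the fact that introduces the parent element of `f`. -/
def Par (F : Set (Atom S V)) (D : Set V) (r : Atom S V → ℕ) (f f' : Atom S V) : Prop :=
  f' ∈ F ∧ ∃ i, f.args i ∉ D ∧ Earlier F r f (f.args i) ∧ ¬ Earlier F r f' (f.args i) ∧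
    ∃ j, f'.args j = f.args i

/-- The subforest that is rooted at an element `v` embeds at `u`: for each child fact of `v` there
is a copy in `Q` whose further elements satisfy `P`. -/
def Extends (Q : Set (Atom S W)) (qpt : Fin k → W) (F : Set (Atom S V)) (pt : Fin k → V)
    (r : Atom S V → ℕ) (P : W → V → Prop) (u : W) (v : V) : Prop :=
  ∀ f ∈ F, ∀ i, f.args i = v → Earlier F r f v → ∃ y : Fin (S.arity f.rel) → W,
    ⟨f.rel, y⟩ ∈ Q ∧ y i = u ∧ (∀ j l, f.args j = pt l → y j = qpt l) ∧
    ∀ j ≠ i, f.args j ∉ Set.range pt → P (y j) (f.args j)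

/-- The subforest that is rooted at `v` maps to `Q`, with `v` mapped to `u`: the largest
predicate that is preserved by `Extends`. -/
def Embeds (Q : Set (Atom S W)) (qpt : Fin k → W) (F : Set (Atom S V)) (pt : Fin k → V)
    (r : Atom S V → ℕ) (u : W) (v : V) : Prop :=
  ∃ P : W → V → Prop, P u v ∧ ∀ u v, P u v → Extends Q qpt F pt r P u v

/-- The tree with the root fact `f` maps to `Q`. -/
def Realized (Q : Set (Atom S W)) (qpt : Fin k → W) (F : Set (Atom S V)) (pt : Fin k → V)
    (r : Atom S V → ℕ) (f : Atom S V) : Prop :=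
  ∃ y : Fin (S.arity f.rel) → W, ⟨f.rel, y⟩ ∈ Q ∧ (∀ j l, f.args j = pt l → y j = qpt l) ∧
    ∀ j, f.args j ∉ Set.range pt → Embeds Q qpt F pt r (y j) (f.args j)

/-- `f` has no parent. -/
def IsRoot (F : Set (Atom S V)) (D : Set V) (r : Atom S V → ℕ) (f : Atom S V) : Prop :=
  ∀ i, f.args i ∉ D → ¬ Earlier F r f (f.args i)

variable {Q : Set (Atom S W)} {qpt : Fin k → W} {F : Set (Atom S V)} {pt : Fin k → V}
  {r : Atom S V → ℕ} {D : Set V}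

theorem Extends.mono {P P' : W → V → Prop} (h : ∀ u v, P u v → P' u v) {u : W} {v : V}
    (hu : Extends Q qpt F pt r P u v) : Extends Q qpt F pt r P' u v := by
  intro f hf i hi he
  obtain ⟨y, h1, h2, h3, h4⟩ := hu f hf i hi he
  exact ⟨y, h1, h2, h3, fun j hj hjD => h _ _ (h4 j hj hjD)⟩

theorem embeds_iff {u : W} {v : V} :
    Embeds Q qpt F pt r u v ↔ Extends Q qpt F pt r (Embeds Q qpt F pt r) u v := by
  have h1 : ∀ u v, Embeds Q qpt F pt r u v → Extends Q qpt F pt r (Embeds Q qpt F pt r) u v :=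
    fun u v ⟨P, hP, hP'⟩ => (hP' u v hP).mono fun u v h => ⟨P, h, hP'⟩
  exact ⟨h1 u v, fun h => ⟨_, h, fun u v h' => h'.mono h1⟩⟩

/-- If all trees of a forest map to `Q`, then the whole forest does. -/
theorem exists_hom_of_realized [Nonempty W] (hr : ForestRank F (Set.range pt) r) (hfin : F.Finite)
    (hpat : ∀ l l', pt l = pt l' → qpt l = qpt l')
    (hroot : ∀ f ∈ F, IsRoot F (Set.range pt) r f → Realized Q qpt F pt r f) :
    ∃ s : V → W, (∀ f ∈ F, f.map s ∈ Q) ∧ ∀ l, s (pt l) = qpt l := by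
  classical
  have key : ∀ n : ℕ, ∃ s : V → W, (∀ l, s (pt l) = qpt l) ∧ ∀ f ∈ F, r f < n → f.map s ∈ Q ∧
      ∀ i, f.args i ∉ Set.range pt → Embeds Q qpt F pt r (s (f.args i)) (f.args i) := by
    intro n
    induction n with
    | zero =>
      refine ⟨fun v => if h : ∃ l, pt l = v then qpt h.choose else Classical.arbitrary W,
        fun l => ?_, by simp⟩
      have h : ∃ l', pt l' = pt l := ⟨l, rfl⟩
      simp only [dif_pos h]
      exact hpat _ _ h.choose_spec
    | succ n ih =>
      obtain ⟨s, hs1, hs2⟩ := ih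
      by_cases hg : ∃ f ∈ F, r f = n
      swap
      · refine ⟨s, hs1, fun g hgF hgn => hs2 g hgF ?_⟩
        by_contra hlt
        exact hg ⟨g, hgF, by omega⟩
      obtain ⟨f, hf, hfn⟩ := hg
      obtain ⟨y, hyQ, hypt, hyE, hys⟩ : ∃ y : Fin (S.arity f.rel) → W, ⟨f.rel, y⟩ ∈ Q ∧
          (∀ j l, f.args j = pt l → y j = qpt l) ∧
          (∀ j, f.args j ∉ Set.range pt → Embeds Q qpt F pt r (y j) (f.args j)) ∧
          ∀ j, f.args j ∉ Set.range pt → Earlier F r f (f.args j) → y j = s (f.args j) := by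
        by_cases hfr : IsRoot F (Set.range pt) r f
        · obtain ⟨y, h1, h2, h3⟩ := hroot f hf hfr
          exact ⟨y, h1, h2, h3, fun j hj he => (hfr j hj he).elim⟩
        · unfold IsRoot at hfr
          push Not at hfr
          obtain ⟨i, hi, he⟩ := hfr
          have hE : Embeds Q qpt F pt r (s (f.args i)) (f.args i) := by
            obtain ⟨f', ⟨hf', hlt⟩, j, hj⟩ := he
            rw [← hj]
            exact (hs2 f' hf' (by omega)).2 j (by rwa [hj])
          obtain ⟨y, h1, h2, h3, h4⟩ := embeds_iff.1 hE f hf i rfl he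
          refine ⟨y, h1, h3, fun j hj => ?_, fun j hj hje => ?_⟩
          · by_cases hji : j = i
            · subst hji; rwa [h2]
            · exact h4 j hji hj
          · obtain rfl := hr.parent_unique f hf j i hj hi hje he
            exact h2
      let s' : V → W := fun v =>
        if h : ∃ j, f.args j = v ∧ v ∉ Set.range pt then y h.choose else s v
      have hs'1 : ∀ j, f.args j ∉ Set.range pt → s' (f.args j) = y j := by
        intro j hj
        have h : ∃ j', f.args j' = f.args j ∧ f.args j ∉ Set.range pt := ⟨j, rfl, hj⟩
        have h2 : h.choose = j := (hr.args_inj f hf _ _ h.choose_spec.1.symm hj).symm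
        simp only [s', dif_pos h, h2]
      have hs'2 : ∀ v, v ∈ Set.range pt → s' v = s v := fun v hv =>
        dif_neg (by rintro ⟨_, _, h⟩; exact h hv)
      have hs'3 : ∀ v, Earlier F r f v → s' v = s v := by
        intro v hv
        by_cases h : ∃ j, f.args j = v ∧ v ∉ Set.range pt
        · obtain ⟨j, rfl, hj⟩ := h
          rw [hs'1 j hj, hys j hj hv]
        · exact dif_neg h
      refine ⟨s', fun l => by rw [hs'2 _ ⟨l, rfl⟩, hs1], fun g hg hgn => ?_⟩
      rcases Nat.lt_or_ge (r g) n with hlt | _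
      · have h1 : ∀ i, s' (g.args i) = s (g.args i) := fun i =>
          hs'3 _ ⟨g, ⟨hg, by omega⟩, i, rfl⟩
        rw [Atom.map_congr h1]
        refine ⟨(hs2 g hg hlt).1, fun i hi => ?_⟩
        rw [h1]
        exact (hs2 g hg hlt).2 i hi
      · obtain rfl : g = f := hr.inj hg hf (by omega)
        have h1 : g.map s' = ⟨g.rel, y⟩ := by
          simp only [Atom.map, Atom.mk.injEq, heq_eq_eq, true_and]
          funext j
          by_cases hj : g.args j ∈ Set.range pt
          · obtain ⟨l, hl⟩ := hj
            rw [hypt j l hl.symm, ← hl, hs'2 _ ⟨l, rfl⟩, hs1]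
          · exact hs'1 j hj
        rw [h1]
        refine ⟨hyQ, fun i hi => ?_⟩
        rw [hs'1 i hi]
        exact hyE i hi
  obtain ⟨m, hm⟩ := (hfin.image r).bddAbove
  obtain ⟨s, h1, h2⟩ := key (m + 1)
  refine ⟨s, fun f hf => (h2 f hf ?_).1, h1⟩
  have := hm ⟨f, hf, rfl⟩
  omega

/-- Each element of a forest is introduced by one fact. -/
theorem exists_birth {f : Atom S V} (hf : f ∈ F) (i : Fin (S.arity f.rel)) :
    ∃ b ∈ F, (∃ j, b.args j = f.args i) ∧ ¬ Earlier F r b (f.args i) := by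
  classical
  have hex : ∃ n, ∃ b ∈ F, (∃ j, b.args j = f.args i) ∧ r b = n := ⟨_, f, hf, ⟨i, rfl⟩, rfl⟩
  obtain ⟨b, hb, hj, hn⟩ := Nat.find_spec hex
  refine ⟨b, hb, hj, ?_⟩
  rintro ⟨b', ⟨hb', hlt⟩, j', hj'⟩
  exact Nat.find_min hex (by omega) ⟨b', hb', ⟨j', hj'⟩, rfl⟩

theorem ForestRank.birth_unique (hr : ForestRank F D r) {b b' : Atom S V} {v : V} (hb : b ∈ F)
    (hb' : b' ∈ F) (hj : ∃ j, b.args j = v) (hj' : ∃ j, b'.args j = v)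
    (h : ¬ Earlier F r b v) (h' : ¬ Earlier F r b' v) : b = b' := by
  by_contra hne
  obtain ⟨j, hj⟩ := hj
  obtain ⟨j', hj'⟩ := hj'
  rcases lt_trichotomy (r b) (r b') with hlt | heq | hlt
  · exact h' ⟨b, ⟨hb, hlt⟩, j, hj⟩
  · exact hne (hr.inj hb hb' heq)
  · exact h ⟨b', ⟨hb', hlt⟩, j', hj'⟩

/-- Two facts that share an element outside of `D` belong to the same tree: here, membership in the
tree with the root `t` is passed on by the fact that introduces the element. -/
theorem tree_iff (hr : ForestRank F D r) {t f b : Atom S V} (ht : IsRoot F D r t) (hf : f ∈ F)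
    (hb : b ∈ F) {i : Fin (S.arity f.rel)} (hi : f.args i ∉ D) (hj : ∃ j, b.args j = f.args i)
    (hbe : ¬ Earlier F r b (f.args i)) :
    Relation.ReflTransGen (Par F D r) f t ↔ Relation.ReflTransGen (Par F D r) b t := by
  by_cases he : Earlier F r f (f.args i)
  · have hpar : Par F D r f b := ⟨hb, i, hi, he, hbe, hj⟩
    refine ⟨fun h => ?_, fun h => h.head hpar⟩
    rcases h.cases_head with rfl | ⟨c, ⟨hc, i', hi', he', hce, hcj⟩, hct⟩
    · exact (ht i hi he).elim
    · obtain rfl := hr.parent_unique f hf i i' hi hi' he he'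
      rwa [hr.birth_unique hb hc hj hcj hbe hce]
  · rw [hr.birth_unique hf hb ⟨i, rfl⟩ hj he hbe]

/-- If a tree of `F` does not map to `Q`, then no good fact over this tree is needed for the
blow-up of `F` to be positive. An element of `Q` over an element of the tree is labelled with a
child fact in whose direction the tree does not embed, and if there is none, with the
fact that introduces the element. The labels of elements over other trees are kept. -/
theorem Pos.weaken (hr : ForestRank F (Set.range pt) r) (hQ : ∀ w, w ∈ Occ Q)
    (hpat : ∀ l l', pt l = pt l' → qpt l = qpt l') {t : Atom S V}
    (ht : IsRoot F (Set.range pt) r t) (ht' : ¬ Realized Q qpt F pt r t)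
    {T : Set (Atom S (V × RawAtom V))} (hT : T ⊆ FrontLifts F)
    (hT' : ∀ f ∈ FrontLifts F, ¬ FrontGood (Set.range pt) f → f ∈ T)
    (h : Pos Q qpt T fun l => (pt l, (0, []))) :
    Pos Q qpt (T \ {f | FrontGood (Set.range pt) f ∧
      Relation.ReflTransGen (Par F (Set.range pt) r) (f.map Prod.fst) t})
      fun l => (pt l, (0, [])) := by
  obtain ⟨h1, h1T, h1pt⟩ := h
  let h : W → V := fun u => (h1 u).1
  have hF : ∀ g ∈ Q, g.map h ∈ F := fun g hg => (hT (h1T g hg)).1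
  have hpt : ∀ l, h (qpt l) = pt l := fun l => congrArg Prod.fst (h1pt l)
  -- the introducing fact of `v` belongs to the tree with the root `t`
  let UV : V → Prop := fun v => ∃ b ∈ F, (∃ j, b.args j = v) ∧ ¬ Earlier F r b v ∧
    Relation.ReflTransGen (Par F (Set.range pt) r) b t
  have hlab : ∀ u : W, ∃ a : RawAtom V,
      (u ∈ Set.range qpt → a = (0, [])) ∧
      (u ∉ Set.range qpt → h u ∈ Set.range pt → ∃ f ∈ F, a = f.raw) ∧
      (h u ∉ Set.range pt → ¬ UV (h u) → a = (h1 u).2) ∧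
      (h u ∉ Set.range pt → UV (h u) → ∃ f ∈ F, a = f.raw ∧ (∃ i, f.args i = h u) ∧
        (¬ Earlier F r f (h u) → Embeds Q qpt F pt r u (h u)) ∧
        (Earlier F r f (h u) → ∃ i, f.args i = h u ∧ ¬ ∃ y : Fin (S.arity f.rel) → W,
          ⟨f.rel, y⟩ ∈ Q ∧ y i = u ∧ (∀ j l, f.args j = pt l → y j = qpt l) ∧
          ∀ j ≠ i, f.args j ∉ Set.range pt → Embeds Q qpt F pt r (y j) (f.args j))) := by
    intro u
    obtain ⟨g, hg, i, rfl⟩ := hQ u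
    by_cases hu : g.args i ∈ Set.range qpt
    · have : h (g.args i) ∈ Set.range pt := by
        obtain ⟨l, hl⟩ := hu
        exact ⟨l, by rw [← hl, hpt]⟩
      exact ⟨(0, []), fun _ => rfl, fun h => (h hu).elim, fun h => (h this).elim,
        fun h => (h this).elim⟩
    · by_cases hD : h (g.args i) ∈ Set.range pt
      · exact ⟨_, fun h => (hu h).elim, fun _ _ => ⟨_, hF g hg, rfl⟩, fun h => (h hD).elim,
          fun h => (h hD).elim⟩
      · by_cases hUV : UV (h (g.args i))
        · by_cases hE : Embeds Q qpt F pt r (g.args i) (h (g.args i))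
          · obtain ⟨b, hb, hbj, hbe, hbt⟩ := hUV
            exact ⟨b.raw, fun h => (hu h).elim, fun _ h => (hD h).elim,
              fun _ h => (h ⟨b, hb, hbj, hbe, hbt⟩).elim,
              fun _ _ => ⟨b, hb, rfl, hbj, fun _ => hE, fun h => (hbe h).elim⟩⟩
          · have hE' := hE
            rw [embeds_iff] at hE'
            unfold Extends at hE'
            push Not at hE'
            obtain ⟨f, hf, i', hi', he, hy⟩ := hE'
            refine ⟨f.raw, fun h => (hu h).elim, fun _ h => (hD h).elim,
              fun _ h => (h hUV).elim,
              fun _ _ => ⟨f, hf, rfl, ⟨i', hi'⟩, fun h => (h he).elim, fun _ => ⟨i', hi', ?_⟩⟩⟩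
            rintro ⟨y, hy1, hy2, hy3, hy4⟩
            obtain ⟨j, hj1, hj2, hj3⟩ := hy y hy1 hy2 hy3
            exact hj3 (hy4 j hj1 hj2)
        · exact ⟨_, fun h => (hu h).elim, fun _ h => (hD h).elim, fun _ _ => rfl,
            fun _ h => (hUV h).elim⟩
  choose a ha1 ha2 ha3 ha4 using hlab
  refine ⟨fun u => (h u, a u), fun g hg => ?_, fun l => ?_⟩
  swap
  · dsimp only
    rw [hpt, ha1 _ ⟨l, rfl⟩]
  have hmemF : g.map h ∈ F := hF g hg
  have hlift : (g.map fun u => (h u, a u)) ∈ FrontLifts F := by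
    refine ⟨hmemF, fun j => ?_⟩
    change a (g.args j) = _ ∨ ∃ f' ∈ F, a (g.args j) = _
    by_cases hu : g.args j ∈ Set.range qpt
    · exact Or.inl (ha1 _ hu)
    by_cases hD : h (g.args j) ∈ Set.range pt
    · exact Or.inr (ha2 _ hu hD)
    by_cases hUV : UV (h (g.args j))
    · obtain ⟨f, hf, hf', -⟩ := ha4 _ hD hUV
      exact Or.inr ⟨f, hf, hf'⟩
    · rw [ha3 _ hD hUV]
      exact (hT (h1T g hg)).2 j
  by_cases hgood : FrontGood (Set.range pt) (g.map fun u => (h u, a u))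
  swap
  · exact ⟨hT' _ hlift hgood, fun h => hgood h.1⟩
  -- the label of an element over a distinguished element is the dummy, so it is distinguished
  have hdist : ∀ j, h (g.args j) ∈ Set.range pt → g.args j ∈ Set.range qpt := by
    intro j hj
    by_contra hu
    obtain ⟨f, _, hf⟩ := ha2 _ hu hj
    have h2 : a (g.args j) = (0, []) := (hgood j).1 hj
    exact f.raw_ne (hf.symm.trans h2)
  have hUViff : ∀ j, h (g.args j) ∉ Set.range pt → (UV (h (g.args j)) ↔
      Relation.ReflTransGen (Par F (Set.range pt) r) (g.map h) t) := by
    intro j hj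
    constructor
    · rintro ⟨b, hb, hbj, hbe, hbt⟩
      exact (tree_iff (f := g.map h) (i := j) hr ht hmemF hb hj hbj hbe).2 hbt
    · intro hgt
      obtain ⟨b, hb, hbj, hbe⟩ := exists_birth (r := r) hmemF j
      exact ⟨b, hb, hbj, hbe, (tree_iff (f := g.map h) (i := j) hr ht hmemF hb hj hbj hbe).1 hgt⟩
  by_cases hgt : Relation.ReflTransGen (Par F (Set.range pt) r) (g.map h) t
  · exfalso
    have hlab : ∀ j, h (g.args j) ∉ Set.range pt →
        (¬ Earlier F r (g.map h) (h (g.args j)) →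
          Embeds Q qpt F pt r (g.args j) (h (g.args j))) ∧
        (Earlier F r (g.map h) (h (g.args j)) → ∃ i, h (g.args i) = h (g.args j) ∧
          ¬ ∃ y : Fin (S.arity g.rel) → W, ⟨g.rel, y⟩ ∈ Q ∧ y i = g.args j ∧
          (∀ j l, h (g.args j) = pt l → y j = qpt l) ∧
          ∀ j ≠ i, h (g.args j) ∉ Set.range pt → Embeds Q qpt F pt r (y j) (h (g.args j))) := by
      intro j hj
      obtain ⟨f, _, hf2, hf3, hf4, hf5⟩ := ha4 _ hj ((hUViff j hj).2 hgt)
      have h2 : a (g.args j) = (g.map h).raw := by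
        refine ((hgood j).2 hj).resolve_right fun h3 => h3 ?_
        change h (g.args j) ∈ (a (g.args j)).2
        rw [hf2]
        exact Atom.mem_raw.2 hf3
      obtain rfl : f = g.map h := Atom.raw_injective (hf2.symm.trans h2)
      exact ⟨hf4, hf5⟩
    have hgpt : ∀ j l, h (g.args j) = pt l → g.args j = qpt l := by
      intro j l hjl
      obtain ⟨l', hl'⟩ := hdist j ⟨l, hjl.symm⟩
      rw [← hl', hpt] at hjl
      rw [← hl']
      exact hpat _ _ hjl
    by_cases hroot : IsRoot F (Set.range pt) r (g.map h)
    · have hteq : g.map h = t := by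
        rcases hgt.cases_head with h2 | ⟨c, ⟨_, i, hi, he, _⟩, _⟩
        · exact h2
        · exact (hroot i hi he).elim
      refine ht' (hteq ▸ ⟨g.args, hg, hgpt, fun j hj => (hlab j hj).1 (hroot j hj)⟩)
    · unfold IsRoot at hroot
      push Not at hroot
      obtain ⟨i, hi, he⟩ := hroot
      obtain ⟨i', hi', hy⟩ := (hlab i hi).2 he
      obtain rfl : i = i' := hr.args_inj _ hmemF i i' hi'.symm hi
      refine hy ⟨g.args, hg, rfl, hgpt, fun j hji hj => (hlab j hj).1 fun hje => hji ?_⟩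
      exact hr.parent_unique _ hmemF j i hj hi hje he
  · have heq : (g.map fun u => (h u, a u)) = g.map h1 := by
      refine Atom.map_congr fun j => ?_
      by_cases hD : h (g.args j) ∈ Set.range pt
      · obtain ⟨l, hl⟩ := hdist j hD
        rw [← hl, h1pt, hpt, ha1 _ ⟨l, rfl⟩]
      · rw [ha3 _ hD fun h2 => hgt ((hUViff j hD).1 h2)]
    exact ⟨heq ▸ h1T g hg, fun h2 => hgt h2.2⟩

/-- Without good facts over some tree of `F`, the blow-up has no section: in a section, the label
of some element of the root fact points to a child fact, the label of some further element of
that fact to a child fact of this one, and so on. -/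
theorem no_section (hr : ForestRank F (Set.range pt) r) (hfin : F.Finite) {t : Atom S V}
    (htF : t ∈ F) (ht : IsRoot F (Set.range pt) r t) {K : Set (Atom S (V × RawAtom V))}
    (hK : K ⊆ FrontLifts F)
    (hK' : ∀ f ∈ K, ¬ (FrontGood (Set.range pt) f ∧
      Relation.ReflTransGen (Par F (Set.range pt) r) (f.map Prod.fst) t))
    (s : V → V × RawAtom V) (hs1 : ∀ v ∈ Occ F, (s v).1 = v) (hs2 : ∀ f ∈ F, f.map s ∈ K)
    (hs3 : ∀ l, s (pt l) = (pt l, (0, []))) : False := by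
  obtain ⟨m, hm⟩ := (hfin.image r).bddAbove
  have key : ∀ n : ℕ, ∀ f ∈ F, m < r f + n →
      Relation.ReflTransGen (Par F (Set.range pt) r) f t →
      (∀ i, f.args i ∉ Set.range pt → Earlier F r f (f.args i) →
        (s (f.args i)).2 = f.raw) → False := by
    intro n
    induction n with
    | zero =>
      intro f hf hlt _ _
      have := hm ⟨f, hf, rfl⟩
      omega
    | succ n ih =>
      intro f hf hlt hft hpar
      have hargs : ∀ i, (s (f.args i)).1 = f.args i := fun i => hs1 _ ⟨f, hf, i, rfl⟩
      have hfs : (f.map s).map Prod.fst = f := Atom.map_eq_self (h := fun v => (s v).1) hargs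
      have hbad : ¬ FrontGood (Set.range pt) (f.map s) := fun h =>
        hK' _ (hs2 f hf) ⟨h, by rwa [hfs]⟩
      unfold FrontGood at hbad
      rw [hfs] at hbad
      obtain ⟨i, hiD, hi1, hi2⟩ : ∃ i, f.args i ∉ Set.range pt ∧ (s (f.args i)).2 ≠ f.raw ∧
          f.args i ∈ (s (f.args i)).2.2 := by
        by_contra! hcon
        have hcon' : ∀ i : Fin (S.arity f.rel), ((s (f.args i)).1 ∈ Set.range pt →
            (s (f.args i)).2 = (0, [])) ∧ ((s (f.args i)).1 ∉ Set.range pt →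
            (s (f.args i)).2 = f.raw ∨ (s (f.args i)).1 ∉ (s (f.args i)).2.2) := by
          intro i
          rw [hargs]
          refine ⟨fun ⟨l, hl⟩ => by rw [← hl, hs3], fun h => ?_⟩
          by_cases h2 : (s (f.args i)).2 = f.raw
          · exact Or.inl h2
          · exact Or.inr (hcon i h h2)
        exact hbad hcon'
      have hi3 : ¬ Earlier F r f (f.args i) := fun h => hi1 (hpar i hiD h)
      rcases (hK (hs2 f hf)).2 i with h1 | ⟨f', hf', h1⟩
      · change (s (f.args i)).2 = _ at h1
        rw [h1] at hi2
        simp at hi2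
      · change (s (f.args i)).2 = _ at h1
        rw [h1] at hi1 hi2
        obtain ⟨j, hj⟩ := Atom.mem_raw.1 hi2
        have hne : f' ≠ f := fun h => hi1 (by rw [h])
        have hlt' : r f < r f' := by
          rcases lt_trichotomy (r f) (r f') with h | h | h
          · exact h
          · exact (hne (hr.inj hf hf' h).symm).elim
          · exact (hi3 ⟨f', ⟨hf', h⟩, j, hj⟩).elim
        have he : Earlier F r f' (f'.args j) := by
          rw [hj]; exact ⟨f, ⟨hf, hlt'⟩, i, rfl⟩
        refine ih f' hf' (by omega) (hft.head ⟨hf, j, by rwa [hj], he, by rwa [hj], i, hj.symm⟩)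
          fun i' hi' he' => ?_
        obtain rfl := hr.parent_unique f' hf' i' j hi' (by rwa [hj]) he' he
        rw [hj, h1]
  exact key (m + 1) t htF (by omega) .refl fun i hi he => (ht i hi he).elim

end

/-! ### Lists of facts and their meaning -/

section

variable {S : Schema} {V V' : Type} {k : ℕ}

/-- The set of facts that is listed. -/
def atomsOf (S : Schema) (l : List (RawAtom V)) : Set (Atom S V) := {f | f.raw ∈ l}

/-- All entries of the list are facts over the schema. -/
def WF (S : Schema) (l : List (RawAtom V)) : Prop := ∀ p ∈ l, ∃ f : Atom S V, f.raw = p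

theorem WF.mono {l l' : List (RawAtom V)} (h : WF S l) (hl : l' ⊆ l) : WF S l' :=
  fun p hp => h p (hl hp)

theorem Atom.raw_map (ρ : V → V') (f : Atom S V) :
    (f.map ρ).raw = (f.raw.1, f.raw.2.map ρ) := by
  simp [Atom.raw, Atom.map, List.map_ofFn, Function.comp_def]

theorem Atom.map_injective {ρ : V → V'} (h : Function.Injective ρ) :
    Function.Injective (Atom.map ρ : Atom S V → Atom S V') := fun f g hfg =>
  Atom.map_injOn (F := Set.univ) h.injOn (Set.mem_univ f) (Set.mem_univ g) hfg

theorem atomsOf_finite (l : List (RawAtom V)) : (atomsOf S l).Finite :=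
  (List.finite_toSet l).preimage Atom.raw_injective.injOn

theorem atomsOf_mono {l l' : List (RawAtom V)} (h : l ⊆ l') : atomsOf S l ⊆ atomsOf S l' :=
  fun _ hf => h hf

theorem image_raw {l : List (RawAtom V)} (h : WF S l) : Atom.raw '' atomsOf S l = {p | p ∈ l} := by
  ext p
  constructor
  · rintro ⟨f, hf, rfl⟩; exact hf
  · intro hp
    obtain ⟨f, rfl⟩ := h p hp
    exact ⟨f, hp, rfl⟩

theorem ncard_atomsOf {l : List (RawAtom V)} (h : WF S l) (hl : l.Nodup) :
    (atomsOf S l).ncard = l.length := by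
  classical
  rw [← Set.ncard_image_of_injective _ Atom.raw_injective, image_raw h,
    ← List.toFinset_card_of_nodup hl, ← Set.ncard_coe_finset]
  congr 1
  ext p; simp

theorem atomsOf_rename {l : List (RawAtom V)} (h : WF S l) (ρ : V → V') :
    atomsOf S (l.map fun p => (p.1, p.2.map fun v => ρ v)) = Atom.map ρ '' atomsOf S l := by
  ext f
  constructor
  · intro hf
    obtain ⟨p, hp, hpf⟩ := List.mem_map.1 hf
    obtain ⟨g, rfl⟩ := h p hp
    refine ⟨g, hp, Atom.raw_injective ?_⟩
    rw [Atom.raw_map, ← hpf]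
  · rintro ⟨g, hg, rfl⟩
    exact List.mem_map.2 ⟨_, hg, (Atom.raw_map ρ g).symm⟩

theorem WF.rename {l : List (RawAtom V)} (h : WF S l) (ρ : V → V') :
    WF S (l.map fun p => (p.1, p.2.map fun v => ρ v)) := by
  intro p hp
  obtain ⟨p', hp', rfl⟩ := List.mem_map.1 hp
  obtain ⟨g, rfl⟩ := h p' hp'
  exact ⟨g.map ρ, Atom.raw_map ρ g⟩

theorem exists_raw_eq (r : Fin S.numRel) (s : List V) (h : s.length = S.arity r) :
    ∃ f : Atom S V, f.rel = r ∧ f.raw = ((r : ℕ), s) := by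
  refine ⟨⟨r, fun i => s[i]⟩, rfl, ?_⟩
  simp only [Atom.raw, Prod.mk.injEq, true_and]
  apply List.ext_getElem <;> simp [h]

section
variable [DecidableEq V]

theorem mem_elements {l : List (RawAtom V)} (h : WF S l) {v : V} :
    v ∈ elements l ↔ v ∈ Occ (atomsOf S l) := by
  simp only [elements, mem_nub, List.mem_flatMap]
  constructor
  · rintro ⟨p, hp, hv⟩
    obtain ⟨f, rfl⟩ := h p hp
    exact ⟨f, hp, Atom.mem_raw.1 hv⟩
  · rintro ⟨f, hf, hv⟩
    exact ⟨_, hf, Atom.mem_raw.2 hv⟩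

theorem ncard_occ {l : List (RawAtom V)} (h : WF S l) :
    (Occ (atomsOf S l)).ncard = (elements l).length := by
  rw [← List.toFinset_card_of_nodup (l := elements l) (nodup_nub _), ← Set.ncard_coe_finset]
  congr 1
  ext v
  simp [← mem_elements h]

theorem idxOf_injOn (l : List (RawAtom V)) (h : WF S l) :
    Set.InjOn (fun v => (elements l).idxOf v) (Occ (atomsOf S l)) := by
  intro v hv w _ hvw
  exact (List.idxOf_inj ((mem_elements h).2 hv)).1 hvw

theorem occ_compress {l : List (RawAtom V)} (h : WF S l) (pts : List V) :
    Occ (atomsOf S (compress (pts, l)).2.2) = {i | i < (elements l).length} := by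
  change Occ (atomsOf S (l.map fun p => (p.1, p.2.map fun v => (elements l).idxOf v))) = _
  rw [atomsOf_rename h, Occ.image]
  ext i
  constructor
  · rintro ⟨v, hv, rfl⟩
    exact List.idxOf_lt_length_iff.2 ((mem_elements h).2 hv)
  · intro hi
    refine ⟨(elements l)[i], (mem_elements h).1 (List.getElem_mem hi), ?_⟩
    exact List.Nodup.idxOf_getElem (nodup_nub _) i hi

end

/-! ### The oracle -/

theorem Data.ofNat_injective : Function.Injective Data.ofNat := by
  intro m
  induction m with
  | zero => intro n h; cases n <;> simp_all [Data.ofNat]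
  | succ m ih =>
    intro n h
    cases n with
    | zero => simp [Data.ofNat] at h
    | succ n => simp only [Data.ofNat, Data.cons.injEq, true_and] at h; rw [ih h]

theorem enc_list_injective {α : Type} [Enc α] (h : Function.Injective (enc : α → Data)) :
    Function.Injective (enc : List α → Data) := by
  intro l
  induction l with
  | nil => intro l' h'; cases l' <;> simp_all [enc, Data.ofList]
  | cons a l ih =>
    intro l' h'
    cases l' with
    | nil => simp [enc, Data.ofList] at h'
    | cons b l' =>
      change Data.cons (enc a) (enc l) = Data.cons (enc b) (enc l') at h'
      simp only [Data.cons.injEq] at h'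
      rw [h h'.1, ih h'.2]

theorem enc_prod_injective {α β : Type} [Enc α] [Enc β]
    (h : Function.Injective (enc : α → Data)) (h' : Function.Injective (enc : β → Data)) :
    Function.Injective (enc : α × β → Data) := by
  rintro ⟨a, b⟩ ⟨a', b'⟩ heq
  change Data.cons (enc a) (enc b) = Data.cons (enc a') (enc b') at heq
  simp only [Data.cons.injEq] at heq
  rw [h heq.1, h' heq.2]

theorem enc_rawStr_injective : Function.Injective (enc : RawStr → Data) :=
  enc_prod_injective Data.ofNat_injective (enc_prod_injective
    (enc_list_injective Data.ofNat_injective)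
    (enc_list_injective (enc_prod_injective Data.ofNat_injective
      (enc_list_injective Data.ofNat_injective))))

theorem Atom.enc_raw (f : Atom S ℕ) : enc f.raw = f.encode := by
  change Data.cons (Data.ofNat f.rel) (Data.ofList ((List.ofFn f.args).map Data.ofNat)) = _
  rw [List.map_ofFn]
  rfl

/-- The listed structure, as programs see it. -/
def Example.raw (E : Example S k) : RawStr :=
  (E.n, List.ofFn fun l => (E.pt l : ℕ), E.facts.map fun f => (f.map Fin.val).raw)

theorem Example.enc_raw (E : Example S k) : enc E.raw = E.encode := by
  change Data.cons (Data.ofNat E.n) (Data.cons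
    (Data.ofList ((List.ofFn fun l => (E.pt l : ℕ)).map Data.ofNat))
    (Data.ofList ((E.facts.map fun f => (f.map Fin.val).raw).map enc))) = _
  rw [List.map_ofFn, List.map_map]
  unfold Example.encode
  congr 3
  exact List.map_congr_left fun f _ => Atom.enc_raw _

theorem CQ.occ_conjuncts (q : CQ S k) (w : q.Var) : w ∈ Occ q.conjuncts := by
  obtain ⟨v, f, hf, j, hj⟩ := w
  refine ⟨⟨f.rel, fun i => ⟨f.args i, f, hf, i, rfl⟩⟩, hf, j, ?_⟩
  exact Subtype.ext hj

theorem CQ.finite_conjuncts (q : CQ S k) : q.conjuncts.Finite :=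
  (List.finite_toSet q.body).preimage (Atom.map_injective Subtype.val_injective).injOn

variable [DecidableEq V]

/-- The membership oracle answers "yes" to a compressed structure if and only if the structure
is positive. -/
theorem ask_compress (q : CQ S k) {l : List (RawAtom V)} (h : WF S l) (pt : Fin k → V) :
    ask q.Mem (compress (List.ofFn pt, l)) = true ↔
      Pos q.conjuncts q.headVar (atomsOf S l) pt := by
  rw [ask_eq_true]
  constructor
  · rintro ⟨E, hE, hpos⟩
    rw [← Example.enc_raw] at hE
    have hE := enc_rawStr_injective hE
    have hn : E.n = (elements l).length := congrArg Prod.fst hE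
    have hpt : (List.ofFn fun l => (E.pt l : ℕ)) =
        (List.ofFn pt).map fun v => (elements l).idxOf v := congrArg (fun A => A.2.1) hE
    have hfacts : (E.facts.map fun f => (f.map Fin.val).raw) =
        l.map fun f => (f.1, f.2.map fun v => (elements l).idxOf v) :=
      congrArg (fun A => A.2.2) hE
    rw [List.map_ofFn] at hpt
    have hpt := fun l' => congrFun (List.ofFn_injective hpt) l'
    have hpos' : Pos q.conjuncts q.headVar {f | f ∈ E.facts} E.pt := hpos
    refine hpos'.map (fun i => (elements l)[i]) (fun f hf => ?_) fun l' => ?_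
    · have h1 : (f.map Fin.val).raw ∈ E.facts.map fun f => (f.map Fin.val).raw :=
        List.mem_map_of_mem hf
      rw [hfacts] at h1
      obtain ⟨p, hp, hpf⟩ := List.mem_map.1 h1
      obtain ⟨g, rfl⟩ := h p hp
      have h2 : g.map (fun v => (elements l).idxOf v) = f.map Fin.val :=
        Atom.raw_injective (by rw [Atom.raw_map, ← hpf])
      have hgl : ∀ i, g.args i ∈ elements l := fun i => (mem_elements h).2 ⟨g, hp, i, rfl⟩
      suffices f.map (fun i => (elements l)[i]) = g by rw [this]; exact hp
      obtain ⟨r, x⟩ := g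
      obtain ⟨r', y⟩ := f
      simp only [Atom.map, Atom.mk.injEq] at h2
      obtain ⟨rfl, h2⟩ := h2
      rw [heq_eq_eq] at h2
      simp only [Atom.map, Atom.mk.injEq, heq_eq_eq, true_and]
      funext i
      have h3 := congrFun h2 i
      simp only [Fin.getElem_fin, ← h3]
      exact List.getElem_idxOf _
    · have h3 := hpt l'
      simp only [Function.comp_apply] at h3
      simp only [Fin.getElem_fin, h3]
      exact List.getElem_idxOf _
  · intro hpos
    have hocc := hpos.pt_mem q.occ_conjuncts
    obtain ⟨ν, hν1, hν2⟩ := hpos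
    have hlt : ∀ v ∈ Occ (atomsOf S l), (elements l).idxOf v < (elements l).length :=
      fun v hv => List.idxOf_lt_length_iff.2 ((mem_elements h).2 hv)
    have hνo : ∀ u, ν u ∈ Occ (atomsOf S l) := by
      intro u
      obtain ⟨g, hg, i, rfl⟩ := q.occ_conjuncts u
      exact ⟨_, hν1 g hg, i, rfl⟩
    obtain ⟨facts, hfacts⟩ : (l.map fun f => (f.1, f.2.map fun v => (elements l).idxOf v)) ∈
        Set.range (List.map fun f : Atom S (Fin (elements l).length) => (f.map Fin.val).raw) := by
      rw [Set.range_list_map]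
      intro p hp
      obtain ⟨p', hp', rfl⟩ := List.mem_map.1 hp
      obtain ⟨g, rfl⟩ := h p' hp'
      refine ⟨⟨g.rel, fun i => ⟨_, hlt (g.args i) ⟨g, hp', i, rfl⟩⟩⟩, ?_⟩
      rw [← Atom.raw_map]
      rfl
    refine ⟨⟨_, facts, fun l' => ⟨_, hlt _ (hocc l')⟩⟩, ?_, ?_⟩
    · rw [← Example.enc_raw]
      congr 1
      unfold Example.raw compress
      rw [hfacts, List.map_ofFn]
      rfl
    · refine ⟨fun u => ⟨_, hlt _ (hνo u)⟩, fun g hg => ?_, fun l' => Fin.ext ?_⟩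
      · have h1 : ((g.map ν).map fun v => (elements l).idxOf v).raw ∈
            l.map fun f => (f.1, f.2.map fun v => (elements l).idxOf v) := by
          rw [Atom.raw_map]
          exact List.mem_map_of_mem (hν1 g hg)
        rw [← hfacts] at h1
        obtain ⟨f, hf, hfg⟩ := List.mem_map.1 h1
        have h2 := Atom.raw_injective hfg
        have h3 : f = g.map fun u => (⟨_, hlt _ (hνo u)⟩ : Fin (elements l).length) :=
          Atom.map_injective Fin.val_injective h2
        exact h3 ▸ hf
      · change (elements l).idxOf (ν (q.headVar l')) = _
        rw [hν2]
        rfl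

/-! ### Greedy minimization -/

/-- One step of `minimize`, for a general test `t`. -/
def dropStep {α : Type} [DecidableEq α] (t : List α → Bool) (acc : List α) (x : α) : List α :=
  if t (acc.filter fun y => !decide (y = x)) then acc.filter fun y => !decide (y = x) else acc

theorem dropStep_subset {α : Type} [DecidableEq α] (t : List α → Bool) (acc : List α) (x : α) :
    dropStep t acc x ⊆ acc := by
  unfold dropStep
  split_ifs
  · exact List.filter_sublist.subset
  · exact List.Subset.refl _

theorem foldl_dropStep_subset {α : Type} [DecidableEq α] (t : List α → Bool) (l acc : List α) :
    l.foldl (dropStep t) acc ⊆ acc := by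
  induction l generalizing acc with
  | nil => exact List.Subset.refl _
  | cons x l ih => exact List.Subset.trans (ih _) (dropStep_subset t acc x)

theorem dropStep_test {α : Type} [DecidableEq α] {t : List α → Bool} {acc : List α}
    (h : t acc = true) (x : α) : t (dropStep t acc x) = true := by
  unfold dropStep
  split_ifs with h1
  · exact h1
  · exact h

theorem foldl_dropStep_test {α : Type} [DecidableEq α] {t : List α → Bool} (l : List α)
    {acc : List α} (h : t acc = true) : t (l.foldl (dropStep t) acc) = true := by
  induction l generalizing acc with
  | nil => exact h
  | cons x l ih => exact ih (dropStep_test h x)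

/-- For a monotone test, no element can be dropped from the result. -/
theorem foldl_dropStep_minimal {α : Type} [DecidableEq α] {t : List α → Bool} {L l acc : List α}
    (hmono : ∀ l l', l ⊆ l' → l' ⊆ L → t l = true → t l' = true) (hacc : acc ⊆ L) {x : α}
    (hx : x ∈ l) (hx' : x ∈ l.foldl (dropStep t) acc) :
    ¬ t ((l.foldl (dropStep t) acc).filter fun y => !decide (y = x)) = true := by
  induction l generalizing acc with
  | nil => simp at hx
  | cons a l ih =>
    have hsub := List.Subset.trans (dropStep_subset t acc a) hacc
    rcases List.mem_cons.1 hx with rfl | hx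
    · intro ht
      have h1 := foldl_dropStep_subset t l _ hx'
      have h2 : t (acc.filter fun y => !decide (y = x)) = true := by
        refine hmono _ _ ?_ (List.Subset.trans List.filter_sublist.subset hacc) ht
        intro y hy
        rw [List.mem_filter] at hy ⊢
        exact ⟨foldl_dropStep_subset t (x :: l) _ hy.1, hy.2⟩
      unfold dropStep at h1
      rw [if_pos h2] at h1
      simp at h1
    · exact ih hsub hx hx'

/-- Elements of `G` that can be dropped from every list which contains everything outside of `G`
do not survive if `G` is processed first. -/
theorem foldl_dropStep_removes {α : Type} [DecidableEq α] {t : List α → Bool}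
    {L G l acc : List α} (hl : l ⊆ G) {M : α → Prop}
    (hM : ∀ acc ⊆ L, (∀ x ∈ L, x ∉ G → x ∈ acc) → t acc = true → ∀ x, M x →
      t (acc.filter fun y => !decide (y = x)) = true)
    (hacc : acc ⊆ L) (hG : ∀ x ∈ L, x ∉ G → x ∈ acc) (ht : t acc = true) {x : α} (hx : x ∈ l)
    (hxM : M x) : x ∉ l.foldl (dropStep t) acc := by
  induction l generalizing acc with
  | nil => simp at hx
  | cons a l ih =>
    rcases List.mem_cons.1 hx with rfl | hx
    · intro h1
      have h1 := foldl_dropStep_subset t l _ h1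
      unfold dropStep at h1
      rw [if_pos (hM acc hacc hG ht x hxM)] at h1
      simp at h1
    · refine ih (fun y hy => hl (List.mem_cons_of_mem _ hy))
        (List.Subset.trans (dropStep_subset t acc a) hacc) (fun y hy hyG => ?_)
        (dropStep_test ht a) hx
      have h1 := hG y hy hyG
      unfold dropStep
      split_ifs
      · refine List.mem_filter.2 ⟨h1, ?_⟩
        have : y ≠ a := fun h => hyG (h ▸ hl List.mem_cons_self)
        simpa using this
      · exact h1

theorem atomsOf_filter (l : List (RawAtom V)) (f : Atom S V) :
    atomsOf S (l.filter fun y => !decide (y = f.raw)) = atomsOf S l \ {f} := by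
  ext g
  simp only [atomsOf, Set.mem_ofPred_eq, List.mem_filter, Set.mem_sdiff, Set.mem_singleton_iff,
    Bool.not_eq_true', decide_eq_false_iff_not, Atom.raw_injective.eq_iff]

/-- Greedy minimization finds a critical positive example. It contains no fact of a set `M` of
facts that are processed early and are not needed as long as all late facts are present. -/
theorem crit_minimize (q : CQ S k) {G L : List (RawAtom V)} (hG : G ⊆ L) (hL : WF S L)
    {pt : Fin k → V} (hpos : Pos q.conjuncts q.headVar (atomsOf S L) pt) :
    Crit q.conjuncts q.headVar
      (atomsOf S (nub (minimize q.Mem (List.ofFn pt, G ++ L)))) pt ∧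
    nub (minimize q.Mem (List.ofFn pt, G ++ L)) ⊆ L ∧
    ∀ M : Set (Atom S V), M ⊆ atomsOf S G →
      (∀ T ⊆ atomsOf S L, (∀ f ∈ atomsOf S L, f ∉ atomsOf S G → f ∈ T) →
        Pos q.conjuncts q.headVar T pt → Pos q.conjuncts q.headVar (T \ M) pt) →
      ∀ f ∈ M, f ∉ atomsOf S (nub (minimize q.Mem (List.ofFn pt, G ++ L))) := by
  let t : List (RawAtom V) → Bool := fun l => ask q.Mem (compress (List.ofFn pt, l))
  have hGL : G ++ L ⊆ L := List.append_subset.2 ⟨hG, List.Subset.refl _⟩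
  have hLG : L ⊆ G ++ L := List.subset_append_right _ _
  have ht : ∀ l ⊆ L, t l = true ↔ Pos q.conjuncts q.headVar (atomsOf S l) pt := fun l hl =>
    ask_compress q (hL.mono hl) pt
  have hmono : ∀ l l', l ⊆ l' → l' ⊆ L → t l = true → t l' = true := by
    intro l l' h h' h1
    rw [ht _ (List.Subset.trans h h')] at h1
    rw [ht _ h']
    exact h1.mono (atomsOf_mono h)
  have ht0 : t (G ++ L) = true := by
    rw [ht _ hGL]
    exact hpos.mono (atomsOf_mono hLG)
  have hres : minimize q.Mem (List.ofFn pt, G ++ L) =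
      (G ++ L).foldl (dropStep t) (G ++ L) := rfl
  rw [hres]
  set K := (G ++ L).foldl (dropStep t) (G ++ L) with hK
  have hKL : K ⊆ L := List.Subset.trans (foldl_dropStep_subset t _ _) hGL
  have hnub : atomsOf S (nub K) = atomsOf S K := by
    ext f; exact mem_nub
  rw [hnub]
  refine ⟨⟨?_, ?_⟩, fun p hp => hKL (mem_nub.1 hp), ?_⟩
  · rw [← ht _ hKL]
    exact foldl_dropStep_test _ ht0
  · intro F' hF' hpos'
    by_contra hne
    obtain ⟨f, hf, hf'⟩ := Set.exists_of_ssubset (hF'.ssubset_of_ne hne)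
    have h1 := foldl_dropStep_minimal (acc := G ++ L) hmono hGL (x := f.raw)
      (hLG (hKL hf)) hf
    refine h1 ?_
    rw [ht _ (List.Subset.trans List.filter_sublist.subset hKL), atomsOf_filter]
    exact hpos'.mono fun g hg => ⟨hF' hg, fun h => hf' (h ▸ hg)⟩
  · intro M hMG hM f hf hfK
    have h1 : f.raw ∉ G.foldl (dropStep t) (G ++ L) := by
      refine foldl_dropStep_removes (L := L) (G := G) (M := fun p => ∃ f ∈ M, f.raw = p)
        (List.Subset.refl _) ?_ hGL (fun x hx _ => hLG hx) ht0 (hMG hf) ⟨f, hf, rfl⟩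
      rintro acc hacc hG' hta _ ⟨f, hf, rfl⟩
      rw [ht _ hacc] at hta
      rw [ht _ (List.Subset.trans List.filter_sublist.subset hacc), atomsOf_filter]
      refine (hM _ (atomsOf_mono hacc) (fun g hg hg' => hG' _ hg hg') hta).mono ?_
      exact fun g hg => ⟨hg.1, fun h => hg.2 (h ▸ hf)⟩
    refine h1 (foldl_dropStep_subset t L _ ?_)
    rw [← List.foldl_append]
    exact hfK

/-! ### The invariant of the main loop -/

/-- The structure `A` is a compressed critical example, and its distinguished elements have the
same equality pattern as the answer variables of `q`. -/
structure Inv (q : CQ S k) (A : RawStr) (pt : Fin k → ℕ) : Prop where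
  wf : WF S A.2.2
  nodup : A.2.2.Nodup
  pts : A.2.1 = List.ofFn pt
  crit : Crit q.conjuncts q.headVar (atomsOf S A.2.2) pt
  pattern : ∀ l l', pt l = pt l' → q.headVar l = q.headVar l'
  occ : Occ (atomsOf S A.2.2) = {i | i < A.1}

theorem inv_compress (q : CQ S k) {K : List (RawAtom V)} {pt : Fin k → V} (hK : WF S K)
    (hnd : K.Nodup) (hcrit : Crit q.conjuncts q.headVar (atomsOf S K) pt)
    (hpat : ∀ l l', pt l = pt l' → q.headVar l = q.headVar l') :
    Inv q (compress (List.ofFn pt, K)) fun l => (elements K).idxOf (pt l) := by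
  have hinj := idxOf_injOn K hK
  have hraw : (compress (List.ofFn pt, K)).2.2 =
    K.map fun p => (p.1, p.2.map fun v => (elements K).idxOf v) := rfl
  have hocc := hcrit.1.pt_mem q.occ_conjuncts
  refine ⟨hK.rename _, ?_, ?_, ⟨?_, ?_⟩, ?_, occ_compress hK _⟩
  · rw [hraw]
    refine List.Nodup.map_on (fun p hp p' hp' heq => ?_) hnd
    obtain ⟨f, rfl⟩ := hK p hp
    obtain ⟨f', rfl⟩ := hK p' hp'
    rw [← Atom.raw_map, ← Atom.raw_map] at heq
    rw [Atom.map_injOn hinj hp hp' (Atom.raw_injective heq)]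
  · change (List.ofFn pt).map _ = _
    rw [List.map_ofFn]
    rfl
  · rw [hraw, atomsOf_rename hK]
    exact hcrit.1.map _ (fun f hf => ⟨f, hf, rfl⟩) fun _ => rfl
  · rw [hraw, atomsOf_rename hK]
    intro F' hF' hpos
    -- pull `F'` back along the renaming
    have h1 : atomsOf S K ∩ Atom.map (fun v => (elements K).idxOf v) ⁻¹' F' = atomsOf S K := by
      refine hcrit.2 _ Set.inter_subset_left ?_
      obtain ⟨ν, hν1, hν2⟩ := hpos
      have hν : ∀ u, ∃ v ∈ Occ (atomsOf S K), (elements K).idxOf v = ν u := by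
        intro u
        obtain ⟨g, hg, i, rfl⟩ := q.occ_conjuncts u
        obtain ⟨f, hf, hfg⟩ := hF' (hν1 g hg)
        have h2 : ν (g.args i) ∈ Occ (Atom.map (fun v => (elements K).idxOf v) '' atomsOf S K) :=
          ⟨_, ⟨f, hf, hfg⟩, i, rfl⟩
        rw [Occ.image] at h2
        exact h2
      choose μ hμ1 hμ2 using hν
      refine ⟨μ, fun g hg => ?_, fun l => hinj (hμ1 _) (hocc l) ?_⟩
      · have h3 : (g.map μ).map (fun v => (elements K).idxOf v) = g.map ν :=
          Atom.map_congr (h := fun u => (elements K).idxOf (μ u)) fun i => hμ2 _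
        refine ⟨?_, ?_⟩
        · obtain ⟨f, hf, hfg⟩ := hF' (hν1 g hg)
          rw [← h3] at hfg
          have h4 : f = g.map μ := by
            refine Atom.map_injOn (F := atomsOf S K ∪ {g.map μ}) (hinj.mono ?_)
              (Or.inl hf) (Or.inr rfl) hfg
            rintro _ ⟨f', hf' | rfl, i, rfl⟩
            · exact ⟨f', hf', i, rfl⟩
            · exact hμ1 _
          exact h4 ▸ hf
        · change (g.map μ).map _ ∈ F'
          rw [h3]
          exact hν1 g hg
      · exact (hμ2 _).trans (hν2 l)
    refine hF'.antisymm ?_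
    rintro _ ⟨f, hf, rfl⟩
    rw [← h1] at hf
    exact hf.2
  · intro l l' hll
    exact hpat _ _ (hinj (hocc l) (hocc l') hll)

theorem size_compress {K : List (RawAtom V)} (hK : WF S K) (hnd : K.Nodup) (pts : List V) :
    (compress (pts, K)).1 + (compress (pts, K)).2.2.length =
      (Occ (atomsOf S K)).ncard + (atomsOf S K).ncard := by
  rw [ncard_occ hK, ncard_atomsOf hK hnd]
  simp [compress]

end

/-! ### The two expansions -/

section

variable {S : Schema} {V Λ : Type} {k : ℕ}

theorem mem_labelings {r : ℕ} {L : List Λ} {l : List V} (h : l.length ≤ r) {s : List (V × Λ)} :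
    s ∈ labelings r L l ↔ s.map Prod.fst = l ∧ ∀ p ∈ s, p.2 ∈ L := by
  induction r generalizing l s with
  | zero =>
    obtain rfl : l = [] := List.length_eq_zero_iff.1 (by omega)
    simp only [labelings, List.mem_singleton, List.map_eq_nil_iff]
    exact ⟨by rintro rfl; simp, fun h => h.1⟩
  | succ r ih =>
    cases l with
    | nil =>
      simp only [labelings, listCase, List.mem_singleton, List.map_eq_nil_iff]
      exact ⟨by rintro rfl; simp, fun h => h.1⟩
    | cons a t =>
      have h' : t.length ≤ r := by simpa using h
      simp only [labelings, listCase, List.mem_flatMap, List.mem_map, ih h']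
      constructor
      · rintro ⟨b, hb, s', ⟨hs1, hs2⟩, rfl⟩
        simp only [List.map_cons, hs1, List.mem_cons, true_and]
        rintro p (rfl | hp)
        · exact hb
        · exact hs2 p hp
      · rintro ⟨h1, h2⟩
        cases s with
        | nil => simp at h1
        | cons p s =>
          simp only [List.map_cons, List.cons.injEq] at h1
          obtain ⟨rfl, rfl⟩ := h1
          exact ⟨p.2, h2 p (by simp), s, ⟨rfl, fun p' hp' => h2 p' (by simp [hp'])⟩, rfl⟩

theorem mem_blowup {R : ℕ} (hR : ∀ r, S.arity r ≤ R) {L : List Λ} {F : List (RawAtom V)}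
    (hF : WF S F) {f : Atom S (V × Λ)} : f ∈ atomsOf S (blowup R L F) ↔
      f.map Prod.fst ∈ atomsOf S F ∧ ∀ j, (f.args j).2 ∈ L := by
  have hlen : ∀ g : Atom S V, g.raw.2.length ≤ R := fun g => by simp [Atom.raw, hR]
  have hall : (∀ j, (f.args j).2 ∈ L) ↔ ∀ p ∈ f.raw.2, p.2 ∈ L := by
    simp [Atom.raw, List.mem_ofFn]
  rw [hall]
  simp only [atomsOf, Set.mem_ofPred_eq, blowup, List.mem_flatMap, List.mem_map]
  constructor
  · rintro ⟨p, hp, s, hs, hsf⟩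
    obtain ⟨g, rfl⟩ := hF p hp
    rw [mem_labelings (hlen g)] at hs
    rw [← hsf, Atom.raw_map, ← hsf]
    refine ⟨?_, hs.2⟩
    dsimp only
    rw [hs.1]
    exact hp
  · rintro ⟨h1, h2⟩
    refine ⟨_, h1, f.raw.2, (mem_labelings (hlen _)).2 ⟨?_, h2⟩, ?_⟩
    · rw [Atom.raw_map]
    · rw [Atom.raw_map]

theorem WF.blowup {R : ℕ} (hR : ∀ r, S.arity r ≤ R) {L : List Λ} {F : List (RawAtom V)}
    (hF : WF S F) : WF S (blowup R L F) := by
  intro p hp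
  obtain ⟨p', hp', hp⟩ := List.mem_flatMap.1 hp
  obtain ⟨s, hs, rfl⟩ := List.mem_map.1 hp
  obtain ⟨g, rfl⟩ := hF p' hp'
  rw [mem_labelings (by simp [Atom.raw, hR])] at hs
  obtain ⟨f, -, hf⟩ := exists_raw_eq g.rel s (by
    rw [← List.length_map (f := Prod.fst), hs.1]; simp [Atom.raw])
  exact ⟨f, hf⟩

/-- A blow-up of a critical example is minimized to a critical example `K`, which is larger or
contains a section. The facts in `p` are processed first, so `K` contains no fact of a set `M ⊆ p`
that is not needed as long as all facts outside of `p` are present. -/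
theorem expand_step (q : CQ S k) {A : RawStr} {pt : Fin k → ℕ} (hA : Inv q A pt)
    [DecidableEq Λ] {L : List Λ} {δ : Λ} (hδ : δ ∈ L) (p : RawAtom (ℕ × Λ) → Bool) {R : ℕ}
    (hR : ∀ r, S.arity r ≤ R) {A' : RawStr}
    (hA' : A' = shrink q.Mem (A.2.1.map fun v => (v, δ),
      ((blowup R L A.2.2).filter fun f => p f) ++ blowup R L A.2.2)) :
    (∃ pt', Inv q A' pt') ∧ ∃ K ⊆ atomsOf S (blowup R L A.2.2),
      (∀ M ⊆ {f ∈ atomsOf S (blowup R L A.2.2) | p f.raw = true},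
        (∀ T ⊆ atomsOf S (blowup R L A.2.2),
          (∀ f ∈ atomsOf S (blowup R L A.2.2), ¬ p f.raw = true → f ∈ T) →
          Pos q.conjuncts q.headVar T (fun l => (pt l, δ)) →
          Pos q.conjuncts q.headVar (T \ M) fun l => (pt l, δ)) → ∀ f ∈ M, f ∉ K) ∧
      (grows A A' = false → ∃ s : ℕ → ℕ × Λ, (∀ v ∈ Occ (atomsOf S A.2.2), (s v).1 = v) ∧
        (∀ f ∈ atomsOf S A.2.2, f.map s ∈ K) ∧ ∀ l, s (pt l) = (pt l, δ)) := by
  have hpts : (A.2.1.map fun v => (v, δ)) = List.ofFn fun l => (pt l, δ) := by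
    rw [hA.pts, List.map_ofFn]; rfl
  rw [hpts] at hA'
  have hwf : WF S (blowup R L A.2.2) := hA.wf.blowup hR
  have hpos : Pos q.conjuncts q.headVar (atomsOf S (blowup R L A.2.2)) fun l => (pt l, δ) := by
    refine hA.crit.1.map (fun v => (v, δ)) (fun f hf => ?_) fun _ => rfl
    exact (mem_blowup hR hA.wf).2 ⟨hf, fun _ => hδ⟩
  obtain ⟨hcrit, hsub, hrem⟩ := crit_minimize q
    (G := (blowup R L A.2.2).filter fun f => p f) List.filter_sublist.subset hwf hpos
  have hKwf := hwf.mono hsub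
  have hKnd : (nub (minimize q.Mem (List.ofFn fun l => (pt l, δ),
      ((blowup R L A.2.2).filter fun f => p f) ++ blowup R L A.2.2))).Nodup := nodup_nub _
  have hinv := inv_compress q hKwf hKnd hcrit fun l l' h =>
    hA.pattern l l' (congrArg Prod.fst h)
  refine ⟨⟨_, by rw [hA']; exact hinv⟩, _, atomsOf_mono hsub, ?_, ?_⟩
  · intro M hM hM'
    have hfil : ∀ f, f ∈ atomsOf S ((blowup R L A.2.2).filter fun f => p f) ↔
        f ∈ atomsOf S (blowup R L A.2.2) ∧ p f.raw = true := fun f => List.mem_filter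
    refine hrem M (fun f hf => (hfil f).2 (hM hf)) fun T hT hT' => hM' T hT fun f hf hpf => ?_
    exact hT' f hf fun h => hpf ((hfil f).1 h).2
  · intro hg
    have : Nonempty (ℕ × Λ) := ⟨(0, δ)⟩
    refine hA.crit.exists_section q.occ_conjuncts hcrit.1 (atomsOf_finite _) Prod.fst
      (fun f hf => ((mem_blowup hR hA.wf).1 (atomsOf_mono hsub hf)).1) (fun _ => rfl) ?_
    rw [← size_compress hKwf hKnd (List.ofFn fun l => (pt l, δ)), hA.occ,
      ncard_atomsOf hA.wf hA.nodup]
    have h1 : ({i | i < A.1} : Set ℕ).ncard = A.1 := by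
      rw [show {i | i < A.1} = Set.Iio A.1 from rfl, ← Finset.coe_Iio, Set.ncard_coe_finset]
      simp
    rw [h1]
    rw [hA'] at hg
    exact not_lt.1 (of_decide_eq_false hg)

theorem coverAllowed_iff {A : RawStr} {pt : Fin k → ℕ} (hpt : A.2.1 = List.ofFn pt)
    (f : Atom S (ℕ × CoverLabel)) :
    coverAllowed A f.raw = true ↔ CoverAllowed (Set.range pt) dummy A.1 f := by
  have hlen : f.raw.2.length = S.arity f.rel := by simp [Atom.raw]
  have hdrop : ∀ j : Fin (S.arity f.rel), ∃ t, f.raw.2.drop j = f.args j :: t := by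
    intro j
    have hj : (j : ℕ) < f.raw.2.length := by rw [hlen]; exact j.2
    refine ⟨f.raw.2.drop (j + 1), (List.drop_eq_getElem_cons hj).trans ?_⟩
    congr 1
    simp [Atom.raw]
  have hraw : (f.raw.1, f.raw.2.map fun p => p.1) = (f.map Prod.fst).raw :=
    (Atom.raw_map Prod.fst f).symm
  have hmem : ∀ v, v ∈ A.2.1 ↔ v ∈ Set.range pt := fun v => by
    rw [hpt, List.mem_ofFn]; rfl
  unfold coverAllowed CoverAllowed
  rw [hlen, hraw]
  simp only [List.any_eq_true, List.mem_range, List.all_eq_true]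
  constructor
  · rintro ⟨i, hi, d, hd, h⟩
    refine ⟨⟨i, hi⟩, d, hd, fun j => ?_⟩
    have h1 := h j j.2
    obtain ⟨t, ht⟩ := hdrop j
    rw [ht] at h1
    simp only [listCase, decide_eq_true_eq, hmem] at h1
    refine ⟨fun h2 => ?_, fun h2 => ⟨fun h3 => ?_, fun h3 => ?_⟩⟩
    · simpa [h2] using h1
    · subst h3
      simpa [h2] using h1
    · have h4 : (j : ℕ) ≠ i := fun h5 => h3 (Fin.ext h5)
      simpa [h2, h4] using h1
  · rintro ⟨i, d, hd, h⟩
    refine ⟨i, i.2, d, hd, fun j hj => ?_⟩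
    obtain ⟨t, ht⟩ := hdrop ⟨j, hj⟩
    dsimp only at ht
    obtain ⟨h1, h2⟩ := h ⟨j, hj⟩
    rw [ht]
    simp only [listCase, decide_eq_true_eq, hmem]
    by_cases h3 : (f.args ⟨j, hj⟩).1 ∈ Set.range pt
    · simpa [h3] using h1 h3
    · by_cases h4 : j = i
      · rw [if_neg h3, if_pos h4]
        exact decide_eq_true ((h2 h3).1 (Fin.ext h4))
      · rw [if_neg h3, if_neg h4]
        exact decide_eq_true ((h2 h3).2 fun h5 => h4 (congrArg Fin.val h5))

theorem mem_coverLabels {A : RawStr} (hA : WF S A.2.2) {R : ℕ} {b : CoverLabel} :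
    b ∈ coverLabels R A ↔ b ∈ CoverLab (atomsOf S A.2.2) dummy A.1 R := by
  simp only [coverLabels, List.mem_cons, List.mem_flatMap, List.mem_map, List.mem_range, CoverLab,
    Set.mem_ofPred_eq]
  refine or_congr Iff.rfl ⟨?_, ?_⟩
  · rintro ⟨p, hp, i, hi, d, hd, rfl⟩
    obtain ⟨f, rfl⟩ := hA p hp
    exact ⟨f, hp, i, hi, d, hd, rfl⟩
  · rintro ⟨f, hf, i, hi, d, hd, rfl⟩
    exact ⟨_, hf, i, hi, d, hd, rfl⟩

/-- If the cover yields no larger structure, then the structure is c-acyclic. -/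
theorem cover_step (q : CQ S k) (hq : Acyc q.conjuncts (Set.range q.headVar)) {A : RawStr}
    {pt : Fin k → ℕ} (hA : Inv q A pt) {R : ℕ} (hR : ∀ r, S.arity r ≤ R) :
    (∃ pt', Inv q (shrink q.Mem (coverBlowup R A)) pt') ∧
      (grows A (shrink q.Mem (coverBlowup R A)) = false →
        Acyc (atomsOf S A.2.2) (Set.range pt)) := by
  obtain ⟨h1, K, hK, hrem, hsec⟩ := expand_step q hA (L := coverLabels R A) (δ := dummy)
    List.mem_cons_self (fun f => !coverAllowed A f) hR (A' := shrink q.Mem (coverBlowup R A)) rfl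
  refine ⟨h1, fun hg => ?_⟩
  obtain ⟨s, hs1, hs2, -⟩ := hsec hg
  have hnot : ∀ f : Atom S (ℕ × CoverLabel), (!coverAllowed A f.raw) = true ↔
      ¬ CoverAllowed (Set.range pt) dummy A.1 f := fun f => by
    rw [← coverAllowed_iff hA.pts]; simp
  have hK' : ∀ f ∈ K, CoverAllowed (Set.range pt) dummy A.1 f := by
    intro f hf
    by_contra hbad
    refine hrem {f ∈ atomsOf S (blowup R (coverLabels R A) A.2.2) |
      (!coverAllowed A f.raw) = true} (Set.Subset.refl _) (fun T hT hT' _ => ?_) f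
      ⟨hK hf, (hnot f).2 hbad⟩ hf
    refine (Pos.cover (R := R) (δ := dummy) (n := A.1) hA.crit.1 hq q.finite_conjuncts hR
      (Nat.succ_pos _)).mono ?_
    rintro g ⟨hg1, hg2, hg3⟩
    have hgb : g ∈ atomsOf S (blowup R (coverLabels R A) A.2.2) :=
      (mem_blowup hR hA.wf).2 ⟨hg1, fun j => (mem_coverLabels hA.wf).2 (hg2 j)⟩
    have hg4 : ¬ (!coverAllowed A g.raw) = true := fun h => (hnot g).1 h hg3
    exact ⟨hT' g hgb hg4, fun h => hg4 h.2⟩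
  refine acyc_of_section (n := A.1) (δ := dummy) (atomsOf_finite _) ?_ s hs1
    fun f hf => hK' _ (hs2 f hf)
  rw [hA.occ, show {i | i < A.1} = Set.Iio A.1 from rfl, ← Finset.coe_Iio, Set.ncard_coe_finset]
  simp

theorem frontGood_iff {A : RawStr} {pt : Fin k → ℕ} (hpt : A.2.1 = List.ofFn pt)
    (f : Atom S (ℕ × RawAtom ℕ)) :
    frontGood A f.raw = true ↔ FrontGood (Set.range pt) f := by
  have hraw : (f.raw.1, f.raw.2.map fun p => p.1) = (f.map Prod.fst).raw :=
    (Atom.raw_map Prod.fst f).symm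
  have hmem : ∀ v, v ∈ A.2.1 ↔ v ∈ Set.range pt := fun v => by
    rw [hpt, List.mem_ofFn]; rfl
  unfold frontGood FrontGood
  rw [hraw]
  have hall : ∀ P : ℕ × RawAtom ℕ → Prop, (∀ p ∈ f.raw.2, P p) ↔ ∀ j, P (f.args j) := by
    intro P; simp [Atom.raw, List.mem_ofFn]
  rw [List.all_eq_true, hall]
  refine forall_congr' fun j => ?_
  simp only [decide_eq_true_eq, hmem]
  by_cases h : (f.args j).1 ∈ Set.range pt
  · simp only [h, if_true, not_true, decide_eq_true_eq, forall_const, false_imp_iff, and_true]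
  · simp only [h, if_false, not_false_iff, forall_const, false_imp_iff, true_and,
      Bool.or_eq_true, decide_eq_true_eq, Bool.not_eq_true', decide_eq_false_iff_not]

theorem mem_frontBlowup {A : RawStr} (hA : WF S A.2.2) {R : ℕ} (hR : ∀ r, S.arity r ≤ R) :
    atomsOf S (blowup R (frontLabels A) A.2.2) = FrontLifts (atomsOf S A.2.2) := by
  ext f
  rw [mem_blowup hR hA]
  refine and_congr Iff.rfl (forall_congr' fun j => ?_)
  simp only [frontLabels, List.mem_cons]
  refine or_congr Iff.rfl ⟨fun h => ?_, ?_⟩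
  · obtain ⟨f', hf'⟩ := hA _ h
    exact ⟨f', by rw [atomsOf, Set.mem_ofPred_eq, hf']; exact h, hf'.symm⟩
  · rintro ⟨f', hf', h⟩
    rw [h]; exact hf'

/-- If the structure is c-acyclic and weakening it yields no larger structure, then it maps to
`q`. -/
theorem front_step (q : CQ S k) {A : RawStr} {pt : Fin k → ℕ} (hA : Inv q A pt) {R : ℕ}
    (hR : ∀ r, S.arity r ≤ R) :
    (∃ pt', Inv q (shrink q.Mem (frontBlowup R A)) pt') ∧
      (grows A (shrink q.Mem (frontBlowup R A)) = false →
        Acyc (atomsOf S A.2.2) (Set.range pt) → Nonempty q.Var →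
        ∃ s : ℕ → q.Var, (∀ f ∈ atomsOf S A.2.2, f.map s ∈ q.conjuncts) ∧
          ∀ l, s (pt l) = q.headVar l) := by
  obtain ⟨h1, K, hK, hrem, hsec⟩ := expand_step q hA (L := frontLabels A) (δ := (0, []))
    List.mem_cons_self (fun f => frontGood A f) hR (A' := shrink q.Mem (frontBlowup R A)) rfl
  refine ⟨h1, fun hg hac hne => ?_⟩
  obtain ⟨s, hs1, hs2, hs3⟩ := hsec hg
  obtain ⟨r, hr⟩ := hac.exists_forestRank (atomsOf_finite _)
  rw [mem_frontBlowup hA.wf hR] at hK hrem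
  refine exists_hom_of_realized hr (atomsOf_finite _) hA.pattern fun t ht hroot => ?_
  by_contra hnr
  refine no_section hr (atomsOf_finite _) ht hroot hK (fun f hf hbad => ?_) s hs1 hs2 hs3
  refine hrem {f ∈ FrontLifts (atomsOf S A.2.2) | FrontGood (Set.range pt) f ∧
    Relation.ReflTransGen (Par (atomsOf S A.2.2) (Set.range pt) r) (f.map Prod.fst) t}
    (fun g hg => ⟨hg.1, (frontGood_iff hA.pts g).2 hg.2.1⟩) (fun T hT hT' hpos => ?_) f
    ⟨hK hf, hbad⟩ hf
  refine (hpos.weaken hr q.occ_conjuncts hA.pattern hroot hnr hT fun g hg hgood =>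
    hT' g hg fun h => hgood ((frontGood_iff hA.pts g).1 h)).mono ?_
  exact fun g hg => ⟨hg.1, fun h => hg.2 h.2⟩

end

/-! ### The initial structure -/

section

variable {S : Schema} {k : ℕ}

theorem ask_example (q : CQ S k) (E : Example S k) : ask q.Mem E.raw = true ↔
    Pos q.conjuncts q.headVar {f | f ∈ E.facts} E.pt := by
  rw [ask_eq_true, Example.enc_raw]
  constructor
  · rintro ⟨E', hE', hpos⟩
    rw [← Example.enc_raw, ← Example.enc_raw] at hE'
    have hE' := enc_rawStr_injective hE'
    obtain ⟨n, facts, pt⟩ := E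
    obtain ⟨n', facts', pt'⟩ := E'
    obtain rfl : n' = n := congrArg Prod.fst hE'
    have h1 : (List.ofFn fun l => (pt' l : ℕ)) = List.ofFn fun l => (pt l : ℕ) :=
      congrArg (fun A => A.2.1) hE'
    have h2 : (facts'.map fun f => (f.map Fin.val).raw) = facts.map fun f => (f.map Fin.val).raw :=
      congrArg (fun A => A.2.2) hE'
    obtain rfl : facts' = facts := List.map_injective_iff.2
      (Atom.raw_injective.comp (Atom.map_injective Fin.val_injective)) h2
    obtain rfl : pt' = pt := funext fun l => Fin.ext (congrFun (List.ofFn_injective h1) l)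
    exact hpos
  · exact fun h => ⟨E, rfl, h⟩

theorem Example.mem_raw (E : Example S k) {f : Atom S (Fin E.n)} (hf : f ∈ E.facts) :
    f.map Fin.val ∈ atomsOf S E.raw.2.2 := List.mem_map.2 ⟨f, hf, rfl⟩

theorem Example.wf_raw (E : Example S k) : WF S E.raw.2.2 := by
  intro p hp
  obtain ⟨f, -, rfl⟩ := List.mem_map.1 hp
  exact ⟨_, rfl⟩

/-- The structure with the elements `0, …, k` and all possible facts, with the distinguished
elements given by `π`. The element `k`, which is not distinguished, makes it nonempty even for
`k = 0`. -/
noncomputable def fullExample (S : Schema) {k : ℕ} (π : Fin k → Fin k) : Example S k where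
  n := k + 1
  facts := (Finset.univ : Finset (Σ r : Fin S.numRel, Fin (S.arity r) → Fin (k + 1))).toList.map
    fun p => ⟨p.1, p.2⟩
  pt := fun l => (π l).castSucc

theorem mem_fullExample (π : Fin k → Fin k) (f : Atom S (Fin (k + 1))) :
    f ∈ (fullExample S π).facts :=
  List.mem_map.2 ⟨⟨f.rel, f.args⟩, by simp, rfl⟩

/-- A query maps to the structure of all facts unless the distinguished elements prevent it. -/
theorem ask_fullExample (q : CQ S k) (π : Fin k → Fin k) :
    ask q.Mem (fullExample S π).raw = true ↔
      ∀ l l', q.headVar l = q.headVar l' → π l = π l' := by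
  rw [ask_example]
  constructor
  · rintro ⟨ν, -, h⟩ l l' hl
    have h1 : (π l).castSucc = (π l').castSucc := by
      rw [show (π l).castSucc = (fullExample S π).pt l from rfl, ← h, hl, h]; rfl
    exact Fin.castSucc_injective _ h1
  · intro h
    classical
    refine ⟨fun u => if H : ∃ l, q.headVar l = u then (π H.choose).castSucc else Fin.last k,
      fun g _ => mem_fullExample π _, fun l => ?_⟩
    have H : ∃ l', q.headVar l' = q.headVar l := ⟨l, rfl⟩
    exact (dif_pos H).trans (congrArg Fin.castSucc (h _ _ H.choose_spec))

/-- All maps from the `k` answer positions to `k` elements, those with larger images first. -/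
noncomputable def patterns (k : ℕ) : List (Fin k → Fin k) :=
  (Finset.univ : Finset (Fin k → Fin k)).toList.insertionSort
    fun π π' => (Finset.univ.image π').card ≤ (Finset.univ.image π).card

/-- On a list that is sorted by decreasing `c`, the first positive structure has the largest `c`
among the positive ones. -/
theorem exists_firstPositive {O : Oracle} {α : Type} {l : List α} {e : α → RawStr} {a : α}
    {c : α → ℕ} (hl : l.Pairwise fun x y => c y ≤ c x) (ha : a ∈ l) (hO : ask O (e a) = true) :
    ∃ b, firstPositive O (l.map e) = e b ∧ ask O (e b) = true ∧ c a ≤ c b := by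
  induction l with
  | nil => simp at ha
  | cons x l ih =>
    rw [List.pairwise_cons] at hl
    by_cases hx : ask O (e x) = true
    · refine ⟨x, by simp [firstPositive, hx], hx, ?_⟩
      rcases List.mem_cons.1 ha with rfl | ha
      · exact le_rfl
      · exact hl.1 a ha
    · rcases List.mem_cons.1 ha with rfl | ha
      · exact (hx hO).elim
      · obtain ⟨b, hb⟩ := ih hl.2 ha
        exact ⟨b, by simpa [firstPositive, hx] using hb⟩

/-- Some map has exactly the equality pattern of the answer variables, and all positive maps are
coarser. So the first positive map, which has the largest image, has this pattern. -/
theorem exists_initial (q : CQ S k) : ∃ π : Fin k → Fin k,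
    firstPositive q.Mem ((patterns k).map fun π => (fullExample S π).raw) =
      (fullExample S π).raw ∧
    ask q.Mem (fullExample S π).raw = true ∧ ∀ l l', π l = π l' → q.headVar l = q.headVar l' := by
  classical
  let π0 : Fin k → Fin k := fun l => Set.rangeSplitting q.headVar ⟨q.headVar l, l, rfl⟩
  have h0 : ∀ l, q.headVar (π0 l) = q.headVar l := fun l => Set.apply_rangeSplitting _ _
  have h0' : ∀ l l', q.headVar l = q.headVar l' → π0 l = π0 l' := by
    intro l l' h
    simp only [π0]
    congr 2
  let rel : (Fin k → Fin k) → (Fin k → Fin k) → Prop :=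
    fun π π' => (Finset.univ.image π').card ≤ (Finset.univ.image π).card
  have htot : Std.Total rel := ⟨fun π π' => le_total _ _⟩
  have htrans : IsTrans _ rel := ⟨fun _ _ _ h h' => le_trans h' h⟩
  obtain ⟨π, hπ1, hπ2, hπ3⟩ := exists_firstPositive (O := q.Mem)
    (c := fun π : Fin k → Fin k => (Finset.univ.image π).card)
    (e := fun π => (fullExample S π).raw) (l := patterns k) (a := π0)
    (by unfold patterns; exact List.pairwise_insertionSort rel _)
    (by unfold patterns; rw [List.mem_insertionSort]; simp) ((ask_fullExample q π0).2 h0')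
  refine ⟨π, hπ1, hπ2, fun l l' hll => ?_⟩
  rw [ask_fullExample] at hπ2
  have hππ : ∀ l, π (π0 l) = π l := fun l => hπ2 _ _ (h0 l)
  have himg : (Finset.univ.image π0).image π = Finset.univ.image π := by
    rw [Finset.image_image]
    exact Finset.image_congr fun l _ => hππ l
  have hinj : Set.InjOn π (Finset.univ.image π0 : Finset (Fin k)) := by
    rw [← Finset.card_image_iff, himg]
    refine le_antisymm ?_ hπ3
    rw [← himg]
    exact Finset.card_image_le
  have h1 : π0 l = π0 l' := hinj (by simp) (by simp) (by rw [hππ, hππ, hll])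
  rw [← h0 l, h1, h0]

theorem exists_inv_initial (q : CQ S k) : ∃ pt, Inv q (shrink q.Mem
    (firstPositive q.Mem ((patterns k).map fun π => (fullExample S π).raw)).2) pt := by
  obtain ⟨π, h1, h2, h3⟩ := exists_initial q
  rw [h1]
  rw [ask_example] at h2
  have hpos : Pos q.conjuncts q.headVar (atomsOf S (fullExample S π).raw.2.2)
      fun l => ((fullExample S π).pt l : ℕ) :=
    h2.map Fin.val (fun f hf => Example.mem_raw _ hf) fun _ => rfl
  obtain ⟨hcrit, hsub, -⟩ := crit_minimize q (G := []) (List.nil_subset _)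
    (fullExample S π).wf_raw hpos
  refine ⟨_, inv_compress q ((fullExample S π).wf_raw.mono hsub) (nodup_nub _) hcrit
    fun l l' h => h3 l l' ?_⟩
  exact Fin.castSucc_injective _ (Fin.ext h)

/-! ### The main loop -/

theorem Inv.card_le {q : CQ S k} {A : RawStr} {pt : Fin k → ℕ} (h : Inv q A pt) :
    A.1 + A.2.2.length + k ≤ q.size := by
  have := q.finite_var
  obtain ⟨-, h1, h2⟩ := h.crit.finite_and_ncard_le q.finite_conjuncts
  rw [ncard_atomsOf h.wf h.nodup] at h1
  rw [h.occ, show {i | i < A.1} = Set.Iio A.1 from rfl, ← Finset.coe_Iio, Set.ncard_coe_finset,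
    Nat.card_Iio] at h2
  unfold CQ.size
  omega

/-- The representations of the structures in the main loop are of polynomial size. -/
theorem Inv.sz_le {q : CQ S k} {A : RawStr} {pt : Fin k → ℕ} (h : Inv q A pt) {R : ℕ}
    (hR : ∀ r, S.arity r ≤ R) :
    sz A ≤ (2 * q.size + 1) + (q.size * (2 * q.size + 2) + 1) +
      (q.size * (2 * S.numRel + 1 + (R * (2 * q.size + 2) + 1) + 2) + 1) + 2 := by
  have hc := h.card_le
  have hlt : ∀ v ∈ Occ (atomsOf S A.2.2), v < A.1 := fun v hv => by rwa [h.occ] at hv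
  have h1 : sz A.2.1 ≤ q.size * (2 * q.size + 2) + 1 := by
    have h2 : sz A.2.1 ≤ A.2.1.length * (2 * q.size + 2) + 1 := by
      refine sz_list_le fun v hv => ?_
      rw [h.pts, List.mem_ofFn] at hv
      obtain ⟨l, rfl⟩ := hv
      have := hlt _ (h.crit.1.pt_mem q.occ_conjuncts l)
      rw [sz_nat]; omega
    have h3 : A.2.1.length = k := by rw [h.pts, List.length_ofFn]
    rw [h3] at h2
    have := Nat.mul_le_mul_right (2 * q.size + 2) (show k ≤ q.size by omega)
    omega
  have h2 : sz A.2.2 ≤ q.size * (2 * S.numRel + 1 + (R * (2 * q.size + 2) + 1) + 2) + 1 := by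
    have h2 : sz A.2.2 ≤
        A.2.2.length * (2 * S.numRel + 1 + (R * (2 * q.size + 2) + 1) + 2) + 1 := by
      refine sz_list_le fun p hp => ?_
      obtain ⟨f, rfl⟩ := h.wf p hp
      have h3 : sz f.raw.2 ≤ f.raw.2.length * (2 * q.size + 2) + 1 := by
        refine sz_list_le fun v hv => ?_
        have := hlt v ⟨f, hp, Atom.mem_raw.1 hv⟩
        rw [sz_nat]; omega
      have h4 : f.raw.2.length ≤ R := by simp [Atom.raw, hR]
      have h5 := Nat.mul_le_mul_right (2 * q.size + 2) h4
      have h6 : sz f.raw.1 = 2 * (f.rel : ℕ) + 1 := sz_nat _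
      have h7 := f.rel.2
      have h8 : sz f.raw = sz f.raw.1 + sz f.raw.2 + 1 := rfl
      rw [h8]
      omega
    have := Nat.mul_le_mul_right (2 * S.numRel + 1 + (R * (2 * q.size + 2) + 1) + 2)
      (show A.2.2.length ≤ q.size by omega)
    omega
  have h3 : sz A = sz A.1 + (sz A.2.1 + sz A.2.2 + 1) + 1 := rfl
  rw [h3, sz_nat]
  omega

/-- A critical example on which the main loop stops is a query that is equivalent to `q`. -/
theorem Inv.exists_output {q : CQ S k} (hq : Acyc q.conjuncts (Set.range q.headVar)) {A : RawStr}
    {pt : Fin k → ℕ} (h : Inv q A pt) {R : ℕ} (hR : ∀ r, S.arity r ≤ R)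
    (hexit : loopTest R q.Mem A = false) :
    ∃ q' : CQ S k, q'.CAcyclic ∧ enc A.2 = q'.encode ∧ q'.Equivalent q := by
  simp only [loopTest, Bool.or_eq_false_iff] at hexit
  have hac := (cover_step q hq h hR).2 hexit.1
  have hfront := (front_step q h hR).2 hexit.2 hac
  obtain ⟨body, hbody⟩ : A.2.2 ∈ Set.range (List.map (Atom.raw : Atom S ℕ → RawAtom ℕ)) := by
    rw [Set.range_list_map]
    exact fun p hp => h.wf p hp
  have hmem : ∀ f : Atom S ℕ, f ∈ body ↔ f ∈ atomsOf S A.2.2 := fun f => by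
    rw [atomsOf, Set.mem_ofPred_eq, ← hbody, List.mem_map_of_injective Atom.raw_injective]
  let q' : CQ S k := ⟨pt, body, fun l => by
    obtain ⟨f, hf, i, hi⟩ := h.crit.1.pt_mem q.occ_conjuncts l
    exact ⟨f, (hmem f).2 hf, i, hi⟩⟩
  refine ⟨q', ?_, ?_, ?_⟩
  · intro m a f i j hc
    obtain ⟨t, l, hl⟩ := hac m (fun t => (a t).1) (fun t => (f t).map Subtype.val) i j
      ⟨fun t => (hmem _).1 (hc.facts_mem t), Subtype.val_injective.comp hc.elements_distinct,
        (Atom.map_injective Subtype.val_injective).comp hc.facts_distinct,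
        fun t => congrArg Subtype.val (hc.leave t), fun t => congrArg Subtype.val (hc.arrive t),
        hc.edges_distinct⟩
    exact ⟨t, l, Subtype.ext hl.symm⟩
  · change Data.cons (enc A.2.1) (enc A.2.2) = _
    rw [h.pts, ← hbody]
    change Data.cons (Data.ofList ((List.ofFn pt).map Data.ofNat))
      (Data.ofList ((body.map Atom.raw).map enc)) = _
    rw [List.map_ofFn, List.map_map]
    unfold CQ.encode
    congr 2
    exact List.map_congr_left fun f _ => Atom.enc_raw f
  · obtain ⟨s, hs1, hs2⟩ : ∃ s : q'.Var → q.Var, (∀ f ∈ q'.conjuncts, f.map s ∈ q.conjuncts) ∧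
        ∀ l, s (q'.headVar l) = q.headVar l := by
      by_cases hne : Nonempty q.Var
      · obtain ⟨s, hs1, hs2⟩ := hfront hne
        exact ⟨fun v => s v.1, fun f hf => hs1 _ ((hmem _).1 hf), hs2⟩
      · rw [not_nonempty_iff] at hne
        obtain ⟨μ, hμ1, hμ2⟩ := h.crit.1
        have hQ : q.conjuncts = ∅ := Set.eq_empty_of_forall_notMem fun g _ =>
          hne.elim (g.args ⟨0, S.arity_pos _⟩)
        have hF : atomsOf S A.2.2 = ∅ := by
          rw [← h.crit.image_eq hμ1 hμ2, hQ, Set.image_empty]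
        have : IsEmpty q'.Var := ⟨fun ⟨v, f, hf, _⟩ => by
          have := (hmem f).1 hf
          rw [hF] at this
          exact this⟩
        exact ⟨fun v => isEmptyElim v, fun f _ => isEmptyElim (f.args ⟨0, S.arity_pos _⟩),
          fun l => isEmptyElim (q'.headVar l)⟩
    obtain ⟨μ, hμ1, hμ2⟩ := h.crit.1
    have hμ : ∀ u, ∃ f ∈ q'.body, ∃ j, f.args j = μ u := by
      intro u
      obtain ⟨g, hg, i, rfl⟩ := q.occ_conjuncts u
      exact ⟨_, (hmem _).2 (hμ1 g hg), i, rfl⟩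
    intro B
    ext x
    constructor
    · rintro ⟨ν, hν1, hν2⟩
      refine ⟨fun u => ν ⟨μ u, hμ u⟩, fun f hf => hν1 (f.map fun u => ⟨μ u, hμ u⟩) ?_,
        fun l => ?_⟩
      · exact (hmem _).2 (hμ1 f hf)
      · rw [← hν2]
        exact congrArg ν (Subtype.ext (hμ2 l))
    · rintro ⟨ν, hν1, hν2⟩
      refine ⟨fun v => ν (s v), fun f hf => hν1 _ (hs1 f hf), fun l => ?_⟩
      exact (congrArg ν (hs2 l)).trans (hν2 l)

/-- As long as the test holds, the body of the loop preserves the invariant and yields a larger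
structure. -/
theorem Inv.loopBody {q : CQ S k} (hq : Acyc q.conjuncts (Set.range q.headVar)) {A : RawStr}
    {pt : Fin k → ℕ} (h : Inv q A pt) {R : ℕ} (hR : ∀ r, S.arity r ≤ R) :
    (∃ pt', Inv q (loopBody R q.Mem A) pt') ∧ (loopTest R q.Mem A = true →
      A.1 + A.2.2.length < (loopBody R q.Mem A).1 + (loopBody R q.Mem A).2.2.length) := by
  unfold CQLearning.loopBody loopTest
  split_ifs with hg
  · exact ⟨(cover_step q hq h hR).1, fun _ => by simpa [grows] using hg⟩
  · refine ⟨(front_step q h hR).1, fun ht => ?_⟩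
    have : grows A (shrink q.Mem (frontBlowup R A)) = true := by simpa [hg] using ht
    simpa [grows] using this

/-- The main loop stops after at most `q.size` iterations. -/
theorem exists_exit {q : CQ S k} (hq : Acyc q.conjuncts (Set.range q.headVar)) {A : RawStr}
    {pt : Fin k → ℕ} (h : Inv q A pt) {R : ℕ} (hR : ∀ r, S.arity r ≤ R) :
    ∃ m ≤ q.size, (∀ i < m, loopTest R q.Mem ((loopBody R q.Mem)^[i] A) = true) ∧
      loopTest R q.Mem ((loopBody R q.Mem)^[m] A) = false ∧
      ∀ i, ∃ pt', Inv q ((loopBody R q.Mem)^[i] A) pt' := by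
  have hinv : ∀ i, ∃ pt', Inv q ((loopBody R q.Mem)^[i] A) pt' := by
    intro i
    induction i with
    | zero => exact ⟨pt, h⟩
    | succ i ih =>
      obtain ⟨pt', h'⟩ := ih
      rw [Function.iterate_succ_apply']
      exact (h'.loopBody hq hR).1
  have hgrow : ∀ m, (∀ i < m, loopTest R q.Mem ((loopBody R q.Mem)^[i] A) = true) →
      m ≤ q.size := by
    intro m hm
    suffices H : ∀ i ≤ m, i ≤ ((loopBody R q.Mem)^[i] A).1 +
        ((loopBody R q.Mem)^[i] A).2.2.length by
      obtain ⟨pt', h'⟩ := hinv m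
      have h1 := H m le_rfl
      have h2 := h'.card_le
      omega
    intro i hi
    induction i with
    | zero => omega
    | succ i ih =>
      obtain ⟨pt', h'⟩ := hinv i
      have h1 := (h'.loopBody hq hR).2 (hm i (by omega))
      have h2 := ih (by omega)
      rw [Function.iterate_succ_apply']
      omega
  classical
  have hex : ∃ m, loopTest R q.Mem ((loopBody R q.Mem)^[m] A) = false := by
    by_contra hcon
    push Not at hcon
    have := hgrow (q.size + 1) fun i _ => by simpa using hcon i
    omega
  have hmin : ∀ i < Nat.find hex, loopTest R q.Mem ((loopBody R q.Mem)^[i] A) = true :=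
    fun i hi => by simpa using Nat.find_min hex hi
  exact ⟨Nat.find hex, hgrow _ hmin, hmin, Nat.find_spec hex, hinv⟩

/-- The program computes the initial structure, runs the main loop, and removes the size of the
domain from the result, which leaves the representation of a query. -/
theorem efficientlyExactlyLearnable_cAcyclic (S : Schema) (k : ℕ) :
    EfficientlyExactlyLearnable {q : CQ S k | q.CAcyclic} := by
  obtain ⟨R, hR⟩ : ∃ R, ∀ r, S.arity r ≤ R :=
    ⟨Finset.univ.sup S.arity, fun r => Finset.le_sup (Finset.mem_univ r)⟩
  have hinit : PolyTime fun O (_ : Unit) => shrink O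
      (firstPositive O ((patterns k).map fun π => (fullExample S π).raw)).2 :=
    .shrink (.snd (.firstPositive _))
  obtain ⟨PI, pI, hI⟩ := hinit
  obtain ⟨PW, pW, hW⟩ := exists_runs_while (PolyTime.loopTest R) (PolyTime.loopBody R)
  -- the bound of `Inv.sz_le` as a polynomial
  let σ : Polynomial ℕ := (2 * .X + 1) + (.X * (2 * .X + 2) + 1) +
    (.X * (2 * (S.numRel : Polynomial ℕ) + 1 + ((R : Polynomial ℕ) * (2 * .X + 2) + 1) + 2) + 1) + 2
  refine ⟨.seq PI (.seq PW .snd), Polynomial.C (pI.eval 1) + (.X + 1) * pW.comp σ + σ + 2,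
    fun q hq => ?_⟩
  have hq' : Acyc q.conjuncts (Set.range q.headVar) := by
    intro m a f i j hc
    obtain ⟨t, l, hl⟩ := hq m a f i j ⟨hc.1, hc.2, hc.3, hc.4, hc.5, hc.6⟩
    exact ⟨t, l, hl.symm⟩
  obtain ⟨pt, h0⟩ := exists_inv_initial q
  obtain ⟨t1, ht1, ht1'⟩ := hI q.Mem ()
  obtain ⟨m, hm, hm1, hm2, hinv⟩ := exists_exit hq' h0 hR
  have hσ : ∀ i, sz ((loopBody R q.Mem)^[i] (shrink q.Mem
      (firstPositive q.Mem ((patterns k).map fun π => (fullExample S π).raw)).2)) ≤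
      σ.eval q.size := by
    intro i
    obtain ⟨pt', h'⟩ := hinv i
    refine (h'.sz_le hR).trans (le_of_eq ?_)
    simp [σ]
  obtain ⟨t2, ht2, ht2'⟩ := hW q.Mem m (σ.eval q.size) (fun i => (loopBody R q.Mem)^[i] _)
    (fun i hi => ⟨hm1 i hi, Function.iterate_succ_apply' _ _ _⟩) hm2 fun i _ => hσ i
  obtain ⟨pt', h'⟩ := hinv m
  obtain ⟨q', hq1, hq2, hq3⟩ := h'.exists_output hq' hR hm2
  have hsnd : ∀ A : RawStr, Runs q.Mem .snd (enc A) (enc A.2) (sz A) := fun A => .snd_cons _ _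
  have hsnd := hsnd ((loopBody R q.Mem)^[m] (shrink q.Mem
    (firstPositive q.Mem ((patterns k).map fun π => (fullExample S π).raw)).2))
  rw [hq2] at hsnd
  refine ⟨q', hq1, _, .seq ht1 (.seq ht2 hsnd), hq3, ?_⟩
  have h1 := hσ m
  have h2 := Nat.mul_le_mul_right (pW.eval (σ.eval q.size)) (Nat.add_le_add_right hm 1)
  have h3 : sz () = 1 := rfl
  rw [h3] at ht1'
  simp only [Polynomial.eval_add, Polynomial.eval_mul, Polynomial.eval_comp, Polynomial.eval_one,
    Polynomial.eval_ofNat, Polynomial.eval_X, Polynomial.eval_C]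
  omega

end

end CQLearning

theorem theorem5p2 (S : CQLearning.Schema) (k : ℕ) :
    CQLearning.EfficientlyExactlyLearnable {q : CQLearning.CQ S k | q.CAcyclic} :=
  CQLearning.efficientlyExactlyLearnable_cAcyclic S k
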